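/- In the Minimum Eccentricity Shortest Path Problem (MESP), one is given a finite connected simple undirected graph $G$ and an integer $k \ge 0$, and has to decide whether $G$ contains a path $P$ that is a shortest path between its endpoints and has eccentricity $\max_{u \in V(G)} \min_{x \in V(P)} d_G(u,x)$ at most $k$. The distance to cluster graph of $G$ is the least size of a set $X \subseteq V(G)$ such that $G \setminus X$ is a vertex-disjoint union of cliques. Theorem. There is an algorithm (a single program of a random access machine whose unit-cost operations are memory access, comparison, addition and truncated subtraction of natural numbers) that solves MESP and that runs in time $\mathcal{O}(2^{4p}\, p \cdot n^6)$ on every connected graph with $n$ vertices and distance to cluster graph $p \ge 1$, for every $k$; the constant in the $\mathcal{O}$ is absolute, and neither $p$ nor a smallest set $X$ as above is part of the input. -/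

import Mathlib

/-! ### Graph notions -/

namespace MESP

/-- A walk (a sequence of consecutively adjacent vertices) is a shortest path if no walk with the
same endpoints has fewer edges. Such a walk never repeats a vertex. -/
def IsShortestPath {V : Type*} {G : SimpleGraph V} {u v : V} (w : G.Walk u v) : Prop :=
  ∀ q : G.Walk u v, w.length ≤ q.length

/-- The distance `d_G(u, S)` between a vertex and a set of vertices
(in `ℕ∞`, with value `⊤` if no vertex of `S` can be reached from `u`). -/
noncomputable def distToSet {V : Type*} (G : SimpleGraph V) (u : V) (S : Set V) : ℕ∞ :=
  ⨅ s ∈ S, G.edist u s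

/-- The eccentricity `ecc_G(S) = max_u d_G(u, S)` of a set of vertices. -/
noncomputable def ecc {V : Type*} (G : SimpleGraph V) (S : Set V) : ℕ∞ :=
  ⨆ u, distToSet G u S

/-- `(G, k)` is a yes-instance of the Minimum Eccentricity Shortest Path Problem: some path of `G`
is a shortest path between its endpoints and has eccentricity at most `k`. -/
def IsYesInstance {V : Type*} (G : SimpleGraph V) (k : ℕ) : Prop :=
  ∃ (u v : V) (w : G.Walk u v), IsShortestPath w ∧ ecc G {x | x ∈ w.support} ≤ (k : ℕ∞)

/-- A cluster graph is a vertex-disjoint union of cliques: every connected component is a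
clique. -/
def IsClusterGraph {V : Type*} (G : SimpleGraph V) : Prop :=
  ∀ u v : V, G.Reachable u v → u ≠ v → G.Adj u v

/-- `X` is a modulator to cluster graph: deleting `X` leaves a cluster graph. -/
def IsClusterModulator {V : Type*} (G : SimpleGraph V) (X : Finset V) : Prop :=
  IsClusterGraph (G.induce {v | v ∉ X})

/-- The distance to cluster graph: the size of a smallest modulator to cluster graph.
(For a finite graph, the set of all vertices is a modulator, so the infimum is a minimum.) -/
noncomputable def distToCluster {V : Type*} (G : SimpleGraph V) : ℕ :=
  sInf {m | ∃ X : Finset V, IsClusterModulator G X ∧ X.card = m}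

end MESP

/-! ### A random access machine with unit costs

The machine works on natural numbers. It has scalar variables and one-dimensional arrays, both named
by numerals; a program, being a finite text, names only finitely many of them. The only arithmetic
operations are addition and truncated subtraction (in particular there is no multiplication and
there are no bit operations). Every operation, every comparison, every access to a variable or an
array cell and every executed statement costs one step. -/

namespace RAM

/-- Expressions. -/
inductive Expr : Type
  /-- a numeral -/
  | lit (c : ℕ) : Expr
  /-- the value of a scalar variable -/
  | var (x : ℕ) : Expr
  /-- the content of the cell of array `a` whose index is the value of `i` -/
  | get (a : ℕ) (i : Expr) : Expr
  /-- sum -/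
  | add (e f : Expr) : Expr
  /-- truncated difference -/
  | sub (e f : Expr) : Expr
  /-- `1` if `e < f`, and `0` otherwise -/
  | lt (e f : Expr) : Expr
  /-- `1` if `e = f`, and `0` otherwise -/
  | eq (e f : Expr) : Expr

/-- Programs. -/
inductive Prog : Type
  /-- do nothing -/
  | skip : Prog
  /-- `x := e` -/
  | assign (x : ℕ) (e : Expr) : Prog
  /-- `a[i] := e` -/
  | store (a : ℕ) (i e : Expr) : Prog
  /-- first `p`, then `q` -/
  | seq (p q : Prog) : Prog
  /-- if `b` is nonzero then `p` else `q` -/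
  | cond (b : Expr) (p q : Prog) : Prog
  /-- while `b` is nonzero do `p` -/
  | loop (b : Expr) (p : Prog) : Prog

/-- The memory: the values of the scalar variables and of the array cells. -/
structure State : Type where
  var : ℕ → ℕ
  arr : ℕ → ℕ → ℕ

/-- The memory after `x := c`. -/
def State.setVar (σ : State) (x c : ℕ) : State :=
  { σ with var := Function.update σ.var x c }

/-- The memory after `a[i] := c`. -/
def State.setArr (σ : State) (a i c : ℕ) : State :=
  { σ with arr := Function.update σ.arr a (Function.update (σ.arr a) i c) }

/-- The value of an expression. -/
def Expr.eval (σ : State) : Expr → ℕ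
  | .lit c => c
  | .var x => σ.var x
  | .get a i => σ.arr a (i.eval σ)
  | .add e f => e.eval σ + f.eval σ
  | .sub e f => e.eval σ - f.eval σ
  | .lt e f => if e.eval σ < f.eval σ then 1 else 0
  | .eq e f => if e.eval σ = f.eval σ then 1 else 0

/-- The number of steps needed to evaluate an expression: one for each of its nodes. -/
def Expr.cost : Expr → ℕ
  | .lit _ => 1
  | .var _ => 1
  | .get _ i => i.cost + 1
  | .add e f => e.cost + f.cost + 1
  | .sub e f => e.cost + f.cost + 1
  | .lt e f => e.cost + f.cost + 1
  | .eq e f => e.cost + f.cost + 1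

/-- `Exec p σ t τ`: started with memory `σ`, the program `p` halts after exactly `t` steps, with
memory `τ`. -/
inductive Exec : Prog → State → ℕ → State → Prop
  | skip (σ : State) : Exec .skip σ 1 σ
  | assign (σ : State) (x : ℕ) (e : Expr) :
      Exec (.assign x e) σ (e.cost + 1) (σ.setVar x (e.eval σ))
  | store (σ : State) (a : ℕ) (i e : Expr) :
      Exec (.store a i e) σ (i.cost + e.cost + 1) (σ.setArr a (i.eval σ) (e.eval σ))
  | seq {p q : Prog} {σ τ ρ : State} {s t : ℕ} :
      Exec p σ s τ → Exec q τ t ρ → Exec (.seq p q) σ (s + t + 1) ρ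
  | cond_true {b : Expr} {p q : Prog} {σ τ : State} {t : ℕ} :
      b.eval σ ≠ 0 → Exec p σ t τ → Exec (.cond b p q) σ (b.cost + t + 1) τ
  | cond_false {b : Expr} {p q : Prog} {σ τ : State} {t : ℕ} :
      b.eval σ = 0 → Exec q σ t τ → Exec (.cond b p q) σ (b.cost + t + 1) τ
  | loop_true {b : Expr} {p : Prog} {σ τ ρ : State} {s t : ℕ} :
      b.eval σ ≠ 0 → Exec p σ s τ → Exec (.loop b p) τ t ρ →
        Exec (.loop b p) σ (b.cost + s + t + 1) ρ
  | loop_false {b : Expr} {p : Prog} {σ : State} :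
      b.eval σ = 0 → Exec (.loop b p) σ (b.cost + 1) σ

/-- The machine is deterministic: running time and final memory are determined by the program and
the initial memory. -/
theorem Exec.deterministic {p : Prog} {σ τ τ' : State} {t t' : ℕ}
    (h : Exec p σ t τ) (h' : Exec p σ t' τ') : t = t' ∧ τ = τ' := by
  induction h generalizing t' τ' with
  | skip => cases h'; exact ⟨rfl, rfl⟩
  | assign => cases h'; exact ⟨rfl, rfl⟩
  | store => cases h'; exact ⟨rfl, rfl⟩
  | seq _ _ ih₁ ih₂ =>
    cases h' with
    | seq a b =>
      obtain ⟨rfl, rfl⟩ := ih₁ a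
      obtain ⟨rfl, rfl⟩ := ih₂ b
      exact ⟨rfl, rfl⟩
  | cond_true hb _ ih =>
    cases h' with
    | cond_true _ a => obtain ⟨rfl, rfl⟩ := ih a; exact ⟨rfl, rfl⟩
    | cond_false hb' _ => exact absurd hb' hb
  | cond_false hb _ ih =>
    cases h' with
    | cond_true hb' _ => exact absurd hb hb'
    | cond_false _ a => obtain ⟨rfl, rfl⟩ := ih a; exact ⟨rfl, rfl⟩
  | loop_true hb _ _ ih₁ ih₂ =>
    cases h' with
    | loop_true _ a b =>
      obtain ⟨rfl, rfl⟩ := ih₁ a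
      obtain ⟨rfl, rfl⟩ := ih₂ b
      exact ⟨rfl, rfl⟩
    | loop_false hb' => exact absurd hb' hb
  | loop_false hb =>
    cases h' with
    | loop_true hb' _ _ => exact absurd hb hb'
    | loop_false _ => exact ⟨rfl, rfl⟩

open Classical in
/-- The initial memory for the instance `(G, k)`, where `G` has vertices `0, …, n - 1`: variable `0`
holds `n`, variable `1` holds `k`, and array `0` holds the adjacency matrix of `G` row by row.
Everything else is `0`. -/
noncomputable def inputState {n : ℕ} (G : SimpleGraph (Fin n)) (k : ℕ) : State where
  var x := if x = 0 then n else if x = 1 then k else 0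
  arr a x := if a = 0 ∧ ∃ i j : Fin n, G.Adj i j ∧ x = i * n + j then 1 else 0

end RAM

/-! ### A language of bounded loops and bounded sums, compiled to the machine -/

namespace RAM

/-! Fix a smallest cluster modulator `X = {x 0, …, x (p - 1)}` and consider a shortest path Q with
start `s`. Three consecutive vertices of Q outside `X` would form an induced path, so going back
along Q from any of its vertices one meets `s` or `X` within two steps. Hence the distance from `x
e` to Q is smaller by 0, 1 or 2 than its distance to the set of `s` and the members of `X` on Q. One
base-four digit per element of `X` therefore encodes which elements lie on Q as well as all
distances `δ e` to Q (`exists_guess_eq`); this gives 4^p guesses for each `s`.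

Given `δ`, a vertex outside `X` is bad if no `x e` certifies that it is within `k` of Q. A shortest
walk from a bad vertex to a vertex of Q within distance `k` avoids `X`, so Q must enter the clique
of the bad vertex (`exists_touches_of_covers`). Conversely, entering that clique puts all its
vertices within distance 1 ≤ k (`covers_of_reps`). A clique is first entered at `s` or right after a
vertex of `X`, so at most p + 1 cliques are prescribed (`card_reps_le`). It remains to find a walk
from some `v` to `s` of length `G.dist v s`, which is automatically a shortest path, that comes
within `δ e` of every `x e` and enters every prescribed clique. These are at most 2p + 1 tasks,
handled by a dynamic program over length, vertex and set of open tasks (`reach_succ`). With n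
starts, 4^p guesses, n^2 * 2^(2p+1) table entries and O(n p) steps per entry, the total is O(16^p p
n^4). For k = 0 the clique argument fails, but then Q contains all vertices, so one looks for two
vertices at distance n - 1.

The modulator is found by branching. In one pass over all triples, whenever a triple is an induced
path that avoids the vertices picked so far, a digit selects which of its vertices to pick. Trying d
= 0, 1, … with all 4^d digit strings succeeds first at d = p (`distToCluster_le_length_picks`,
`exists_length_picks_le`).

The program is written with bounded sums and loops and compiled (`Cmd.exec_comp`). The predicates
`Fits` and `Spec` bound a cost by the size of the program text times a product of loop lengths, so
the final constant is absolute. As the machine cannot multiply or shift, multiples, powers of two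
and shifted numbers are tabulated.

Storage. Variables: 0 is n, 1 is k, 2 the flag of the search, 3 the size tried, 4 the number of
masks, 5 the length of the list (finally p), 6 the start, 7 the guess, 8 the answer, 9 the number of
representatives, 10 the number of tasks; 11 to 13 are loop counters, 14 and 15 loop bounds, 20 and
21 summation variables. Arrays: 0 adjacency, 1 multiples of n, 2 powers of two, 3 the relation
"distance at most r", 4 distances, 5 and 6 multiples and shifts, 7 the list, 8 its characteristic
function, 9 `δ`, 10 bad vertices, 11 to 13 representatives, their ranks and their enumeration, 14
the dynamic program. -/

/-- Terms: expressions extended by case distinction and bounded sums. -/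
inductive Tm : Type
  | lit (c : ℕ) : Tm
  | var (x : ℕ) : Tm
  | get (a : ℕ) (i : Tm) : Tm
  | add (e f : Tm) : Tm
  | sub (e f : Tm) : Tm
  | lt (e f : Tm) : Tm
  | eq (e f : Tm) : Tm
  | ite (b e f : Tm) : Tm
  /-- the sum of `e` over all values of the variable `x` below `N` -/
  | sum (x : ℕ) (N e : Tm) : Tm

namespace Tm

/-- The value of a term. -/
def eval : Tm → State → ℕ
  | lit c, _ => c
  | var x, σ => σ.var x
  | get a i, σ => σ.arr a (i.eval σ)
  | add e f, σ => e.eval σ + f.eval σ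
  | sub e f, σ => e.eval σ - f.eval σ
  | lt e f, σ => if e.eval σ < f.eval σ then 1 else 0
  | eq e f, σ => if e.eval σ = f.eval σ then 1 else 0
  | ite b e f, σ => if b.eval σ ≠ 0 then e.eval σ else f.eval σ
  | sum x N e, σ => ∑ i ∈ Finset.range (N.eval σ), e.eval (σ.setVar x i)

/-- An upper bound for the number of steps that the compiled term takes. -/
def cost : Tm → State → ℕ
  | lit _, _ => 2
  | var _, _ => 2
  | get _ i, σ => i.cost σ + 4
  | add e f, σ => e.cost σ + f.cost σ + 6
  | sub e f, σ => e.cost σ + f.cost σ + 6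
  | lt e f, σ => e.cost σ + f.cost σ + 6
  | eq e f, σ => e.cost σ + f.cost σ + 6
  | ite b e f, σ => b.cost σ + (if b.eval σ = 0 then f.cost σ else e.cost σ) + 3
  | sum x N e, σ =>
    N.cost σ + 17 + ∑ i ∈ Finset.range (N.eval σ), (e.cost (σ.setVar x i) + 14)

/-- A strict upper bound for the variables of a term. -/
def bd : Tm → ℕ
  | lit _ => 0
  | var x => x + 1
  | get _ i => i.bd
  | add e f => max e.bd f.bd
  | sub e f => max e.bd f.bd
  | lt e f => max e.bd f.bd
  | eq e f => max e.bd f.bd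
  | ite b e f => max b.bd (max e.bd f.bd)
  | sum x N e => max (x + 1) (max N.bd e.bd)

/-- The compiled term leaves its value in variable `d` and keeps all smaller variables. -/
def comp : Tm → ℕ → Prog
  | lit c, d => .assign d (.lit c)
  | var x, d => .assign d (.var x)
  | get a i, d => .seq (i.comp d) (.assign d (.get a (.var d)))
  | add e f, d => .seq (.seq (e.comp d) (f.comp (d + 1)))
      (.assign d (.add (.var d) (.var (d + 1))))
  | sub e f, d => .seq (.seq (e.comp d) (f.comp (d + 1)))
      (.assign d (.sub (.var d) (.var (d + 1))))
  | lt e f, d => .seq (.seq (e.comp d) (f.comp (d + 1)))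
      (.assign d (.lt (.var d) (.var (d + 1))))
  | eq e f, d => .seq (.seq (e.comp d) (f.comp (d + 1)))
      (.assign d (.eq (.var d) (.var (d + 1))))
  | ite b e f, d => .seq (b.comp d) (.cond (.var d) (e.comp d) (f.comp d))
  | sum x N e, d =>
    .seq (N.comp (d + 1))
      (.seq (.assign (d + 2) (.var x))
      (.seq (.assign d (.lit 0))
      (.seq (.assign x (.lit 0))
      (.seq (.loop (.lt (.var x) (.var (d + 1)))
        (.seq (e.comp (d + 3)) (.seq (.assign d (.add (.var d) (.var (d + 3))))
          (.assign x (.add (.var x) (.lit 1))))))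
      (.assign x (.var (d + 2)))))))

/-- Compiled code leaves garbage in the scratch variables. This is harmless because value and cost
depend only on the arrays and on the variables below `bd`. -/
theorem eval_cost_congr (e : Tm) : ∀ {σ τ : State}, (∀ y < e.bd, σ.var y = τ.var y) →
    σ.arr = τ.arr → e.eval σ = e.eval τ ∧ e.cost σ = e.cost τ := by
  induction e with
  | lit c => intros; exact ⟨rfl, rfl⟩
  | var x => intro σ τ h _; exact ⟨h x (Nat.lt_succ_self x), rfl⟩
  | get a i ih => intro σ τ h h'; simp [eval, cost, ih h h', h']
  | add e f ihe ihf | sub e f ihe ihf | lt e f ihe ihf | eq e f ihe ihf =>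
    intro σ τ h h'
    have h1 := ihe (fun y hy => h y (lt_max_of_lt_left hy)) h'
    have h2 := ihf (fun y hy => h y (lt_max_of_lt_right hy)) h'
    simp [eval, cost, h1, h2]
  | ite b e f ihb ihe ihf =>
    intro σ τ h h'
    have h0 := ihb (fun y hy => h y (lt_max_of_lt_left hy)) h'
    have h1 := ihe (fun y hy => h y (lt_max_of_lt_right (lt_max_of_lt_left hy))) h'
    have h2 := ihf (fun y hy => h y (lt_max_of_lt_right (lt_max_of_lt_right hy))) h'
    simp [eval, cost, h0, h1, h2]
  | sum x N e ihN ihe =>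
    intro σ τ h h'
    have h0 := ihN (fun y hy => h y (lt_max_of_lt_right (lt_max_of_lt_left hy))) h'
    have h1 : ∀ i, e.eval (σ.setVar x i) = e.eval (τ.setVar x i) ∧
        e.cost (σ.setVar x i) = e.cost (τ.setVar x i) := fun i => by
      refine ihe (fun y hy => ?_) h'
      by_cases hyx : y = x
      · subst hyx; simp [State.setVar]
      · simpa [State.setVar, hyx] using h y (lt_max_of_lt_right (lt_max_of_lt_right hy))
    simp [eval, cost, h0, h1]

/-- Operands are evaluated into successive scratch variables, so that a later one does not destroy
an earlier one. A sum keeps its accumulator in `d`, its bound in `d + 1` and the old value of `x` in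
`d + 2`; restoring `x` at the end makes it a bound variable, and so everything below `d` survives.
-/
theorem exec_comp (e : Tm) : ∀ {d : ℕ} (σ : State), e.bd ≤ d →
    ∃ t τ, Exec (e.comp d) σ t τ ∧ t ≤ e.cost σ ∧ τ.var d = e.eval σ ∧ τ.arr = σ.arr ∧
      ∀ y < d, τ.var y = σ.var y := by
  have bin : ∀ (e f : Tm) (op : Expr → Expr → Expr) (g : ℕ → ℕ → ℕ) (d : ℕ) (σ : State),
      (∀ {d : ℕ} (σ : State), e.bd ≤ d →
        ∃ t τ, Exec (e.comp d) σ t τ ∧ t ≤ e.cost σ ∧ τ.var d = e.eval σ ∧ τ.arr = σ.arr ∧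
          ∀ y < d, τ.var y = σ.var y) →
      (∀ {d : ℕ} (σ : State), f.bd ≤ d →
        ∃ t τ, Exec (f.comp d) σ t τ ∧ t ≤ f.cost σ ∧ τ.var d = f.eval σ ∧ τ.arr = σ.arr ∧
          ∀ y < d, τ.var y = σ.var y) →
      (∀ τ : State, (op (.var d) (.var (d + 1))).eval τ = g (τ.var d) (τ.var (d + 1))) →
      (op (.var d) (.var (d + 1))).cost = 3 → max e.bd f.bd ≤ d →
      ∃ t τ, Exec (.seq (.seq (e.comp d) (f.comp (d + 1)))
          (.assign d (op (.var d) (.var (d + 1))))) σ t τ ∧ t ≤ e.cost σ + f.cost σ + 6 ∧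
        τ.var d = g (e.eval σ) (f.eval σ) ∧ τ.arr = σ.arr ∧ ∀ y < d, τ.var y = σ.var y := by
    intro e f op g d σ ihe ihf hop hc hd
    obtain ⟨t₁, τ₁, x₁, l₁, v₁, a₁, k₁⟩ := ihe (d := d) σ (le_of_max_le_left hd)
    obtain ⟨t₂, τ₂, x₂, l₂, v₂, a₂, k₂⟩ :=
      ihf (d := d + 1) τ₁ ((le_of_max_le_right hd).trans (Nat.le_succ d))
    have hf := eval_cost_congr f (σ := τ₁) (τ := σ)
      (fun y hy => k₁ y (hy.trans_le (le_of_max_le_right hd))) a₁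
    refine ⟨_, _, .seq (.seq x₁ x₂) (.assign _ _ _), ?_, ?_, ?_, ?_⟩
    · rw [hc]; omega
    · simp [State.setVar, hop, v₂, hf.1, k₂ d (Nat.lt_succ_self d), v₁]
    · simp [State.setVar, a₂, a₁]
    · intro y hy
      simp [State.setVar, hy.ne, k₂ y (by omega), k₁ y hy]
  induction e with
  | lit c =>
    intro d σ _
    exact ⟨_, _, .assign _ _ _, le_rfl, by simp [State.setVar, Expr.eval, eval], rfl,
      fun y hy => by simp [State.setVar, hy.ne]⟩
  | var x =>
    intro d σ _
    exact ⟨_, _, .assign _ _ _, le_rfl, by simp [State.setVar, Expr.eval, eval], rfl,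
      fun y hy => by simp [State.setVar, hy.ne]⟩
  | get a i ih =>
    intro d σ hd
    obtain ⟨t₁, τ₁, x₁, l₁, v₁, a₁, k₁⟩ := ih (d := d) σ hd
    refine ⟨_, _, .seq x₁ (.assign _ _ _), ?_, ?_, a₁, ?_⟩
    · simp only [Expr.cost, cost]; omega
    · simp [State.setVar, Expr.eval, eval, v₁, a₁]
    · intro y hy; simp [State.setVar, hy.ne, k₁ y hy]
  | add e f ihe ihf =>
    intro d σ hd; exact bin e f .add (· + ·) d σ ihe ihf (fun _ => rfl) rfl hd
  | sub e f ihe ihf =>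
    intro d σ hd; exact bin e f .sub (· - ·) d σ ihe ihf (fun _ => rfl) rfl hd
  | lt e f ihe ihf =>
    intro d σ hd
    exact bin e f .lt (fun a b => if a < b then 1 else 0) d σ ihe ihf (fun _ => rfl) rfl hd
  | eq e f ihe ihf =>
    intro d σ hd
    exact bin e f .eq (fun a b => if a = b then 1 else 0) d σ ihe ihf (fun _ => rfl) rfl hd
  | ite b e f ihb ihe ihf =>
    intro d σ hd
    simp only [bd, max_le_iff] at hd
    obtain ⟨t₁, τ₁, x₁, l₁, v₁, a₁, k₁⟩ := ihb (d := d) σ hd.1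
    by_cases hb : b.eval σ = 0
    · obtain ⟨t₂, τ₂, x₂, l₂, v₂, a₂, k₂⟩ := ihf (d := d) τ₁ hd.2.2
      have hf := eval_cost_congr f (σ := τ₁) (τ := σ)
        (fun y hy => k₁ y (hy.trans_le hd.2.2)) a₁
      refine ⟨_, _, .seq x₁ (.cond_false (by simp [Expr.eval, v₁, hb]) x₂), ?_, ?_,
        a₂.trans a₁, fun y hy => (k₂ y hy).trans (k₁ y hy)⟩
      · simp only [Expr.cost, cost, hb, if_true]; omega
      · simp [eval, v₂, hb, hf.1]
    · obtain ⟨t₂, τ₂, x₂, l₂, v₂, a₂, k₂⟩ := ihe (d := d) τ₁ hd.2.1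
      have hf := eval_cost_congr e (σ := τ₁) (τ := σ)
        (fun y hy => k₁ y (hy.trans_le hd.2.1)) a₁
      refine ⟨_, _, .seq x₁ (.cond_true (by simp [Expr.eval, v₁, hb]) x₂), ?_, ?_,
        a₂.trans a₁, fun y hy => (k₂ y hy).trans (k₁ y hy)⟩
      · simp only [Expr.cost, cost, hb, if_false]; omega
      · simp [eval, v₂, hb, hf.1]
  | sum x N e ihN ihe =>
    intro d σ hd
    simp only [bd, max_le_iff] at hd
    obtain ⟨hx, hN, he⟩ := hd
    obtain ⟨t₁, τ₁, x₁, l₁, v₁, a₁, k₁⟩ := ihN (d := d + 1) σ (by omega)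
    set B : Prog := .seq (e.comp (d + 3)) (.seq (.assign d (.add (.var d) (.var (d + 3))))
          (.assign x (.add (.var x) (.lit 1)))) with hB
    -- Invariant after `i` rounds, with `m` rounds left. The cost of the completed rounds is added
    -- on the left to avoid subtraction. A round costs 14 besides the body, and the 4 pays for the
    -- last test.
    have loop : ∀ (m i : ℕ) (τ : State), i + m = N.eval σ → τ.var x = i →
        τ.var (d + 1) = N.eval σ → τ.var (d + 2) = σ.var x →
        τ.var d = ∑ j ∈ Finset.range i, e.eval (σ.setVar x j) →
        τ.arr = σ.arr → (∀ y < d, y ≠ x → τ.var y = σ.var y) →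
        ∃ t τ', Exec (.loop (.lt (.var x) (.var (d + 1))) B) τ t τ' ∧
          t + ∑ j ∈ Finset.range i, (e.cost (σ.setVar x j) + 14) ≤
            4 + ∑ j ∈ Finset.range (N.eval σ), (e.cost (σ.setVar x j) + 14) ∧
          τ'.var (d + 2) = σ.var x ∧
          τ'.var d = ∑ j ∈ Finset.range (N.eval σ), e.eval (σ.setVar x j) ∧
          τ'.arr = σ.arr ∧ (∀ y < d, y ≠ x → τ'.var y = σ.var y) := by
      intro m
      induction m with
      | zero =>
        intro i τ hi h1 h2 h3 h4 h5 h6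
        have hi : i = N.eval σ := by omega
        subst hi
        exact ⟨_, _, .loop_false (by simp [Expr.eval, h1, h2]), by simp [Expr.cost], h3, h4, h5, h6⟩
      | succ m ih =>
        intro i τ hi h1 h2 h3 h4 h5 h6
        obtain ⟨t₂, τ₂, x₂, l₂, v₂, a₂, k₂⟩ := ihe (d := d + 3) τ (by omega)
        have hf := eval_cost_congr e (σ := τ) (τ := σ.setVar x i)
          (fun y hy => by
            by_cases hyx : y = x
            · subst hyx; simp [State.setVar, h1]
            · simp [State.setVar, hyx, h6 y (by omega) hyx]) h5
        have hxd : x ≠ d := by omega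
        obtain ⟨t₃, τ₃, x₃, l₃, r₃⟩ := ih (i + 1)
          ((τ₂.setVar d (τ₂.var d + τ₂.var (d + 3))).setVar x (i + 1)) (by omega)
          (by simp [State.setVar])
          (by simp [State.setVar, k₂ (d + 1) (by omega), h2, show d + 1 ≠ x by omega])
          (by simp [State.setVar, k₂ (d + 2) (by omega), h3, show d + 2 ≠ x by omega])
          (by simp [State.setVar, hxd.symm, k₂ d (by omega), h4, v₂, hf.1, Finset.sum_range_succ])
          (by simp [State.setVar, a₂, h5])
          (fun y hy hyx => by
            simp [State.setVar, hyx, hy.ne, k₂ y (by omega), h6 y hy hyx])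
        have xb : Exec B τ (t₂ + (4 + 4 + 1) + 1)
            ((τ₂.setVar d (τ₂.var d + τ₂.var (d + 3))).setVar x (i + 1)) := by
          have e1 := Exec.assign τ₂ d (.add (.var d) (.var (d + 3)))
          have e2 := Exec.assign (τ₂.setVar d (τ₂.var d + τ₂.var (d + 3))) x
            (.add (.var x) (.lit 1))
          have hxi : (τ₂.setVar d (τ₂.var d + τ₂.var (d + 3))).var x = i := by
            simp [State.setVar, hxd, k₂ x (by omega), h1]
          simp only [Expr.eval, Expr.cost, hxi] at e1 e2
          exact .seq x₂ (.seq e1 e2)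
        refine ⟨_, _, .loop_true (by simp [Expr.eval, h1, h2]; omega) xb x₃, ?_, r₃⟩
        rw [Finset.sum_range_succ] at l₃
        simp only [Expr.cost]
        rw [hf.2] at l₂
        omega
    obtain ⟨t₄, τ₄, x₄, l₄, v₄, w₄, a₄, k₄⟩ := loop (N.eval σ) 0
      (((τ₁.setVar (d + 2) (τ₁.var x)).setVar d 0).setVar x 0) (by omega)
      (by simp [State.setVar])
      (by simp [State.setVar, v₁, show d + 1 ≠ x by omega])
      (by simp [State.setVar, show d + 2 ≠ x by omega, k₁ x (by omega)])
      (by simp [State.setVar, show d ≠ x by omega])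
      (by simp [State.setVar, a₁])
      (fun y hy hyx => by
        simp [State.setVar, hyx, hy.ne, show y ≠ d + 2 by omega, k₁ y (by omega)])
    refine ⟨_, _, .seq x₁ (.seq (.assign _ _ _) (.seq (.assign _ _ _) (.seq (.assign _ _ _)
      (.seq x₄ (.assign _ _ _))))), ?_, ?_, ?_, ?_⟩
    · simp only [Expr.cost, cost]
      simp at l₄
      omega
    · simp [State.setVar, w₄, eval, show d ≠ x by omega]
    · simp [State.setVar, a₄]
    · intro y hy
      by_cases hyx : y = x
      · subst hyx; simp [State.setVar, Expr.eval, v₄]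
      · simp [State.setVar, hyx, k₄ y hy hyx]

end Tm

/-! ### Commands with bounded loops, their costs and their compilation -/

/-- Iterating `f 0, f 1, …, f (i - 1)`. -/
def iter (f : ℕ → State → State) : ℕ → State → State
  | 0, σ => σ
  | i + 1, σ => f i (iter f i σ)

/-- Commands. -/
inductive Cmd : Type
  | set (x : ℕ) (e : Tm) : Cmd
  | store (a : ℕ) (i e : Tm) : Cmd
  | seq (p q : Cmd) : Cmd
  /-- if `b` is nonzero then `p` -/
  | when (b : Tm) (p : Cmd) : Cmd
  /-- for `x = 0, …, N - 1` do `p` -/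
  | loop (x : ℕ) (N : Tm) (p : Cmd) : Cmd

namespace Cmd

/-- The memory after the execution of a command. -/
def run : Cmd → State → State
  | set x e, σ => σ.setVar x (e.eval σ)
  | store a i e, σ => σ.setArr a (i.eval σ) (e.eval σ)
  | seq p q, σ => q.run (p.run σ)
  | when b p, σ => if b.eval σ = 0 then σ else p.run σ
  | loop x N p, σ => iter (fun i τ => p.run (τ.setVar x i)) (N.eval σ) σ

/-- An upper bound for the number of steps that the compiled command takes. -/
def cost : Cmd → State → ℕ
  | set _ e, σ => e.cost σ + 3
  | store _ i e, σ => i.cost σ + e.cost σ + 5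
  | seq p q, σ => p.cost σ + q.cost (p.run σ) + 1
  | when b p, σ => b.cost σ + (if b.eval σ = 0 then 0 else p.cost σ) + 4
  | loop x N p, σ => N.cost σ + 8 + ∑ i ∈ Finset.range (N.eval σ),
      (p.cost ((iter (fun i τ => p.run (τ.setVar x i)) i σ).setVar x i) + 12)

/-- A strict upper bound for the variables of a command. -/
def bd : Cmd → ℕ
  | set x e => max (x + 1) e.bd
  | store _ i e => max i.bd e.bd
  | seq p q => max p.bd q.bd
  | when b p => max b.bd p.bd
  | loop x N p => max (x + 1) (max N.bd p.bd)

/-- The compiled command; it uses the variables from `d` on as auxiliary storage. -/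
def comp : Cmd → ℕ → Prog
  | set x e, d => .seq (e.comp d) (.assign x (.var d))
  | store a i e, d => .seq (.seq (i.comp d) (e.comp (d + 1))) (.store a (.var d) (.var (d + 1)))
  | seq p q, d => .seq (p.comp d) (q.comp d)
  | when b p, d => .seq (b.comp d) (.cond (.var d) (p.comp d) .skip)
  | loop x N p, d => .seq (N.comp (d + 1)) (.seq (.assign d (.lit 0))
      (.loop (.lt (.var d) (.var (d + 1))) (.seq (.assign x (.var d))
        (.seq (p.comp (d + 2)) (.assign d (.add (.var d) (.lit 1)))))))

/-- The actual memory `σ'` need only agree with the intended memory `σ` on the program variables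
below `b` and on the arrays. The last clause protects the variables between `b` and `d`, where
enclosing loops keep counter and bound; a body may therefore overwrite `x` without affecting the
number of rounds. -/
theorem exec_comp (c : Cmd) {b : ℕ} : ∀ {d : ℕ} {σ σ' : State}, c.bd ≤ b → b ≤ d →
    (∀ y < b, σ'.var y = σ.var y) → σ'.arr = σ.arr →
    ∃ t τ, Exec (c.comp d) σ' t τ ∧ t ≤ c.cost σ ∧ (∀ y < b, τ.var y = (c.run σ).var y) ∧
      τ.arr = (c.run σ).arr ∧ ∀ y < d, b ≤ y → τ.var y = σ'.var y := by
  induction c with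
  | set x e =>
    intro d σ σ' hb hd hv ha
    simp only [bd, max_le_iff] at hb
    obtain ⟨t₁, τ₁, x₁, l₁, v₁, a₁, k₁⟩ := e.exec_comp (d := d) σ' (by omega)
    have hf := Tm.eval_cost_congr e (σ := σ') (τ := σ) (fun y hy => hv y (by omega)) ha
    refine ⟨_, _, .seq x₁ (.assign _ _ _), ?_, ?_, ?_, ?_⟩
    · simp only [Expr.cost, cost]; omega
    · intro y hy
      by_cases hyx : y = x
      · subst hyx; simp [State.setVar, Expr.eval, run, v₁, hf.1]
      · simp [State.setVar, hyx, run, k₁ y (by omega), hv y hy]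
    · simp [State.setVar, run, a₁, ha]
    · intro y hy hby
      simp [State.setVar, show y ≠ x by omega, k₁ y hy]
  | store a i e =>
    intro d σ σ' hb hd hv ha
    simp only [bd, max_le_iff] at hb
    obtain ⟨t₁, τ₁, x₁, l₁, v₁, a₁, k₁⟩ := i.exec_comp (d := d) σ' (by omega)
    have hf := Tm.eval_cost_congr i (σ := σ') (τ := σ) (fun y hy => hv y (by omega)) ha
    obtain ⟨t₂, τ₂, x₂, l₂, v₂, a₂, k₂⟩ := e.exec_comp (d := d + 1) τ₁ (by omega)
    have hg := Tm.eval_cost_congr e (σ := τ₁) (τ := σ)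
      (fun y hy => (k₁ y (by omega)).trans (hv y (by omega))) (a₁.trans ha)
    refine ⟨_, _, .seq (.seq x₁ x₂) (.store _ _ _ _), ?_, ?_, ?_, ?_⟩
    · simp only [Expr.cost, cost]; omega
    · intro y hy
      simp [State.setArr, run, k₂ y (by omega), k₁ y (by omega), hv y hy]
    · simp [State.setArr, run, Expr.eval, v₂, hg.1, k₂ d (by omega), v₁, hf.1, a₂, a₁, ha]
    · intro y hy hby
      simp [State.setArr, k₂ y (by omega), k₁ y (by omega)]
  | seq p q ihp ihq =>
    intro d σ σ' hb hd hv ha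
    simp only [bd, max_le_iff] at hb
    obtain ⟨t₁, τ₁, x₁, l₁, v₁, a₁, k₁⟩ := ihp hb.1 hd hv ha
    obtain ⟨t₂, τ₂, x₂, l₂, v₂, a₂, k₂⟩ := ihq hb.2 hd v₁ a₁
    refine ⟨_, _, .seq x₁ x₂, ?_, v₂, a₂, fun y hy hby => (k₂ y hy hby).trans (k₁ y hy hby)⟩
    simp only [cost]; omega
  | when e p ih =>
    intro d σ σ' hb hd hv ha
    simp only [bd, max_le_iff] at hb
    obtain ⟨t₁, τ₁, x₁, l₁, v₁, a₁, k₁⟩ := e.exec_comp (d := d) σ' (by omega)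
    have hf := Tm.eval_cost_congr e (σ := σ') (τ := σ) (fun y hy => hv y (by omega)) ha
    by_cases h0 : e.eval σ = 0
    · refine ⟨_, _, .seq x₁ (.cond_false (by simp [Expr.eval, v₁, hf.1, h0]) (.skip _)), ?_, ?_, ?_,
        fun y hy _ => k₁ y hy⟩
      · simp only [Expr.cost, cost]; omega
      · intro y hy; simp [run, h0, k₁ y (by omega), hv y hy]
      · simp [run, h0, a₁, ha]
    · obtain ⟨t₂, τ₂, x₂, l₂, v₂, a₂, k₂⟩ := ih hb.2 hd (σ := σ) (σ' := τ₁)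
        (fun y hy => (k₁ y (by omega)).trans (hv y hy)) (a₁.trans ha)
      refine ⟨_, _, .seq x₁ (.cond_true (by simp [Expr.eval, v₁, hf.1, h0]) x₂), ?_, ?_, ?_,
        fun y hy hby => (k₂ y hy hby).trans (k₁ y hy)⟩
      · simp only [Expr.cost, cost, h0, if_false]; omega
      · intro y hy; simp [run, h0, v₂ y hy]
      · simp [run, h0, a₂]
  | loop x N p ih =>
    intro d σ σ' hb hd hv ha
    simp only [bd, max_le_iff] at hb
    obtain ⟨hx, hN, hp⟩ := hb
    obtain ⟨t₁, τ₁, x₁, l₁, v₁, a₁, k₁⟩ := N.exec_comp (d := d + 1) σ' (by omega)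
    have hf := Tm.eval_cost_congr N (σ := σ') (τ := σ) (fun y hy => hv y (by omega)) ha
    set f : ℕ → State → State := fun i τ => p.run (τ.setVar x i) with hfdef
    have loop : ∀ (m i : ℕ) (τ : State), i + m = N.eval σ → τ.var d = i →
        τ.var (d + 1) = N.eval σ → (∀ y < b, τ.var y = (iter f i σ).var y) →
        τ.arr = (iter f i σ).arr → (∀ y < d, b ≤ y → τ.var y = σ'.var y) →
        ∃ t τ', Exec (.loop (.lt (.var d) (.var (d + 1))) (.seq (.assign x (.var d))
            (.seq (p.comp (d + 2)) (.assign d (.add (.var d) (.lit 1)))))) τ t τ' ∧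
          t + ∑ j ∈ Finset.range i, (p.cost ((iter f j σ).setVar x j) + 12) ≤
            4 + ∑ j ∈ Finset.range (N.eval σ), (p.cost ((iter f j σ).setVar x j) + 12) ∧
          (∀ y < b, τ'.var y = (iter f (N.eval σ) σ).var y) ∧
          τ'.arr = (iter f (N.eval σ) σ).arr ∧ (∀ y < d, b ≤ y → τ'.var y = σ'.var y) := by
      intro m
      induction m with
      | zero =>
        intro i τ hi h1 h2 h3 h4 h5
        have hi : i = N.eval σ := by omega
        subst hi
        exact ⟨_, _, .loop_false (by simp [Expr.eval, h1, h2]), by simp [Expr.cost], h3, h4, h5⟩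
      | succ m ihm =>
        intro i τ hi h1 h2 h3 h4 h5
        obtain ⟨t₂, τ₂, x₂, l₂, v₂, a₂, k₂⟩ := ih (d := d + 2) hp (by omega)
          (σ := (iter f i σ).setVar x i) (σ' := τ.setVar x i)
          (fun y hy => by
            by_cases hyx : y = x
            · subst hyx; simp [State.setVar]
            · simp [State.setVar, hyx, h3 y hy]) (by simp [State.setVar, h4])
        have hd2 : τ₂.var d = i := by
          rw [k₂ d (by omega) hd]; simp [State.setVar, show d ≠ x by omega, h1]
        obtain ⟨t₃, τ₃, x₃, l₃, r₃⟩ := ihm (i + 1) (τ₂.setVar d (i + 1)) (by omega)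
          (by simp [State.setVar])
          (by
            simp only [State.setVar, Function.update_of_ne (show d + 1 ≠ d by omega)]
            rw [k₂ (d + 1) (by omega) (by omega)]
            simp [State.setVar, show d + 1 ≠ x by omega, h2])
          (fun y hy => by
            simp only [State.setVar, Function.update_of_ne (show y ≠ d by omega)]
            exact v₂ y hy)
          a₂
          (fun y hy hby => by
            simp only [State.setVar, Function.update_of_ne (show y ≠ d by omega)]
            rw [k₂ y (by omega) hby]
            simp [State.setVar, show y ≠ x by omega, h5 y hy hby])
        have xb : Exec (.seq (.assign x (.var d))
            (.seq (p.comp (d + 2)) (.assign d (.add (.var d) (.lit 1))))) τ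
            (2 + (t₂ + 4 + 1) + 1) (τ₂.setVar d (i + 1)) := by
          have e1 := Exec.assign τ x (.var d)
          have e2 := Exec.assign τ₂ d (.add (.var d) (.lit 1))
          simp only [Expr.eval, Expr.cost, h1, hd2] at e1 e2
          exact .seq e1 (.seq x₂ e2)
        refine ⟨_, _, .loop_true (by simp [Expr.eval, h1, h2]; omega) xb x₃, ?_, r₃⟩
        rw [Finset.sum_range_succ] at l₃
        simp only [Expr.cost]
        omega
    obtain ⟨t₄, τ₄, x₄, l₄, r₄⟩ := loop (N.eval σ) 0 (τ₁.setVar d 0) (by omega)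
      (by simp [State.setVar]) (by simp [State.setVar, v₁, hf.1])
      (fun y hy => by simp [State.setVar, show y ≠ d by omega, k₁ y (by omega), hv y hy, iter])
      (by simp [State.setVar, a₁, ha, iter])
      (fun y hy hby => by simp [State.setVar, show y ≠ d by omega, k₁ y (by omega)])
    refine ⟨_, _, .seq x₁ (.seq (.assign _ _ _) x₄), ?_, r₄⟩
    have hc : cost (Cmd.loop x N p) σ = N.cost σ + 8 + ∑ i ∈ Finset.range (N.eval σ),
      (p.cost ((iter f i σ).setVar x i) + 12) := rfl
    rw [hc]
    simp only [Expr.cost]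
    simp only [Finset.range_zero, Finset.sum_empty, add_zero] at l₄
    omega

theorem exists_exec (c : Cmd) (σ : State) :
    ∃ t τ, Exec (c.comp c.bd) σ t τ ∧ t ≤ c.cost σ ∧ ∀ y < c.bd, τ.var y = (c.run σ).var y := by
  obtain ⟨t, τ, h, l, v, _⟩ := exec_comp c (b := c.bd) (d := c.bd) (σ := σ) (σ' := σ)
    le_rfl le_rfl (fun _ _ => rfl) rfl
  exact ⟨t, τ, h, l, v⟩

end Cmd
end RAM

/-! ### Cluster modulators and shortest paths -/

namespace MESP

variable {V : Type*} {G : SimpleGraph V}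

/-- `X` meets all induced paths on three vertices. -/
def HitsP3 (G : SimpleGraph V) (X : Finset V) : Prop :=
  ∀ a b c, a ∉ X → b ∉ X → c ∉ X → a ≠ c → G.Adj a b → G.Adj b c → G.Adj a c

/-- Without induced paths on three vertices, "equal or adjacent" is transitive outside `X`, so it
propagates along walks. -/
theorem HitsP3.eq_or_adj_of_walk {X : Finset V} (hX : HitsP3 G X) {u v : V} (q : G.Walk u v)
    (hq : ∀ x ∈ q.support, x ∉ X) : u = v ∨ G.Adj u v := by
  induction q with
  | nil => exact Or.inl rfl
  | @cons u w v h q ih =>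
    simp only [SimpleGraph.Walk.support_cons, List.mem_cons, forall_eq_or_imp] at hq
    have hw := hq.2 w q.start_mem_support
    have hv := hq.2 v q.end_mem_support
    by_cases huv : u = v
    · exact Or.inl huv
    rcases ih hq.2 with rfl | h'
    · exact Or.inr h
    · exact Or.inr (hX u w v hq.1 hw hv huv h h')

theorem isClusterModulator_iff {X : Finset V} : IsClusterModulator G X ↔ HitsP3 G X := by
  constructor
  · intro h a b c ha hb hc hac hab hbc
    have h1 : (G.induce {v | v ∉ X}).Adj ⟨a, ha⟩ ⟨b, hb⟩ := hab
    have h2 : (G.induce {v | v ∉ X}).Adj ⟨b, hb⟩ ⟨c, hc⟩ := hbc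
    exact h ⟨a, ha⟩ ⟨c, hc⟩ (h1.reachable.trans h2.reachable) (by simpa using hac)
  · rintro h u v ⟨q⟩ huv
    have := h.eq_or_adj_of_walk (q.map (SimpleGraph.Embedding.induce {v | v ∉ X}).toHom) (by
      intro x hx
      simp only [SimpleGraph.Walk.support_map, List.mem_map] at hx
      obtain ⟨y, _, rfl⟩ := hx
      exact y.2)
    rcases this with h' | h'
    · exact absurd (Subtype.ext h') huv
    · exact h'

theorem distToCluster_le {X : Finset V} (hX : HitsP3 G X) : distToCluster G ≤ X.card :=
  Nat.sInf_le ⟨X, isClusterModulator_iff.2 hX, rfl⟩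

theorem exists_hitsP3_card [Fintype V] (G : SimpleGraph V) :
    ∃ X, HitsP3 G X ∧ X.card = distToCluster G := by
  have h : {m | ∃ X : Finset V, IsClusterModulator G X ∧ X.card = m}.Nonempty :=
    ⟨_, Finset.univ, isClusterModulator_iff.2 (fun a _ _ ha => absurd (Finset.mem_univ a) ha), rfl⟩
  obtain ⟨X, hX, hc⟩ := Nat.sInf_mem h
  exact ⟨X, isClusterModulator_iff.1 hX, hc⟩

/-- Connectedness makes all extended distances finite, so the problem can be treated with `G.dist`
in `ℕ` from here on. -/
theorem isYesInstance_iff (hG : G.Connected) {k : ℕ} : IsYesInstance G k ↔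
    ∃ (s v : V) (q : G.Walk s v), q.length = G.dist s v ∧
      ∀ u, ∃ w ∈ q.support, G.dist u w ≤ k := by
  have key : ∀ {s v : V} (q : G.Walk s v),
      (IsShortestPath q ↔ q.length = G.dist s v) ∧
      (ecc G {x | x ∈ q.support} ≤ (k : ℕ∞) ↔ ∀ u, ∃ w ∈ q.support, G.dist u w ≤ k) := by
    intro s v q
    constructor
    · constructor
      · intro h
        obtain ⟨q', hq'⟩ := hG.exists_walk_length_eq_dist s v
        exact le_antisymm (hq' ▸ h q') (SimpleGraph.dist_le q)
      · intro h q'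
        exact h ▸ SimpleGraph.dist_le q'
    · simp only [ecc, iSup_le_iff]
      refine forall_congr' fun u => ?_
      constructor
      · intro h
        by_contra! hc
        have : ((k + 1 : ℕ) : ℕ∞) ≤ distToSet G u {x | x ∈ q.support} := by
          refine le_iInf₂ fun w hw => ?_
          rw [← (hG u w).coe_dist_eq_edist]
          exact_mod_cast hc w hw
        have := this.trans h
        norm_cast at this
        omega
      · rintro ⟨w, hw, hk⟩
        refine (iInf₂_le w hw).trans ?_
        rw [← (hG u w).coe_dist_eq_edist]
        exact_mod_cast hk
  constructor
  · rintro ⟨s, v, q, h1, h2⟩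
    exact ⟨s, v, q, (key q).1.1 h1, (key q).2.1 h2⟩
  · rintro ⟨s, v, q, h1, h2⟩
    exact ⟨s, v, q, (key q).1.2 h1, (key q).2.2 h2⟩

/-! ### Distances and shortest paths -/

theorem dist_le_succ_iff (hG : G.Connected) {u v : V} {r : ℕ} :
    G.dist u v ≤ r + 1 ↔ u = v ∨ ∃ w, G.Adj u w ∧ G.dist w v ≤ r := by
  constructor
  · intro h
    obtain ⟨q, hq⟩ := hG.exists_walk_length_eq_dist u v
    cases q with
    | nil => exact Or.inl rfl
    | @cons _ w _ ha q =>
      refine Or.inr ⟨w, ha, (SimpleGraph.dist_le q).trans ?_⟩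
      simp only [SimpleGraph.Walk.length_cons] at hq
      omega
  · rintro (rfl | ⟨w, ha, h⟩)
    · simp
    · have := hG.dist_triangle (u := u) (v := w) (w := v)
      have := SimpleGraph.dist_eq_one_iff_adj.2 ha
      omega

theorem isPath_of_length_eq_dist {s v : V} (q : G.Walk s v) (hq : q.length = G.dist s v) :
    q.IsPath := SimpleGraph.Walk.isPath_of_length_eq_dist q hq

theorem dist_lt_card [Fintype V] (hG : G.Connected) (u v : V) : G.dist u v < Fintype.card V := by
  obtain ⟨q, hq⟩ := hG.exists_walk_length_eq_dist u v
  exact hq ▸ (isPath_of_length_eq_dist q hq).length_lt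

/-- Two vertices of a walk whose length is a distance have the distance that the walk suggests. -/
theorem dist_getVert {s v : V} (hG : G.Connected) (q : G.Walk s v) (hq : q.length = G.dist s v)
    {i j : ℕ} (hij : i ≤ j) (hj : j ≤ q.length) : G.dist (q.getVert i) (q.getVert j) = j - i := by
  have step : ∀ (a d : ℕ), a + d ≤ q.length → G.dist (q.getVert a) (q.getVert (a + d)) ≤ d := by
    intro a d
    induction d with
    | zero => simp
    | succ d ih =>
      intro h
      have h1 := ih (by omega)
      have h2 := q.adj_getVert_succ (i := a + d) (by omega)
      have h3 := SimpleGraph.dist_eq_one_iff_adj.2 h2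
      have := hG.dist_triangle (u := q.getVert a) (v := q.getVert (a + d)) (w := q.getVert (a + d + 1))
      rw [← add_assoc]
      omega
  -- The three pieces of the walk bound three distances from above, and these bounds add up to
  -- `G.dist s v`. By the triangle inequality none of them can be strict.
  have h1 := step 0 i (by omega)
  have h2 := step i (j - i) (by omega)
  have h3 := step j (q.length - j) (by omega)
  rw [Nat.add_sub_cancel' hij] at h2
  rw [Nat.add_sub_cancel' hj] at h3
  simp only [zero_add, SimpleGraph.Walk.getVert_zero, SimpleGraph.Walk.getVert_length] at h1 h3
  have t1 := hG.dist_triangle (u := s) (v := q.getVert i) (w := v)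
  have t2 := hG.dist_triangle (u := q.getVert i) (v := q.getVert j) (w := v)
  omega

/-- The distance between a vertex and a set of vertices. -/
noncomputable def minDist (G : SimpleGraph V) (u : V) (S : Set V) : ℕ :=
  sInf {d | ∃ y ∈ S, G.dist u y = d}

theorem minDist_le {u y : V} {S : Set V} (hy : y ∈ S) : minDist G u S ≤ G.dist u y :=
  Nat.sInf_le ⟨y, hy, rfl⟩

theorem exists_dist_eq_minDist {u : V} {S : Set V} (hS : S.Nonempty) :
    ∃ y ∈ S, G.dist u y = minDist G u S := by
  obtain ⟨y, hy⟩ := hS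
  exact Nat.sInf_mem (s := {d | ∃ y ∈ S, G.dist u y = d}) ⟨_, y, hy, rfl⟩

theorem minDist_le_iff {u : V} {S : Set V} (hS : S.Nonempty) {r : ℕ} :
    minDist G u S ≤ r ↔ ∃ y ∈ S, G.dist u y ≤ r := by
  constructor
  · intro h
    obtain ⟨y, hy, h'⟩ := exists_dist_eq_minDist (G := G) (u := u) hS
    exact ⟨y, hy, h' ▸ h⟩
  · rintro ⟨y, hy, h⟩
    exact (minDist_le hy).trans h

/-! ### What a path of small eccentricity has to meet -/

section Decision

variable {n : ℕ} {G : SimpleGraph (Fin n)}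

/-- A vertex outside `X` that is not brought within distance `k` of the path by the vertices of `X`,
if `x e` is promised to have distance at most `δ e` from the path. -/
def IsBad (G : SimpleGraph (Fin n)) (X : Finset (Fin n)) (x : ℕ → Fin n) (p k : ℕ) (δ : ℕ → ℕ)
    (u : Fin n) : Prop :=
  u ∉ X ∧ ∀ e < p, k < G.dist u (x e) + δ e

/-- The least bad vertex of its clique. -/
def IsRep (G : SimpleGraph (Fin n)) (X : Finset (Fin n)) (x : ℕ → Fin n) (p k : ℕ) (δ : ℕ → ℕ)
    (u : Fin n) : Prop :=
  IsBad G X x p k δ u ∧ ∀ w < u, IsBad G X x p k δ w → ¬ G.Adj w u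

/-- `w` lies in the same clique of `G \ X` as `u`. -/
def Touches (G : SimpleGraph (Fin n)) (X : Finset (Fin n)) (u w : Fin n) : Prop :=
  w ∉ X ∧ (w = u ∨ G.Adj w u)

variable {X : Finset (Fin n)} {x : ℕ → Fin n} {p k : ℕ} {δ : ℕ → ℕ}

/-- Vertices of `X` are covered by the promise, vertices that are not bad by the triangle inequality
through some `x e`. A bad vertex lies in the clique of a representative, which `S` touches; this
gives distance at most 1, and is the reason for `1 ≤ k`. -/
theorem covers_of_reps (hG : G.Connected) (hX : HitsP3 G X) (hx : ∀ v ∈ X, ∃ e < p, x e = v)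
    (hk : 1 ≤ k) (S : Set (Fin n)) (hδ : ∀ e < p, δ e ≤ k)
    (hS : ∀ e < p, ∃ w ∈ S, G.dist (x e) w ≤ δ e)
    (hR : ∀ u, IsRep G X x p k δ u → ∃ w ∈ S, Touches G X u w) (u : Fin n) :
    ∃ w ∈ S, G.dist u w ≤ k := by
  by_cases huX : u ∈ X
  · obtain ⟨e, he, rfl⟩ := hx u huX
    obtain ⟨w, hw, h⟩ := hS e he
    exact ⟨w, hw, h.trans (hδ e he)⟩
  by_cases hb : IsBad G X x p k δ u
  -- The least bad vertex equal or adjacent to `u` is a representative: a smaller bad neighbour of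
  -- it would again be equal or adjacent to `u`.
  · obtain ⟨u₀, ⟨hu₀, hadj⟩, hmin⟩ := WellFounded.has_min (wellFounded_lt (α := Fin n))
      {w | IsBad G X x p k δ w ∧ (w = u ∨ G.Adj w u)} ⟨u, hb, Or.inl rfl⟩
    obtain ⟨w, hw, hwX, hwu⟩ := hR u₀ ⟨hu₀, fun w hw hbw ha => hmin w ⟨hbw, by
      by_cases hwu : w = u
      · exact Or.inl hwu
      rcases hadj with rfl | h
      · exact Or.inr ha
      · exact Or.inr (hX w u₀ u hbw.1 hu₀.1 huX hwu ha h)⟩ hw⟩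
    refine ⟨w, hw, le_trans ?_ hk⟩
    by_cases hwu' : u = w
    · simp [hwu']
    refine (SimpleGraph.dist_eq_one_iff_adj.2 ?_).le
    rcases hadj with rfl | h
    · rcases hwu with rfl | h'
      · exact absurd rfl hwu'
      · exact h'.symm
    · rcases hwu with rfl | h'
      · exact h.symm
      · exact hX u u₀ w huX hu₀.1 hwX hwu' h.symm h'.symm
  · simp only [IsBad, not_and, not_forall, not_lt] at hb
    obtain ⟨e, he, h⟩ := hb huX
    obtain ⟨w, hw, h'⟩ := hS e he
    exact ⟨w, hw, hG.dist_triangle.trans ((Nat.add_le_add_left h' _).trans h)⟩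

/-- A shortest walk from `u` to a vertex of `S` within distance `k` cannot pass through some `x e`:
its length would be at least `G.dist u (x e) + δ e`, which exceeds `k` as `u` is bad. A walk outside
`X` stays in one clique. -/
theorem exists_touches_of_covers (hG : G.Connected) (hX : HitsP3 G X)
    (hx : ∀ v ∈ X, ∃ e < p, x e = v) (S : Set (Fin n)) (hS : ∀ u, ∃ w ∈ S, G.dist u w ≤ k)
    (hδ : ∀ e < p, δ e = minDist G (x e) S) {u : Fin n} (hu : IsBad G X x p k δ u) :
    ∃ w ∈ S, Touches G X u w := by
  obtain ⟨w, hw, hk⟩ := hS u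
  obtain ⟨q, hq⟩ := hG.exists_walk_length_eq_dist u w
  have hav : ∀ y ∈ q.support, y ∉ X := by
    intro y hy hyX
    obtain ⟨e, he, rfl⟩ := hx y hyX
    have h1 := congrArg SimpleGraph.Walk.length (q.take_spec hy)
    rw [SimpleGraph.Walk.length_append] at h1
    have h2 := SimpleGraph.dist_le (q.takeUntil _ hy)
    have h3 := SimpleGraph.dist_le (q.dropUntil _ hy)
    have h4 := hu.2 e he
    have h5 := minDist_le (G := G) (u := x e) hw
    rw [hδ e he] at h4
    omega
  refine ⟨w, hw, hav w q.end_mem_support, ?_⟩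
  rcases hX.eq_or_adj_of_walk q hav with h | h
  · exact Or.inl h.symm
  · exact Or.inr h.symm

/-- A shortest path enters at most `|X| + 1` cliques. -/
theorem card_reps_le (hX : HitsP3 G X) {s v : Fin n} (q : G.Walk s v)
    (hq : q.length = G.dist s v) (R : Finset (Fin n)) (hR : ∀ u ∈ R, IsRep G X x p k δ u)
    (hT : ∀ u ∈ R, ∃ w ∈ q.support, Touches G X u w) : R.card ≤ X.card + 1 := by
  classical
  -- At the first position in the clique of `u`, the predecessor on the path is not in that clique
  -- although it is adjacent to it, so it belongs to `X`.
  have hfirst : ∀ u ∈ R, ∃ j ≤ q.length, Touches G X u (q.getVert j) ∧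
      (j = 0 ∨ ∃ i, j = i + 1 ∧ q.getVert i ∈ X) := by
    intro u hu
    have hex : ∃ j, j ≤ q.length ∧ Touches G X u (q.getVert j) := by
      obtain ⟨w, hw, h⟩ := hT u hu
      obtain ⟨j, rfl, hj⟩ := (SimpleGraph.Walk.mem_support_iff_exists_getVert).1 hw
      exact ⟨j, hj, h⟩
    refine ⟨Nat.find hex, (Nat.find_spec hex).1, (Nat.find_spec hex).2, ?_⟩
    rcases hj : Nat.find hex with _ | i
    · exact Or.inl rfl
    · refine Or.inr ⟨i, rfl, ?_⟩
      have h1 := Nat.find_spec hex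
      rw [hj] at h1
      have h2 := Nat.find_min hex (m := i) (by omega)
      by_contra hiX
      have huX := (hR u hu).1.1
      have ha := q.adj_getVert_succ (i := i) (by omega)
      refine h2 ⟨by omega, hiX, ?_⟩
      by_cases hiu : q.getVert i = u
      · exact Or.inl hiu
      rcases h1.2.2 with h | h
      · exact Or.inr (h ▸ ha)
      · exact Or.inr (hX _ _ _ hiX h1.2.1 huX hiu ha h)
  choose! j hj hjT hj0 using hfirst
  -- A vertex outside `X` lies in only one clique, and a clique has only one least bad vertex.
  have hinj : ∀ u ∈ R, ∀ u' ∈ R, j u = j u' → u = u' := by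
    intro u hu u' hu' h
    have h1 := hjT u hu
    have h2 := hjT u' hu'
    rw [← h] at h2
    set w := q.getVert (j u)
    by_contra hne
    have huX := (hR u hu).1.1
    have huX' := (hR u' hu').1.1
    have hadj : G.Adj u u' := by
      rcases h1.2 with e1 | e1
      · rcases h2.2 with e2 | e2
        · exact absurd (e1.symm.trans e2) hne
        · exact e1 ▸ e2
      · rcases h2.2 with e2 | e2
        · exact e2 ▸ e1.symm
        · exact hX u w u' huX h1.1 huX' hne e1.symm e2
    rcases lt_or_gt_of_ne hne with hlt | hlt
    · exact (hR u' hu').2 u hlt (hR u hu).1 hadj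
    · exact (hR u hu).2 u' hlt (hR u' hu').1 hadj.symm
  -- Each representative is sent to the predecessor of its first touching vertex, or to `none` if
  -- this is the start of the path; the extra element `none` is the `+ 1`. The path repeats no
  -- vertex, so the predecessor determines the position.
  rw [← Finset.card_insertNone]
  refine Finset.card_le_card_of_injOn
    (fun u => if j u = 0 then none else some (q.getVert (j u - 1))) ?_ ?_
  · intro u hu
    rcases hj0 u hu with h | ⟨i, h, hi⟩
    · simp [h]
    · simp [h, hi]
  · intro u hu u' hu' h
    refine hinj u hu u' hu' ?_
    rcases hj0 u hu with h1 | ⟨i, h1, -⟩ <;> rcases hj0 u' hu' with h2 | ⟨i', h2, -⟩ <;>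
      simp only [h1, h2, if_true, Nat.add_eq_zero_iff, one_ne_zero, and_false, if_false,
        reduceCtorEq, Nat.add_sub_cancel, Option.some.injEq] at h ⊢
    have := (isPath_of_length_eq_dist q hq).getVert_injOn (x₁ := i) (x₂ := i')
      (by have := hj u hu; simp; omega) (by have := hj u' hu'; simp; omega) h
    omega

/-- The upper bounds for the distances from the `x e` to a path that starts in `s` that are encoded
by the digits `f`: the path contains those `x e` with `f e = 0`, and their distances together
with that to `s` exceed the distance to the path by `f e - 1`. -/
noncomputable def guess (G : SimpleGraph (Fin n)) (x : ℕ → Fin n) (p : ℕ) (s : Fin n) (f : ℕ → ℕ)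
    (e : ℕ) : ℕ :=
  minDist G (x e) {y | y = s ∨ ∃ i < p, f i = 0 ∧ y = x i} - (f e - 1)

/-- Every vertex of the path is at distance at most 2 from `T`, since three consecutive path
vertices outside `X` would be an induced path. So the distances to `T` and to the path differ by 0,
1 or 2. Together with the digit for "on the path" this makes four cases. -/
theorem exists_guess_eq (hG : G.Connected) (hX : HitsP3 G X) (hx : ∀ v ∈ X, ∃ e < p, x e = v)
    {s v : Fin n} (q : G.Walk s v) (hq : q.length = G.dist s v) :
    ∃ f : ℕ → ℕ, (∀ e, f e < 4) ∧
      ∀ e < p, guess G x p s f e = minDist G (x e) {w | w ∈ q.support} := by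
  classical
  set S : Set (Fin n) := {w | w ∈ q.support} with hS
  set T : Set (Fin n) := {y | y = s ∨ ∃ i < p, x i ∈ S ∧ y = x i} with hT
  have hsT : s ∈ T := Or.inl rfl
  have hTS : T ⊆ S := by
    rintro y (rfl | ⟨i, _, hi, rfl⟩)
    · exact q.start_mem_support
    · exact hi
  have hnear : ∀ w ∈ S, ∃ y ∈ T, G.dist w y ≤ 2 := by
    intro w hw
    obtain ⟨j, rfl, hj⟩ := (SimpleGraph.Walk.mem_support_iff_exists_getVert).1 hw
    have hd : ∀ i ≤ j, G.dist (q.getVert j) (q.getVert i) = j - i := fun i hi => by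
      rw [G.dist_comm]; exact dist_getVert hG q hq hi hj
    by_cases hj2 : j ≤ 2
    · refine ⟨s, hsT, ?_⟩
      have := hd 0 (Nat.zero_le _)
      rw [q.getVert_zero] at this
      omega
    · obtain ⟨i, rfl⟩ : ∃ i, j = i + 2 := ⟨j - 2, by omega⟩
      have hmem : ∀ a, i ≤ a → a ≤ i + 2 → q.getVert a ∈ X →
          ∃ y ∈ T, G.dist (q.getVert (i + 2)) y ≤ 2 := by
        intro a h1 h2 ha
        obtain ⟨e, he, hxe⟩ := hx _ ha
        exact ⟨q.getVert a, Or.inr ⟨e, he, hxe ▸ q.getVert_mem_support a, hxe.symm⟩, by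
          rw [hd a h2]; omega⟩
      by_contra hcon
      have h0 : q.getVert i ∉ X := fun h => hcon (hmem i (by omega) (by omega) h)
      have h1 : q.getVert (i + 1) ∉ X := fun h => hcon (hmem (i + 1) (by omega) (by omega) h)
      have h2 : q.getVert (i + 2) ∉ X := fun h => hcon (hmem (i + 2) (by omega) (by omega) h)
      have d2 := hd i (by omega)
      have hne : q.getVert i ≠ q.getVert (i + 2) := by
        intro h; rw [h, SimpleGraph.dist_self] at d2; omega
      have := hX _ _ _ h0 h1 h2 hne (q.adj_getVert_succ (by omega)) (q.adj_getVert_succ (by omega))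
      have := SimpleGraph.dist_eq_one_iff_adj.2 this.symm
      omega
  have hle : ∀ e, minDist G (x e) S ≤ minDist G (x e) T := fun e => by
    obtain ⟨y, hy, h⟩ := exists_dist_eq_minDist (G := G) (u := x e) ⟨s, hsT⟩
    exact h ▸ minDist_le (hTS hy)
  have hge : ∀ e, minDist G (x e) T ≤ minDist G (x e) S + 2 := fun e => by
    obtain ⟨w, hw, h⟩ := exists_dist_eq_minDist (G := G) (u := x e) (S := S) ⟨s, hTS hsT⟩
    obtain ⟨y, hy, h'⟩ := hnear w hw
    have := minDist_le (G := G) (u := x e) hy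
    have := hG.dist_triangle (u := x e) (v := w) (w := y)
    omega
  -- The `+ 1` keeps the digits of vertices off the path nonzero. For a vertex on the path the
  -- truncated `0 - 1` is `0`, and its distance to `T` is `0` as well.
  refine ⟨fun e => if x e ∈ S then 0 else minDist G (x e) T - minDist G (x e) S + 1, ?_, ?_⟩
  · intro e
    have := hge e
    dsimp only
    split_ifs <;> omega
  · intro e he
    -- The digit zero marks exactly the vertices on the path, so the set that `guess` reads off the
    -- digits is `T`.
    have hTe : {y | y = s ∨ ∃ i < p, (if x i ∈ S then 0 else
        minDist G (x i) T - minDist G (x i) S + 1) = 0 ∧ y = x i} = T := by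
      ext y
      simp only [Set.mem_ofPred_eq, hT]
      refine or_congr Iff.rfl (exists_congr fun i => and_congr Iff.rfl (and_congr ?_ Iff.rfl))
      split_ifs with h <;> simp [h]
    simp only [guess, hTe]
    have h1 := hle e
    have h2 := hge e
    split_ifs with h
    · have h3 := minDist_le (G := G) (u := x e) (S := T) (Or.inr ⟨e, he, h, rfl⟩)
      rw [SimpleGraph.dist_self] at h3
      omega
    · omega

end Decision

/-! ### Collecting a modulator -/

section Pick

/-- The vertices `a`, `b`, `c` avoid `l` and form an induced path. -/
def IsFreeP3 (A : ℕ → ℕ → Prop) (l : List ℕ) (t : ℕ × ℕ × ℕ) : Prop :=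
  t.1 ∉ l ∧ t.2.1 ∉ l ∧ t.2.2 ∉ l ∧ t.1 ≠ t.2.2 ∧ A t.1 t.2.1 ∧ A t.2.1 t.2.2 ∧ ¬ A t.1 t.2.2

/-- The entry of a triple that is selected by a digit. -/
def entry (d : ℕ) (t : ℕ × ℕ × ℕ) : ℕ := if d = 0 then t.1 else if d = 1 then t.2.1 else t.2.2

open Classical in
/-- Add the entry of `t` selected by the digits `f`, if `t` is not yet met. -/
noncomputable def pick (A : ℕ → ℕ → Prop) (f : ℕ → ℕ) (l : List ℕ) (t : ℕ × ℕ × ℕ) : List ℕ :=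
  if IsFreeP3 A l t then l ++ [entry (f l.length) t] else l

variable {A : ℕ → ℕ → Prop} {f : ℕ → ℕ}

theorem prefix_pick (l : List ℕ) (t : ℕ × ℕ × ℕ) : l <+: pick A f l t := by
  unfold pick; split_ifs <;> simp

theorem prefix_foldl_pick (ts : List (ℕ × ℕ × ℕ)) (l : List ℕ) : l <+: ts.foldl (pick A f) l := by
  induction ts generalizing l with
  | nil => simp
  | cons t ts ih => exact (prefix_pick l t).trans (ih _)

theorem not_isFreeP3_pick (l : List ℕ) (t : ℕ × ℕ × ℕ) : ¬ IsFreeP3 A (pick A f l t) t := by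
  by_cases h : IsFreeP3 A l t
  · rw [pick, if_pos h]
    unfold entry IsFreeP3
    split_ifs <;> simp
  · rwa [pick, if_neg h]

theorem IsFreeP3.mono {l l' : List ℕ} (h : l ⊆ l') {t : ℕ × ℕ × ℕ} (ht : IsFreeP3 A l' t) :
    IsFreeP3 A l t :=
  ⟨fun h' => ht.1 (h h'), fun h' => ht.2.1 (h h'), fun h' => ht.2.2.1 (h h'), ht.2.2.2⟩

/-- The list only grows, so a triple that is met once stays met. This is why a single pass over the
triples suffices. -/
theorem not_isFreeP3_foldl_pick (ts : List (ℕ × ℕ × ℕ)) (l : List ℕ) {t : ℕ × ℕ × ℕ}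
    (ht : t ∈ ts) : ¬ IsFreeP3 A (ts.foldl (pick A f) l) t := by
  induction ts generalizing l with
  | nil => simp at ht
  | cons t' ts ih =>
    rcases List.mem_cons.1 ht with rfl | h
    · exact fun h => not_isFreeP3_pick l t (h.mono (prefix_foldl_pick ts _).subset)
    · exact ih _ h

theorem nodup_foldl_pick (ts : List (ℕ × ℕ × ℕ)) (l : List ℕ) (hl : l.Nodup) :
    (ts.foldl (pick A f) l).Nodup := by
  induction ts generalizing l with
  | nil => exact hl
  | cons t ts ih =>
    refine ih _ ?_
    by_cases h : IsFreeP3 A l t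
    · rw [pick, if_pos h]
      have : entry (f l.length) t ∉ l := by
        unfold entry; split_ifs; exacts [h.1, h.2.1, h.2.2.1]
      rw [List.nodup_append]
      refine ⟨hl, List.nodup_singleton _, fun a ha b hb => ?_⟩
      rw [List.mem_singleton] at hb
      rintro rfl
      exact this (hb ▸ ha)
    · rwa [pick, if_neg h]

theorem forall_mem_foldl_pick {P : ℕ → Prop} (ts : List (ℕ × ℕ × ℕ)) (l : List ℕ)
    (hl : ∀ a ∈ l, P a) (hts : ∀ t ∈ ts, P t.1 ∧ P t.2.1 ∧ P t.2.2) :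
    ∀ a ∈ ts.foldl (pick A f) l, P a := by
  induction ts generalizing l with
  | nil => exact hl
  | cons t ts ih =>
    refine ih _ ?_ (fun t' ht' => hts t' (List.mem_cons_of_mem _ ht'))
    have ht := hts t List.mem_cons_self
    by_cases h : IsFreeP3 A l t
    · rw [pick, if_pos h]
      intro a ha
      rcases List.mem_append.1 ha with h' | h'
      · exact hl a h'
      · rw [List.mem_singleton] at h'
        subst h'
        unfold entry; split_ifs; exacts [ht.1, ht.2.1, ht.2.2]
    · rwa [pick, if_neg h]

/-- A pick at position `e` reads only the digit `e`, so a run depends only on as many digits as the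
final list is long. -/
theorem foldl_pick_congr {f f' : ℕ → ℕ} (ts : List (ℕ × ℕ × ℕ)) (l : List ℕ)
    (h : ∀ e < (ts.foldl (pick A f) l).length, f e = f' e) :
    ts.foldl (pick A f') l = ts.foldl (pick A f) l := by
  induction ts generalizing l with
  | nil => rfl
  | cons t ts ih =>
    have : pick A f' l t = pick A f l t := by
      by_cases h' : IsFreeP3 A l t
      · have hlt : l.length < ((t :: ts).foldl (pick A f) l).length := by
          have := (prefix_foldl_pick (A := A) (f := f) ts (pick A f l t)).length_le
          have h2 : (pick A f l t).length = l.length + 1 := by simp [pick, if_pos h']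
          rw [h2] at this
          exact this
        simp [pick, if_pos h', h _ hlt]
      · simp [pick, if_neg h']
    rw [List.foldl_cons, this]
    exact ih _ h

/-- With suitable digits only elements of a given hitting set are picked. -/
theorem exists_foldl_pick_subset (P : ℕ → Prop) (ts : List (ℕ × ℕ × ℕ))
    (hP : ∀ t ∈ ts, IsFreeP3 A [] t → P t.1 ∨ P t.2.1 ∨ P t.2.2) :
    ∃ f : ℕ → ℕ, (∀ e, f e < 4) ∧ ∀ a ∈ ts.foldl (pick A f) [], P a := by
  induction ts using List.reverseRecOn with
  | nil => exact ⟨fun _ => 0, by simp, by simp⟩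
  | append_singleton ts t ih =>
    obtain ⟨f, hf, hP'⟩ := ih fun t' ht' => hP t' (by simp [ht'])
    set l := ts.foldl (pick A f) [] with hl
    by_cases h : IsFreeP3 A l t
    · obtain ⟨d, hd, hPd⟩ : ∃ d < 4, P (entry d t) := by
        rcases hP t (by simp) (IsFreeP3.mono (List.nil_subset l) h) with h' | h' | h'
        · exact ⟨0, by omega, h'⟩
        · exact ⟨1, by omega, h'⟩
        · exact ⟨2, by omega, h'⟩
      refine ⟨Function.update f l.length d, fun e => ?_, ?_⟩
      · by_cases he : e = l.length
        · simp [he, hd]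
        · simp [he, hf]
      -- The digit at position `l.length` has not been read by the earlier triples, so it can still
      -- be chosen freely.
      · have hc : ts.foldl (pick A (Function.update f l.length d)) [] = l :=
          foldl_pick_congr ts [] fun e he => by
            rw [← hl] at he
            simp [he.ne]
        rw [List.foldl_append, hc]
        intro a ha
        simp only [List.foldl_cons, List.foldl_nil, pick, if_pos h, Function.update_self,
          List.mem_append, List.mem_singleton] at ha
        rcases ha with ha | rfl
        · exact hP' a ha
        · exact hPd
    · refine ⟨f, hf, ?_⟩
      rw [List.foldl_append, ← hl]
      simpa [pick, if_neg h] using hP'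

end Pick
end MESP

/-! ### Reasoning about terms and commands -/

namespace RAM

namespace State

theorem setVar_var (σ : State) (x c y : ℕ) :
    (σ.setVar x c).var y = if y = x then c else σ.var y := by
  simp [setVar, Function.update_apply]

theorem setVar_arr (σ : State) (x c : ℕ) : (σ.setVar x c).arr = σ.arr := rfl

theorem setArr_var (σ : State) (a i c : ℕ) : (σ.setArr a i c).var = σ.var := rfl

theorem setArr_arr (σ : State) (a i c b j : ℕ) :
    (σ.setArr a i c).arr b j = if b = a ∧ j = i then c else σ.arr b j := by
  by_cases h : b = a
  · subst h; simp [setArr, Function.update_apply]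
  · simp [setArr, h]

end State

/-! ### Truth values and cost bounds of terms -/

namespace Tm

/-- The truth of a term. -/
def Holds (e : Tm) (σ : State) : Prop := e.eval σ ≠ 0

/-- Conjunction. -/
abbrev and (e f : Tm) : Tm := ite e f (lit 0)

/-- Negation. -/
abbrev not (e : Tm) : Tm := eq e (lit 0)

theorem holds_lt (e f : Tm) (σ : State) : (lt e f).Holds σ ↔ e.eval σ < f.eval σ := by
  simp [Holds, eval]

theorem holds_eq (e f : Tm) (σ : State) : (eq e f).Holds σ ↔ e.eval σ = f.eval σ := by
  simp [Holds, eval]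

theorem holds_not (e : Tm) (σ : State) : (eq e (lit 0)).Holds σ ↔ ¬ e.Holds σ := by
  by_cases h : e.eval σ = 0 <;> simp [Holds, eval, h]

theorem holds_and (e f : Tm) (σ : State) : (ite e f (lit 0)).Holds σ ↔ e.Holds σ ∧ f.Holds σ := by
  by_cases h : e.eval σ = 0 <;> simp [Holds, eval, h]

theorem holds_add (e f : Tm) (σ : State) : (add e f).Holds σ ↔ e.Holds σ ∨ f.Holds σ := by
  simp only [Holds, eval]; omega

open Classical in
theorem holds_ite (b e f : Tm) (σ : State) :
    (ite b e f).Holds σ ↔ if b.Holds σ then e.Holds σ else f.Holds σ := by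
  by_cases h : b.eval σ = 0 <;> simp [Holds, eval, h]

theorem holds_sum (x : ℕ) (N e : Tm) (σ : State) :
    (sum x N e).Holds σ ↔ ∃ i < N.eval σ, e.Holds (σ.setVar x i) := by
  simp [Holds, eval, Finset.sum_eq_zero_iff]

open Classical in
theorem eval_ite (b e f : Tm) (σ : State) :
    (ite b e f).eval σ = if b.Holds σ then e.eval σ else f.eval σ := by
  by_cases h : b.eval σ = 0 <;> simp [Holds, eval, h]

theorem eval_lt (e f : Tm) (σ : State) :
    (lt e f).eval σ = if e.eval σ < f.eval σ then 1 else 0 := rfl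

theorem eval_eq (e f : Tm) (σ : State) :
    (eq e f).eval σ = if e.eval σ = f.eval σ then 1 else 0 := rfl

theorem eval_lit (c : ℕ) (σ : State) : (lit c).eval σ = c := rfl

theorem eval_var (x : ℕ) (σ : State) : (var x).eval σ = σ.var x := rfl

theorem eval_get (a : ℕ) (i : Tm) (σ : State) : (get a i).eval σ = σ.arr a (i.eval σ) := rfl

theorem eval_add (e f : Tm) (σ : State) : (add e f).eval σ = e.eval σ + f.eval σ := rfl

theorem eval_sub (e f : Tm) (σ : State) : (sub e f).eval σ = e.eval σ - f.eval σ := rfl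

theorem eval_sum (x : ℕ) (N e : Tm) (σ : State) :
    (sum x N e).eval σ = ∑ i ∈ Finset.range (N.eval σ), e.eval (σ.setVar x i) := rfl

/-- The size of a term. -/
def size : Tm → ℕ
  | lit _ => 2
  | var _ => 2
  | get _ i => i.size + 4
  | add e f => e.size + f.size + 6
  | sub e f => e.size + f.size + 6
  | lt e f => e.size + f.size + 6
  | eq e f => e.size + f.size + 6
  | ite b e f => b.size + e.size + f.size + 3
  | sum _ N e => N.size + e.size + 31

/-- The term contains no sums. -/
def flat : Tm → Bool
  | lit _ => true
  | var _ => true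
  | get _ i => i.flat
  | add e f => e.flat && f.flat
  | sub e f => e.flat && f.flat
  | lt e f => e.flat && f.flat
  | eq e f => e.flat && f.flat
  | ite b e f => b.flat && (e.flat && f.flat)
  | sum _ _ _ => false

/-- Evaluation takes at most `A` steps, up to a factor that depends only on the size. -/
def Fits (e : Tm) (σ : State) (A : ℕ) : Prop := 1 ≤ A ∧ e.cost σ ≤ e.size * A

variable {e f b N : Tm} {σ : State} {A B K : ℕ}

theorem Fits.mono (h : e.Fits σ A) (hAB : A ≤ B) : e.Fits σ B :=
  ⟨h.1.trans hAB, h.2.trans (Nat.mul_le_mul_left _ hAB)⟩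

theorem cost_le_size (h : e.flat = true) : e.cost σ ≤ e.size := by
  induction e with
  | lit | var => exact le_rfl
  | get a i ih => simp only [flat] at h; simp [cost, size, ih h]
  | add e f ihe ihf | sub e f ihe ihf | lt e f ihe ihf | eq e f ihe ihf =>
    simp only [flat, Bool.and_eq_true] at h
    have := ihe h.1; have := ihf h.2
    simp only [cost, size]; omega
  | ite b e f ihb ihe ihf =>
    simp only [flat, Bool.and_eq_true] at h
    have := ihb h.1; have := ihe h.2.1; have := ihf h.2.2
    simp only [cost, size]; split_ifs <;> omega
  | sum => simp [flat] at h

theorem fits_flat (h : e.flat = true) (hA : 1 ≤ A) : e.Fits σ A :=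
  ⟨hA, (cost_le_size h).trans (Nat.le_mul_of_pos_right _ hA)⟩

theorem fits_get {a : ℕ} (h : e.Fits σ A) : (get a e).Fits σ A :=
  ⟨h.1, by simp only [cost, size, add_mul]; have := h.1; have := h.2; omega⟩

theorem fits_add (he : e.Fits σ A) (hf : f.Fits σ A) : (add e f).Fits σ A :=
  ⟨he.1, by simp only [cost, size, add_mul]; have := he.1; have := he.2; have := hf.2; omega⟩

theorem fits_sub (he : e.Fits σ A) (hf : f.Fits σ A) : (sub e f).Fits σ A :=
  ⟨he.1, by simp only [cost, size, add_mul]; have := he.1; have := he.2; have := hf.2; omega⟩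

theorem fits_eq (he : e.Fits σ A) (hf : f.Fits σ A) : (eq e f).Fits σ A :=
  ⟨he.1, by simp only [cost, size, add_mul]; have := he.1; have := he.2; have := hf.2; omega⟩

/-- The bounds for the branches may use the condition. This is needed where a branch is cheap only
because the condition guarantees correct table entries. -/
theorem fits_ite (hb : b.Fits σ A) (he : b.Holds σ → e.Fits σ A) (hf : ¬ b.Holds σ → f.Fits σ A) :
    (ite b e f).Fits σ A := by
  refine ⟨hb.1, ?_⟩
  simp only [cost, size, add_mul]
  have := hb.1
  have := hb.2
  by_cases h : b.eval σ = 0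
  · have := (hf (by simp [Holds, h])).2
    simp only [h, if_true]
    omega
  · have := (he h).2
    simp only [h, if_false]
    omega

/-- The number of rounds goes into the budget `K * A`, while the overhead of 17 + 14 per sum goes
additively into `size`. Nesting therefore never mixes instance parameters into the constant. -/
theorem fits_sum {x : ℕ} (K : ℕ) (hK : 1 ≤ K) (hN : N.flat = true) (hNK : N.eval σ ≤ K)
    (hA : 1 ≤ A) (he : ∀ i < N.eval σ, e.Fits (σ.setVar x i) A) :
    (sum x N e).Fits σ (K * A) := by
  have hKA : 1 ≤ K * A := Nat.mul_pos hK hA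
  refine ⟨hKA, ?_⟩
  have h : ∑ i ∈ Finset.range (N.eval σ), (e.cost (σ.setVar x i) + 14) ≤
      N.eval σ * (e.size * A + 14 * A) := by
    rw [← smul_eq_mul, ← Finset.card_range (N.eval σ), ← Finset.sum_const, Finset.card_range]
    refine Finset.sum_le_sum fun i hi => ?_
    have := (he i (Finset.mem_range.1 hi)).2
    omega
  have h2 := h.trans (Nat.mul_le_mul_right _ hNK)
  simp only [cost, size]
  calc _ ≤ N.size * (K * A) + 17 * (K * A) + K * (e.size * A + 14 * A) := by
        have := Nat.le_mul_of_pos_right N.size hKA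
        have := Tm.cost_le_size (σ := σ) hN
        omega
    _ = _ := by ring

end Tm

/-! ### Frames and program logic with cost bounds -/

namespace Cmd

/-- The variables that a command may change. -/
def modV : Cmd → ℕ → Bool
  | set x _, y => y == x
  | store _ _ _, _ => false
  | seq p q, y => p.modV y || q.modV y
  | when _ p, y => p.modV y
  | loop x _ p, y => y == x || p.modV y

/-- The arrays that a command may change. -/
def modA : Cmd → ℕ → Bool
  | set _ _, _ => false
  | store a _ _, y => y == a
  | seq p q, y => p.modA y || q.modA y
  | when _ p, y => p.modA y
  | loop _ _ p, y => p.modA y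

/-- The size of a command. -/
def size : Cmd → ℕ
  | set _ e => e.size + 3
  | store _ i e => i.size + e.size + 5
  | seq p q => p.size + q.size + 1
  | when b p => b.size + p.size + 4
  | loop _ N p => N.size + p.size + 20

/-- The memories `σ` and `τ` differ only where the command `c` may change something. -/
structure Frame (c : Cmd) (σ τ : State) : Prop where
  var : ∀ y, c.modV y = false → τ.var y = σ.var y
  arr : ∀ a, c.modA a = false → τ.arr a = σ.arr a

theorem Frame.refl (c : Cmd) (σ : State) : c.Frame σ σ := ⟨fun _ _ => rfl, fun _ _ => rfl⟩

theorem frame_run (c : Cmd) : ∀ σ, c.Frame σ (c.run σ) := by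
  induction c with
  | set x e =>
    intro σ
    refine ⟨fun y hy => ?_, fun _ _ => rfl⟩
    have : y ≠ x := by simpa [modV] using hy
    simp [run, State.setVar_var, this]
  | store a i e =>
    intro σ
    refine ⟨fun _ _ => rfl, fun b hb => ?_⟩
    have : b ≠ a := by simpa [modA] using hb
    simp [run, State.setArr, this]
  | seq p q ihp ihq =>
    intro σ
    refine ⟨fun y hy => ?_, fun y hy => ?_⟩
    · simp only [modV, Bool.or_eq_false_iff] at hy
      exact ((ihq _).var y hy.2).trans ((ihp _).var y hy.1)
    · simp only [modA, Bool.or_eq_false_iff] at hy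
      exact ((ihq _).arr y hy.2).trans ((ihp _).arr y hy.1)
  | when b p ih =>
    intro σ
    by_cases h : b.eval σ = 0
    · simp only [run, h, if_true]; exact Frame.refl _ _
    · simp only [run, h, if_false]; exact ⟨(ih σ).var, (ih σ).arr⟩
  | loop x N p ih =>
    intro σ
    simp only [run]
    generalize N.eval σ = m
    induction m with
    | zero => exact Frame.refl _ _
    | succ m ihm =>
      refine ⟨fun y hy => ?_, fun y hy => ?_⟩
      · have h := hy
        simp only [modV, Bool.or_eq_false_iff] at h
        have h1 : y ≠ x := by simpa using h.1
        have := (ih ((iter (fun i τ => p.run (τ.setVar x i)) m σ).setVar x m)).var y h.2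
        rw [State.setVar_var, if_neg h1, ihm.var y hy] at this
        exact this
      · exact ((ih _).arr y hy).trans (ihm.arr y hy)

/-- The command takes at most `A` steps, up to a factor that depends only on its size, and leaves
a memory with the property `Q`. -/
def Spec (c : Cmd) (σ : State) (A : ℕ) (Q : State → Prop) : Prop :=
  1 ≤ A ∧ c.cost σ ≤ c.size * A ∧ Q (c.run σ)

variable {p q : Cmd} {e i b N : Tm} {σ : State} {A B K : ℕ} {Q R : State → Prop}

theorem Spec.mono (h : p.Spec σ A Q) (hAB : A ≤ B) : p.Spec σ B Q :=
  ⟨h.1.trans hAB, h.2.1.trans (Nat.mul_le_mul_left _ hAB), h.2.2⟩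

theorem Spec.imp (h : p.Spec σ A Q) (hQ : ∀ τ, p.Frame σ τ → Q τ → R τ) : p.Spec σ A R :=
  ⟨h.1, h.2.1, hQ _ (p.frame_run σ) h.2.2⟩

theorem spec_set {x : ℕ} (he : e.Fits σ A) (hQ : Q (σ.setVar x (e.eval σ))) :
    (set x e).Spec σ A Q :=
  ⟨he.1, by simp only [cost, size, add_mul]; have := he.1; have := he.2; omega, hQ⟩

theorem spec_store {a : ℕ} (hi : i.Fits σ A) (he : e.Fits σ A)
    (hQ : Q (σ.setArr a (i.eval σ) (e.eval σ))) : (store a i e).Spec σ A Q :=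
  ⟨he.1, by
    simp only [cost, size, add_mul]; have := he.1; have := he.2; have := hi.2; omega, hQ⟩

theorem spec_seq (hp : p.Spec σ A R) (hq : ∀ τ, p.Frame σ τ → R τ → q.Spec τ A Q) :
    (seq p q).Spec σ A Q := by
  have h := hq _ (p.frame_run σ) hp.2.2
  refine ⟨hp.1, ?_, h.2.2⟩
  simp only [cost, size, add_mul]
  have := hp.1; have := hp.2.1; have := h.2.1
  omega

theorem spec_when (hb : b.Fits σ A) (hp : b.Holds σ → p.Spec σ A Q) (h0 : ¬ b.Holds σ → Q σ) :
    (when b p).Spec σ A Q := by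
  have := hb.1; have := hb.2
  by_cases h : b.eval σ = 0
  · refine ⟨hb.1, ?_, ?_⟩
    · simp only [cost, size, add_mul, h, if_true]; omega
    · simpa [run, h] using h0 (by simp [Tm.Holds, h])
  · have hp := hp h
    refine ⟨hb.1, ?_, ?_⟩
    · simp only [cost, size, add_mul, h, if_false]; have := hp.2.1; omega
    · simpa [run, h] using hp.2.2

/-- The body may assume, besides the invariant, that the memory differs from the initial one only
where the loop writes. Invariants can thus be restricted to what changes. -/
theorem spec_loop {x : ℕ} (K : ℕ) (I : ℕ → State → Prop) (hK : 1 ≤ K) (hN : N.flat = true)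
    (hNK : N.eval σ ≤ K) (hA : 1 ≤ A) (h0 : I 0 σ)
    (hp : ∀ i < N.eval σ, ∀ τ, (loop x N p).Frame σ τ → I i τ →
      p.Spec (τ.setVar x i) A (I (i + 1)))
    (hQ : ∀ τ, (loop x N p).Frame σ τ → I (N.eval σ) τ → Q τ) :
    (loop x N p).Spec σ (K * A) Q := by
  have hKA : 1 ≤ K * A := Nat.mul_pos hK hA
  set f : ℕ → State → State := fun i τ => p.run (τ.setVar x i) with hf
  have inv : ∀ m ≤ N.eval σ, (loop x N p).Frame σ (iter f m σ) ∧ I m (iter f m σ) := by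
    intro m
    induction m with
    | zero => exact fun _ => ⟨Frame.refl _ _, h0⟩
    | succ m ih =>
      intro hm
      have h := ih (by omega)
      refine ⟨⟨fun y hy => ?_, fun y hy => ?_⟩, (hp m hm _ h.1 h.2).2.2⟩
      · have hy' := hy
        simp only [modV, Bool.or_eq_false_iff] at hy'
        have h1 : y ≠ x := by simpa using hy'.1
        have := (p.frame_run ((iter f m σ).setVar x m)).var y hy'.2
        rw [State.setVar_var, if_neg h1, h.1.var y hy] at this
        exact this
      · exact ((p.frame_run _).arr y hy).trans (h.1.arr y hy)
  refine ⟨hKA, ?_, hQ _ (frame_run _ _) (inv _ le_rfl).2⟩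
  have h : ∑ i ∈ Finset.range (N.eval σ), (p.cost ((iter f i σ).setVar x i) + 12) ≤
      N.eval σ * (p.size * A + 12 * A) := by
    rw [← smul_eq_mul, ← Finset.card_range (N.eval σ), ← Finset.sum_const, Finset.card_range]
    refine Finset.sum_le_sum fun i hi => ?_
    have hi := Finset.mem_range.1 hi
    have := (hp i hi _ (inv i hi.le).1 (inv i hi.le).2).2.1
    omega
  have h2 := h.trans (Nat.mul_le_mul_right _ hNK)
  have hc : cost (Cmd.loop x N p) σ = N.cost σ + 8 + ∑ i ∈ Finset.range (N.eval σ),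
      (p.cost ((iter f i σ).setVar x i) + 12) := rfl
  rw [hc]
  simp only [size]
  calc _ ≤ N.size * (K * A) + 8 * (K * A) + K * (p.size * A + 12 * A) := by
        have := Nat.le_mul_of_pos_right N.size hKA
        have := Tm.cost_le_size (σ := σ) hN
        omega
    _ = _ := by ring

/-- Filling an array by a loop. -/
theorem spec_fill {x a : ℕ} (K : ℕ) (Φ : ℕ → ℕ → Prop) (hK : 1 ≤ K) (hN : N.flat = true)
    (hNK : N.eval σ ≤ K) (hA : 1 ≤ A)
    (he : ∀ i < N.eval σ, ∀ τ, (loop x N (store a (.var x) e)).Frame σ τ →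
      (∀ j < i, Φ j (τ.arr a j)) → e.Fits (τ.setVar x i) A ∧ Φ i (e.eval (τ.setVar x i))) :
    (loop x N (store a (.var x) e)).Spec σ (K * A) (fun τ => ∀ j < N.eval σ, Φ j (τ.arr a j)) := by
  refine spec_loop K (fun i τ => ∀ j < i, Φ j (τ.arr a j)) hK hN hNK hA (by simp) ?_
    (fun _ _ h => h)
  intro i hi τ hτ hI
  obtain ⟨h1, h2⟩ := he i hi τ hτ hI
  refine spec_store (Tm.fits_flat rfl hA) h1 ?_
  intro j hj
  rw [State.setArr_arr]
  simp only [Tm.eval, State.setVar_var, if_true, true_and, State.setVar_arr]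
  split_ifs with h
  · rw [h]; exact h2
  · exact hI j (by omega)

end Cmd
end RAM

/-! ### Filling multi-dimensional tables -/

namespace RAM

/-- Uniqueness of quotient and remainder by `L`: distinct table positions occupy distinct cells. -/
theorem cell_inj {L a b c d : ℕ} (hb : b < L) (hd : d < L) (h : a * L + b = c * L + d) :
    a = c ∧ b = d := by
  have hL : 0 < L := by omega
  have h1 : (a * L + b) / L = a := by
    rw [mul_comm, Nat.mul_add_div hL, Nat.div_eq_of_lt hb, add_zero]
  have h2 : (c * L + d) / L = c := by
    rw [mul_comm, Nat.mul_add_div hL, Nat.div_eq_of_lt hd, add_zero]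
  have : a = c := by rw [← h1, h, h2]
  subst this
  exact ⟨rfl, by omega⟩

theorem cell_lt {L R a b : ℕ} (ha : a < R) (hb : b < L) : a * L + b < R * L :=
  calc a * L + b < (a + 1) * L := by rw [add_mul, one_mul]; omega
    _ ≤ R * L := Nat.mul_le_mul_right _ ha

namespace Cmd

variable {p q : Cmd} {e i b N M : Tm} {σ τ τ' : State} {A B K L : ℕ} {Q R : State → Prop}

theorem Frame.body {x j : ℕ} (h : (loop x N p).Frame σ τ) (h' : p.Frame (τ.setVar x j) τ') :
    (loop x N p).Frame σ τ' := by
  refine ⟨fun y hy => ?_, fun y hy => (h'.arr y hy).trans (h.arr y hy)⟩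
  have hy' := hy
  simp only [modV, Bool.or_eq_false_iff] at hy'
  have h1 : y ≠ x := by simpa using hy'.1
  rw [h'.var y hy'.2, State.setVar_var, if_neg h1, h.var y hy]

theorem Frame.setVar {x j : ℕ} (h : (loop x N p).Frame σ τ) :
    (loop x N p).Frame σ (τ.setVar x j) :=
  h.body (Frame.refl _ _)

/-- When an entry in row `r` is computed, all earlier rows are already correct, so the rule also
serves recursions on the row. By `cell_inj` a store does not disturb the finished entries. -/
theorem spec_fill₂ {x y a : ℕ} (R L : ℕ) (Φ : ℕ → ℕ → ℕ → Prop) (hxy : x ≠ y) (hR : 1 ≤ R)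
    (hL : 1 ≤ L) (hA : 1 ≤ A) (hN : N.flat = true) (hM : M.flat = true) (hNR : N.eval σ = R)
    (hML : ∀ τ, (loop x N (loop y M (store a i e))).Frame σ τ → M.eval τ = L)
    (he : ∀ r < R, ∀ c < L, ∀ τ, (loop x N (loop y M (store a i e))).Frame σ τ →
      τ.var x = r → τ.var y = c → (∀ r' < r, ∀ c' < L, Φ r' c' (τ.arr a (r' * L + c'))) →
      (i.Fits τ A ∧ i.eval τ = r * L + c) ∧ e.Fits τ A ∧ Φ r c (e.eval τ)) :
    (loop x N (loop y M (store a i e))).Spec σ (R * (L * A))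
      (fun τ => ∀ r < R, ∀ c < L, Φ r c (τ.arr a (r * L + c))) := by
  refine spec_loop R (fun r τ => ∀ r' < r, ∀ c < L, Φ r' c (τ.arr a (r' * L + c))) hR hN hNR.le
    (Nat.mul_pos hL hA) (by simp) ?_ (fun τ _ h => hNR ▸ h)
  intro r hr τ hτ hI
  rw [hNR] at hr
  refine spec_loop L (fun c τ' => (∀ r' < r, ∀ c < L, Φ r' c (τ'.arr a (r' * L + c))) ∧
    ∀ c' < c, Φ r c' (τ'.arr a (r * L + c'))) hL hM (hML _ hτ.setVar).le hA ⟨hI, by simp⟩ ?_ ?_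
  · intro c hc τ' hτ' hI'
    rw [hML _ hτ.setVar] at hc
    have hf : (loop x N (loop y M (store a i e))).Frame σ (τ'.setVar y c) :=
      hτ.body (hτ'.setVar)
    have hx : (τ'.setVar y c).var x = r := by
      rw [State.setVar_var, if_neg hxy, hτ'.var x (by simp [modV, hxy]), State.setVar_var,
        if_pos rfl]
    obtain ⟨⟨h1, h2⟩, h3, h4⟩ := he r hr c hc _ hf hx (by simp [State.setVar_var]) hI'.1
    refine spec_store h1 h3 ⟨fun r' hr' c' hc' => ?_, fun c' hc' => ?_⟩
    · rw [State.setArr_arr, h2, if_neg]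
      · exact hI'.1 r' hr' c' hc'
      · rintro ⟨-, h⟩
        have := (cell_inj hc' hc h).1
        omega
    · rw [State.setArr_arr, h2]
      split_ifs with h
      · rw [(cell_inj (by omega) hc h.2).2]
        exact h4
      · refine hI'.2 c' ?_
        rcases Nat.lt_succ_iff_lt_or_eq.1 hc' with h' | rfl
        · exact h'
        · exact absurd ⟨rfl, rfl⟩ h
  · intro τ' hτ' hI' r' hr' c hc
    rw [hML _ hτ.setVar] at hI'
    rcases Nat.lt_succ_iff_lt_or_eq.1 hr' with h | rfl
    · exact hI'.1 r' h c hc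
    · exact hI'.2 c hc

theorem spec_fill₃ {x y z a : ℕ} {O : Tm} (R L₁ L₂ : ℕ) (Φ : ℕ → ℕ → ℕ → ℕ → Prop) (hxy : x ≠ y)
    (hxz : x ≠ z) (hyz : y ≠ z) (hR : 1 ≤ R) (hL₁ : 1 ≤ L₁) (hL₂ : 1 ≤ L₂) (hA : 1 ≤ A)
    (hN : N.flat = true) (hM : M.flat = true) (hO : O.flat = true) (hNR : N.eval σ = R)
    (hML : ∀ τ, (loop x N (loop y M (loop z O (store a i e)))).Frame σ τ →
      M.eval τ = L₁ ∧ O.eval τ = L₂)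
    (he : ∀ r < R, ∀ c < L₁, ∀ d < L₂, ∀ τ,
      (loop x N (loop y M (loop z O (store a i e)))).Frame σ τ →
      τ.var x = r → τ.var y = c → τ.var z = d →
      (∀ r' < r, ∀ c' < L₁, ∀ d' < L₂, Φ r' c' d' (τ.arr a ((r' * L₁ + c') * L₂ + d'))) →
      (i.Fits τ A ∧ i.eval τ = (r * L₁ + c) * L₂ + d) ∧ e.Fits τ A ∧ Φ r c d (e.eval τ)) :
    (loop x N (loop y M (loop z O (store a i e)))).Spec σ (R * (L₁ * (L₂ * A)))
      (fun τ => ∀ r < R, ∀ c < L₁, ∀ d < L₂, Φ r c d (τ.arr a ((r * L₁ + c) * L₂ + d))) := by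
  refine spec_loop R (fun r τ => ∀ r' < r, ∀ c < L₁, ∀ d < L₂,
      Φ r' c d (τ.arr a ((r' * L₁ + c) * L₂ + d))) hR hN hNR.le
    (Nat.mul_pos hL₁ (Nat.mul_pos hL₂ hA)) (by simp) ?_ (fun τ _ h => hNR ▸ h)
  intro r hr τ hτ hI
  rw [hNR] at hr
  refine spec_loop L₁ (fun c τ' =>
    (∀ r' < r, ∀ c < L₁, ∀ d < L₂, Φ r' c d (τ'.arr a ((r' * L₁ + c) * L₂ + d))) ∧
    ∀ c' < c, ∀ d < L₂, Φ r c' d (τ'.arr a ((r * L₁ + c') * L₂ + d))) hL₁ hM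
    (hML _ hτ.setVar).1.le (Nat.mul_pos hL₂ hA) ⟨hI, by simp⟩ ?_ ?_
  · intro c hc τ' hτ' hI'
    rw [(hML _ hτ.setVar).1] at hc
    have hOc := (hML _ (hτ.body (hτ'.setVar (j := c)))).2
    refine spec_loop L₂ (fun d τ₂ =>
      (∀ r' < r, ∀ c < L₁, ∀ d < L₂, Φ r' c d (τ₂.arr a ((r' * L₁ + c) * L₂ + d))) ∧
      (∀ c' < c, ∀ d < L₂, Φ r c' d (τ₂.arr a ((r * L₁ + c') * L₂ + d))) ∧
      ∀ d' < d, Φ r c d' (τ₂.arr a ((r * L₁ + c) * L₂ + d'))) hL₂ hO hOc.le hA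
      ⟨hI'.1, hI'.2, by simp⟩ ?_ ?_
    · intro d hd τ₂ hτ₂ hI₂
      rw [hOc] at hd
      have hf : (loop x N (loop y M (loop z O (store a i e)))).Frame σ (τ₂.setVar z d) :=
        hτ.body (hτ'.body hτ₂.setVar)
      have hy : (τ₂.setVar z d).var y = c := by
        rw [State.setVar_var, if_neg hyz, hτ₂.var y (by simp [modV, hyz]), State.setVar_var,
          if_pos rfl]
      have hx : (τ₂.setVar z d).var x = r := by
        rw [State.setVar_var, if_neg hxz, hτ₂.var x (by simp [modV, hxz]), State.setVar_var,
          if_neg hxy, hτ'.var x (by simp [modV, hxz, hxy]), State.setVar_var, if_pos rfl]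
      obtain ⟨⟨h1, h2⟩, h3, h4⟩ := he r hr c hc d hd _ hf hx hy (by simp [State.setVar_var]) hI₂.1
      refine spec_store h1 h3 ⟨fun r' hr' c' hc' d' hd' => ?_, fun c' hc' d' hd' => ?_,
        fun d' hd' => ?_⟩
      · rw [State.setArr_arr, h2, if_neg]
        · exact hI₂.1 r' hr' c' hc' d' hd'
        · rintro ⟨-, h⟩
          have := (cell_inj hc' hc (cell_inj hd' hd h).1).1
          omega
      · rw [State.setArr_arr, h2, if_neg]
        · exact hI₂.2.1 c' hc' d' hd'
        · rintro ⟨-, h⟩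
          have := (cell_inj hd' hd h).1
          omega
      · rw [State.setArr_arr, h2]
        split_ifs with h
        · rw [(cell_inj (by omega) hd h.2).2]
          exact h4
        · refine hI₂.2.2 d' ?_
          rcases Nat.lt_succ_iff_lt_or_eq.1 hd' with h' | rfl
          · exact h'
          · exact absurd ⟨rfl, rfl⟩ h
    · intro τ₂ hτ₂ hI₂
      rw [hOc] at hI₂
      refine ⟨hI₂.1, fun c' hc' d' hd' => ?_⟩
      rcases Nat.lt_succ_iff_lt_or_eq.1 hc' with h | rfl
      · exact hI₂.2.1 c' h d' hd'
      · exact hI₂.2.2 d' hd'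
  · intro τ' hτ' hI' r' hr' c hc d hd
    rw [(hML _ hτ.setVar).1] at hI'
    rcases Nat.lt_succ_iff_lt_or_eq.1 hr' with h | rfl
    · exact hI'.1 r' h c hc d hd
    · exact hI'.2 c hc d hd

end Cmd

/-! ### Distances -/

open Tm Cmd

/-- The input. -/
structure Input {n : ℕ} (G : SimpleGraph (Fin n)) (k : ℕ) (σ : State) : Prop where
  var_n : σ.var 0 = n
  var_k : σ.var 1 = k
  adj : ∀ u v : Fin n, σ.arr 0 (u * n + v) ≠ 0 ↔ G.Adj u v

/-- Array `1` contains the multiples of `n` and array `2` the powers of two. -/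
structure Arith {n : ℕ} (G : SimpleGraph (Fin n)) (k : ℕ) (σ : State) : Prop
    extends Input G k σ where
  mul : ∀ q < n * n, σ.arr 1 q = q * n
  pow : ∀ e < 2 * n + 4, σ.arr 2 e = 2 ^ e

/-- Array `4` contains the distances. -/
structure Dist {n : ℕ} (G : SimpleGraph (Fin n)) (k : ℕ) (σ : State) : Prop
    extends Arith G k σ where
  dist : ∀ u v : Fin n, σ.arr 4 (u * n + v) = G.dist u v

/-- Decidable condition for a command to keep given variables and arrays. -/
def Cmd.keeps (c : Cmd) (xs as : List ℕ) : Bool :=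
  xs.all (fun x => !c.modV x) && as.all (fun a => !c.modA a)

theorem Cmd.Frame.var_eq {c : Cmd} {σ τ : State} (h : c.Frame σ τ) {xs as : List ℕ}
    (hc : c.keeps xs as = true) {x : ℕ} (hx : x ∈ xs) : τ.var x = σ.var x := by
  simp only [keeps, Bool.and_eq_true, List.all_eq_true, Bool.not_eq_true'] at hc
  exact h.var x (hc.1 x hx)

theorem Cmd.Frame.arr_eq {c : Cmd} {σ τ : State} (h : c.Frame σ τ) {xs as : List ℕ}
    (hc : c.keeps xs as = true) {x : ℕ} (hx : x ∈ as) : τ.arr x = σ.arr x := by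
  simp only [keeps, Bool.and_eq_true, List.all_eq_true, Bool.not_eq_true'] at hc
  exact h.arr x (hc.2 x hx)

section

variable {n k : ℕ} {G : SimpleGraph (Fin n)} {σ τ : State} {c : Cmd}

theorem Input.congr (h : Input G k σ) (h0 : τ.var 0 = σ.var 0) (h1 : τ.var 1 = σ.var 1)
    (h2 : τ.arr 0 = σ.arr 0) : Input G k τ :=
  ⟨h0.trans h.var_n, h1.trans h.var_k, by rw [h2]; exact h.adj⟩

theorem Input.frame (h : Input G k σ) (hf : c.Frame σ τ) (hc : c.keeps [0, 1] [0] = true) :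
    Input G k τ :=
  h.congr (hf.var_eq hc (by simp)) (hf.var_eq hc (by simp)) (hf.arr_eq hc (by simp))

theorem Arith.congr (h : Arith G k σ) (h0 : τ.var 0 = σ.var 0) (h1 : τ.var 1 = σ.var 1)
    (h2 : τ.arr 0 = σ.arr 0) (h3 : τ.arr 1 = σ.arr 1) (h4 : τ.arr 2 = σ.arr 2) : Arith G k τ :=
  ⟨h.toInput.congr h0 h1 h2, by rw [h3]; exact h.mul, by rw [h4]; exact h.pow⟩

theorem Arith.frame (h : Arith G k σ) (hf : c.Frame σ τ) (hc : c.keeps [0, 1] [0, 1, 2] = true) :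
    Arith G k τ :=
  h.congr (hf.var_eq hc (by simp)) (hf.var_eq hc (by simp)) (hf.arr_eq hc (by simp))
    (hf.arr_eq hc (by simp)) (hf.arr_eq hc (by simp))

theorem Dist.congr (h : Dist G k σ) (h0 : τ.var 0 = σ.var 0) (h1 : τ.var 1 = σ.var 1)
    (h2 : τ.arr 0 = σ.arr 0) (h3 : τ.arr 1 = σ.arr 1) (h4 : τ.arr 2 = σ.arr 2)
    (h5 : τ.arr 4 = σ.arr 4) : Dist G k τ :=
  ⟨h.toArith.congr h0 h1 h2 h3 h4, by rw [h5]; exact h.dist⟩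

theorem Dist.frame (h : Dist G k σ) (hf : c.Frame σ τ)
    (hc : c.keeps [0, 1] [0, 1, 2, 4] = true) : Dist G k τ :=
  h.congr (hf.var_eq hc (by simp)) (hf.var_eq hc (by simp)) (hf.arr_eq hc (by simp))
    (hf.arr_eq hc (by simp)) (hf.arr_eq hc (by simp)) (hf.arr_eq hc (by simp))

/-- The entry `a[i * n + j]`. -/
abbrev entry (a : ℕ) (i j : Tm) : Tm := get a (add (get 1 i) j)

theorem Arith.eval_entry (h : Arith G k σ) {a : ℕ} {i j : Tm} (hi : i.eval σ < n) :
    (entry a i j).eval σ = σ.arr a (i.eval σ * n + j.eval σ) := by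
  simp only [Tm.eval]
  rw [h.mul _ (hi.trans_le (Nat.le_mul_of_pos_left _ (by omega)))]

theorem Arith.holds_adj (h : Arith G k σ) {i j : Tm} {u v : Fin n} (hi : i.eval σ = u)
    (hj : j.eval σ = v) : (entry 0 i j).Holds σ ↔ G.Adj u v := by
  rw [Holds, h.eval_entry (by rw [hi]; exact u.2), hi, hj, h.adj]

theorem Dist.eval_dist (h : Dist G k σ) {i j : Tm} {u v : Fin n} (hi : i.eval σ = u)
    (hj : j.eval σ = v) : (entry 4 i j).eval σ = G.dist u v := by
  rw [h.eval_entry (by rw [hi]; exact u.2), hi, hj, h.dist]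

/-- Computes the multiples of `n`. -/
def mulTable : Cmd :=
  .seq (set 14 (sum 20 (var 0) (var 0)))
    (loop 11 (var 14) (store 1 (var 11) (sum 20 (var 11) (var 0))))

/-- Products arise by summing a constant. Multiples are needed up to index n^2 because a row index
of a three-dimensional table has the form r * n + u. -/
theorem spec_mulTable (hn : 1 ≤ n) (h : Input G k σ) :
    mulTable.Spec σ (n ^ 4) (fun τ => ∀ q < n * n, τ.arr 1 q = q * n) := by
  have hnn : 1 ≤ n * n := Nat.mul_pos hn hn
  have h4 : n * n * (n * n * 1) = n ^ 4 := by ring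
  have h1 : n * 1 ≤ n ^ 4 := by rw [mul_one]; exact Nat.le_self_pow (by norm_num) _
  refine spec_seq (R := fun τ => τ.var 14 = n * n) (spec_set ?_ ?_) ?_
  · exact (fits_sum n hn rfl (by exact h.var_n.le) le_rfl fun _ _ => fits_flat rfl le_rfl).mono h1
  · simp [Tm.eval, State.setVar_var, h.var_n]
  · intro τ hτ hv
    have h := h.frame hτ rfl
    rw [← h4]
    refine (spec_fill (n * n) (fun q z => z = q * n) hnn rfl (by exact hv.le) (by simpa using hnn) ?_).imp ?_
    · intro i hi τ' hτ' _
      have h := h.frame hτ' rfl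
      simp only [Tm.eval, hv] at hi
      refine ⟨fits_sum (n * n) hnn rfl ?_ le_rfl fun _ _ => fits_flat rfl le_rfl, ?_⟩
      · simp only [Tm.eval, State.setVar_var]; simpa using hi.le
      · simp [Tm.eval, State.setVar_var, h.var_n]
    · intro τ' _ h' q hq
      exact h' q (by simpa [Tm.eval, hv] using hq)

/-- Computes powers of two. -/
def powTable : Cmd :=
  loop 11 (add (add (var 0) (var 0)) (lit 4)) (store 2 (var 11)
    (ite (var 11) (add (get 2 (sub (var 11) (lit 1))) (get 2 (sub (var 11) (lit 1)))) (lit 1)))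

theorem spec_powTable (hn : 1 ≤ n) (h : Input G k σ) :
    powTable.Spec σ (6 * n) (fun τ => ∀ e < 2 * n + 4, τ.arr 2 e = 2 ^ e) := by
  have hv : (add (add (var 0) (var 0)) (lit 4)).eval σ = 2 * n + 4 := by
    simp [Tm.eval, h.var_n]; ring
  rw [← mul_one (6 * n), ← hv]
  -- For n ≥ 1 the number 2 * n + 4 of rounds is at most 6 * n.
  refine spec_fill (6 * n) (fun e z => z = 2 ^ e) (by omega) rfl (by omega) le_rfl ?_
  intro i hi τ' hτ' hI
  refine ⟨fits_flat rfl le_rfl, ?_⟩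
  rcases i with _ | i
  · simp [Tm.eval, State.setVar_var]
  · simp [Tm.eval, State.setVar_var, State.setVar_arr, hI i (by omega)]
    ring

/-- Computes the distances. -/
def distTable : Cmd :=
  .seq (loop 11 (var 0) (loop 12 (var 0) (loop 13 (var 0)
    (store 3 (add (get 1 (add (get 1 (var 11)) (var 12))) (var 13))
      (add (eq (var 12) (var 13)) (and (var 11) (sum 20 (var 0) (and (entry 0 (var 12) (var 20))
        (get 3 (add (get 1 (add (get 1 (sub (var 11) (lit 1))) (var 20))) (var 13)))))))))))
  (loop 11 (var 0) (loop 12 (var 0) (store 4 (add (get 1 (var 11)) (var 12))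
    (sum 20 (var 0) (not (get 3 (add (get 1 (add (get 1 (var 20)) (var 11))) (var 12))))))))

/-- The table in array 3 decides "distance at most r" by the recursion `MESP.dist_le_succ_iff`. As
all distances are below n, a distance equals the number of r < n for which the table says no. -/
theorem spec_distTable (hn : 1 ≤ n) (hG : G.Connected) (h : Arith G k σ) :
    distTable.Spec σ (n ^ 4) (fun τ => ∀ u v : Fin n, τ.arr 4 (u * n + v) = G.dist u v) := by
  have h4 : n * (n * (n * (n * 1))) = n ^ 4 := by ring
  have h3 : n * (n * (n * 1)) ≤ n ^ 4 := by
    rw [← h4]; exact Nat.le_mul_of_pos_left _ hn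
  refine spec_seq (R := fun τ => ∀ r < n, ∀ u < n, ∀ v < n,
      ∀ (hu : u < n) (hv : v < n), τ.arr 3 ((r * n + u) * n + v) ≠ 0 ↔ G.dist ⟨u, hu⟩ ⟨v, hv⟩ ≤ r)
    (h4 ▸ spec_fill₃ n n n (fun r u v z => ∀ (hu : u < n) (hv : v < n),
      z ≠ 0 ↔ G.dist ⟨u, hu⟩ ⟨v, hv⟩ ≤ r)
      (by decide) (by decide) (by decide) hn hn hn (by omega) rfl rfl rfl (by exact h.var_n)
      (fun τ hτ => ⟨(h.frame hτ rfl).var_n, (h.frame hτ rfl).var_n⟩) ?_) ?_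
  · intro r hr u hu v hv τ hτ h11 h12 h13 hI
    have h := h.frame hτ rfl
    have hm1 : ∀ r < n, τ.arr 1 r = r * n := fun r hr =>
      h.mul r (hr.trans_le (Nat.le_mul_of_pos_left _ hn))
    have hm2 : ∀ r < n, ∀ u < n, τ.arr 1 (r * n + u) = (r * n + u) * n := fun r hr u hu =>
      h.mul _ (cell_lt hr hu)
    refine ⟨⟨fits_flat rfl (by omega), ?_⟩, ?_, fun _ _ => ?_⟩
    · simp only [Tm.eval, h11, h12, h13, hm1 r hr, hm2 r hr u hu]
    · have hs : ∀ e : Tm, e.flat = true → (sum 20 (var 0) e).Fits τ (n * 1) := fun e he =>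
        fits_sum n hn rfl (by exact h.var_n.le) le_rfl fun _ _ => fits_flat he le_rfl
      exact fits_add (fits_flat rfl (by omega)) (fits_ite (fits_flat rfl (by omega)) (fun _ => hs _ rfl)
        fun _ => fits_flat rfl (by omega))
    · change Holds _ _ ↔ _
      rw [holds_add, holds_eq, holds_and, holds_sum]
      have hv11 : (var 11).Holds τ ↔ r ≠ 0 := by rw [← h11]; rfl
      simp only [eval_var, h12, h13, h.var_n, hv11]
      rcases r with _ | r
      · rw [Nat.le_zero, hG.dist_eq_zero_iff, Fin.mk.injEq]
        simp
      · rw [MESP.dist_le_succ_iff hG, Fin.mk.injEq]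
        refine or_congr Iff.rfl ?_
        simp only [ne_eq, Nat.add_eq_zero_iff, one_ne_zero, and_false, not_false_eq_true, true_and]
        rw [Fin.exists_iff]
        refine exists_congr fun l => ?_
        rw [← exists_prop]
        refine exists_congr fun hl => ?_
        have h := h.congr (τ := τ.setVar 20 l) (by simp [State.setVar_var])
          (by simp [State.setVar_var]) rfl rfl rfl
        rw [holds_and, h.holds_adj (u := ⟨u, hu⟩) (v := ⟨l, hl⟩)
          (by simp [Tm.eval, State.setVar_var, h12]) (by simp [Tm.eval, State.setVar_var])]
        refine and_congr Iff.rfl ?_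
        have := hI r (Nat.lt_succ_self r) l hl v hv hl hv
        simp only [Holds, Tm.eval, State.setVar_var, State.setVar_arr, h11, h13]
        simp only [Nat.add_sub_cancel, reduceIte, Nat.reduceEqDiff, hm1 r (by omega), hm2 r (by omega) l hl]
        exact this
  · intro τ hτ hW
    have h := h.frame hτ rfl
    refine ((spec_fill₂ (A := n * 1) n n (fun u v z => ∀ (hu : u < n) (hv : v < n),
      z = G.dist ⟨u, hu⟩ ⟨v, hv⟩) (by decide) hn hn (by omega) rfl rfl (by exact h.var_n)
      (fun τ hτ => by exact (h.frame hτ rfl).var_n) ?_).mono h3).imp ?_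
    · intro u hu v hv τ' hτ' h11 h12 _
      have h := h.frame hτ' rfl
      have h3 : τ'.arr 3 = τ.arr 3 := hτ'.arr 3 rfl
      have hm1 : ∀ r < n, τ'.arr 1 r = r * n := fun r hr =>
        h.mul r (hr.trans_le (Nat.le_mul_of_pos_left _ hn))
      have hm2 : ∀ r < n, ∀ u < n, τ'.arr 1 (r * n + u) = (r * n + u) * n := fun r hr u hu =>
        h.mul _ (cell_lt hr hu)
      refine ⟨⟨fits_flat rfl (by omega), ?_⟩,
        fits_sum n hn rfl (by exact h.var_n.le) le_rfl fun _ _ => fits_flat rfl le_rfl, fun _ _ => ?_⟩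
      · simp only [Tm.eval, h11, h12, hm1 u hu]
      · rw [eval_sum, eval_var, h.var_n]
        have hd := MESP.dist_lt_card hG ⟨u, hu⟩ ⟨v, hv⟩
        rw [Fintype.card_fin] at hd
        have : ∀ r ∈ Finset.range n, (not (get 3 (add (get 1 (add (get 1 (var 20)) (var 11)))
            (var 12)))).eval (τ'.setVar 20 r) =
            if r < G.dist ⟨u, hu⟩ ⟨v, hv⟩ then 1 else 0 := by
          intro r hr
          have hr := Finset.mem_range.1 hr
          have := hW r hr u hu v hv hu hv
          simp only [Tm.eval, State.setVar_var, State.setVar_arr, reduceIte, Nat.reduceEqDiff, h11,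
            h12, hm1 r hr, hm2 r hr u hu, h3]
          refine if_congr ?_ rfl rfl
          rw [← not_iff_not, not_lt]
          exact this
        rw [Finset.sum_congr rfl this, ← Finset.sum_filter, Finset.sum_const, smul_eq_mul, mul_one]
        have : (Finset.range n).filter (· < G.dist ⟨u, hu⟩ ⟨v, hv⟩) =
            Finset.range (G.dist ⟨u, hu⟩ ⟨v, hv⟩) := by
          ext r; simp; omega
        rw [this, Finset.card_range]
    · intro τ' _ h' u v
      exact h' u u.2 v v.2 u.2 v.2

/-- The tables that depend only on the graph. -/
def prepare : Cmd := .seq mulTable (.seq powTable distTable)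

theorem spec_prepare (hn : 1 ≤ n) (hG : G.Connected) (h : Input G k σ) :
    prepare.Spec σ (6 * n ^ 4) (Dist G k) := by
  have h1 : n ≤ n ^ 4 := Nat.le_self_pow (by norm_num) _
  refine spec_seq ((spec_mulTable hn h).mono (by omega)) fun τ hτ hm => ?_
  have h := h.frame hτ rfl
  refine spec_seq ((spec_powTable hn h).mono (by omega)) fun τ' hτ' hp => ?_
  have h : Arith G k τ' := ⟨h.frame hτ' rfl, by rw [hτ'.arr 1 rfl]; exact hm, hp⟩
  exact ((spec_distTable hn hG h).mono (by omega)).imp fun τ'' hτ'' hd =>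
    ⟨h.frame hτ'' rfl, hd⟩

end

end RAM

/-! ### Digits -/

namespace RAM

open Tm Cmd

/-- The digits in base four. -/
def digit (g e : ℕ) : ℕ := g / 2 ^ (2 * e) - 4 * (g / 2 ^ (2 * e + 2))

theorem digit_eq (g e : ℕ) : digit g e = g / 4 ^ e % 4 := by
  rw [digit, pow_add, pow_mul, ← Nat.div_div_eq_div_mul]
  norm_num
  omega

/-- Peel off the lowest digit: the number for `f` is 4 times the number for the shifted sequence,
plus `f 0`. -/
theorem exists_digit_eq (f : ℕ → ℕ) (hf : ∀ e, f e < 4) (d : ℕ) :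
    ∃ g < 2 ^ (2 * d), ∀ e < d, digit g e = f e := by
  induction d generalizing f with
  | zero => exact ⟨0, by simp, by simp⟩
  | succ d ih =>
    obtain ⟨g, hg, h⟩ := ih (fun e => f (e + 1)) (fun e => hf _)
    have h0 := hf 0
    refine ⟨4 * g + f 0, ?_, fun e he => ?_⟩
    · rw [mul_add, pow_add]; norm_num; omega
    · rw [digit_eq]
      rcases e with _ | e
      · simp; omega
      · have h1 := h e (by omega)
        rw [digit_eq] at h1
        rw [pow_succ', ← Nat.div_div_eq_div_mul, show (4 * g + f 0) / 4 = g by omega, h1]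

/-- Variable `4` contains `M = 2 ^ (2 * d + 1)`, array `5` the multiples of `M`, and array `6` the
numbers below `M` without their last `e` binary digits. -/
structure Bits (n d : ℕ) (σ : State) : Prop where
  var_M : σ.var 4 = 2 ^ (2 * d + 1)
  mulM : ∀ q < n * n + 2 * n + 4, σ.arr 5 q = q * 2 ^ (2 * d + 1)
  shift : ∀ e < 2 * d + 2, ∀ g < 2 ^ (2 * d + 1), σ.arr 6 (e * 2 ^ (2 * d + 1) + g) = g / 2 ^ e

/-- Computes the tables of `Bits`. -/
def bitsTable : Cmd :=
  .seq (set 4 (get 2 (add (add (var 3) (var 3)) (lit 1))))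
  (.seq (set 15 (add (sum 20 (var 0) (var 0)) (add (add (var 0) (var 0)) (lit 4))))
  (.seq (loop 11 (var 15) (store 5 (var 11) (sum 20 (var 11) (var 4))))
  (loop 11 (add (add (var 3) (var 3)) (lit 2)) (loop 12 (var 4)
    (store 6 (add (get 5 (var 11)) (var 12)) (ite (var 11)
      (sum 20 (get 6 (add (get 5 (sub (var 11) (lit 1))) (var 12)))
        (lt (add (add (var 20) (var 20)) (lit 1))
          (get 6 (add (get 5 (sub (var 11) (lit 1))) (var 12)))))
      (var 12)))))))

/-- The term for a row of the table of shifted numbers. -/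
abbrev shiftTm (e g : Tm) : Tm := get 6 (add (get 5 e) g)

/-- The term for a digit in base four. -/
abbrev digitTm (e g : Tm) : Tm :=
  sub (shiftTm (add e e) g)
    (add (add (shiftTm (add (add e e) (lit 2)) g) (shiftTm (add (add e e) (lit 2)) g))
      (add (shiftTm (add (add e e) (lit 2)) g) (shiftTm (add (add e e) (lit 2)) g)))

/-- The term for a binary digit. -/
abbrev bitTm (e g : Tm) : Tm :=
  sub (shiftTm e g) (add (shiftTm (add e (lit 1)) g) (shiftTm (add e (lit 1)) g))

section

variable {n k d : ℕ} {G : SimpleGraph (Fin n)} {σ τ : State} {c : Cmd}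

theorem Bits.congr (h : Bits n d σ) (h0 : τ.var 4 = σ.var 4) (h1 : τ.arr 5 = σ.arr 5)
    (h2 : τ.arr 6 = σ.arr 6) : Bits n d τ :=
  ⟨h0.trans h.var_M, by rw [h1]; exact h.mulM, by rw [h2]; exact h.shift⟩

theorem Bits.frame (h : Bits n d σ) (hf : c.Frame σ τ) (hc : c.keeps [4] [5, 6] = true) :
    Bits n d τ :=
  h.congr (hf.var_eq hc (by simp)) (hf.arr_eq hc (by simp)) (hf.arr_eq hc (by simp))

theorem Bits.eval_shift (h : Bits n d σ) (hd : d ≤ n) {e g : Tm} (he : e.eval σ < 2 * d + 2)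
    (hg : g.eval σ < 2 ^ (2 * d + 1)) : (shiftTm e g).eval σ = g.eval σ / 2 ^ e.eval σ := by
  simp only [Tm.eval]
  rw [h.mulM _ (by omega), h.shift _ he _ hg]

theorem Bits.eval_digit (h : Bits n d σ) (hd : d ≤ n) {e g : Tm} (he : e.eval σ < d)
    (hg : g.eval σ < 2 ^ (2 * d + 1)) : (digitTm e g).eval σ = digit (g.eval σ) (e.eval σ) := by
  have h1 := h.eval_shift hd (e := add e e) (g := g) (by simp only [Tm.eval]; omega) hg
  have h2 := h.eval_shift hd (e := add (add e e) (lit 2)) (g := g)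
    (by simp only [Tm.eval]; omega) hg
  rw [eval_sub, eval_add, eval_add, h1, h2]
  simp only [Tm.eval, digit, two_mul]
  omega

theorem Bits.holds_bit (h : Bits n d σ) (hd : d ≤ n) {e g : Tm} (he : e.eval σ < 2 * d + 1)
    (hg : g.eval σ < 2 ^ (2 * d + 1)) :
    (bitTm e g).Holds σ ↔ (g.eval σ).testBit (e.eval σ) = true := by
  have h1 := h.eval_shift hd (e := e) (g := g) (by omega) hg
  have h2 := h.eval_shift hd (e := add e (lit 1)) (g := g) (by simp only [Tm.eval]; omega) hg
  rw [Holds, eval_sub, eval_add, h1, h2, Nat.testBit_eq_decide_div_mod_eq, decide_eq_true_iff]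
  simp only [Tm.eval]
  rw [pow_succ, ← Nat.div_div_eq_div_mul]
  omega

/-- There are 2d + 1 binary places because up to p + (p + 1) tasks are stored in a mask later. Each
of the (2d + 2) * M entries is found by a sum of length at most M = 2^(2d+1), and M * M = 4 * 16^d.
The summand 49 * n^4 pays for the multiples of M, whose indices cover the rows of array 6 and the
pairs (length, vertex) of the dynamic program. -/
theorem spec_bitsTable (hn : 1 ≤ n) (hd : d ≤ n) (h : Arith G k σ) (h3 : σ.var 3 = d) :
    bitsTable.Spec σ (49 * n ^ 4 + (2 * d + 2) * (4 * 16 ^ d)) (Bits n d) := by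
  set A := 49 * n ^ 4 + (2 * d + 2) * (4 * 16 ^ d) with hA
  set M := 2 ^ (2 * d + 1) with hM
  have hM1 : 1 ≤ M := Nat.one_le_two_pow
  have hMM : M * (M * 1) = 4 * 16 ^ d := by
    rw [hM, mul_one, ← pow_add, show 2 * d + 1 + (2 * d + 1) = 4 * d + 2 by ring, pow_add, pow_mul]
    norm_num
    ring
  have hn4 : n ^ 4 ≤ A := by omega
  have hA1 : 1 ≤ A := le_trans (Nat.one_le_pow _ _ hn) hn4
  have hS : (n * n + 2 * n + 4) * ((n * n + 2 * n + 4) * 1) ≤ A := by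
    have h1 : n ≤ n * n := Nat.le_mul_of_pos_left _ hn
    have : n * n + 2 * n + 4 ≤ 7 * (n * n) := by omega
    calc _ ≤ (7 * (n * n)) * (7 * (n * n)) := by rw [mul_one]; exact Nat.mul_le_mul this this
      _ = 49 * n ^ 4 := by ring
      _ ≤ A := by omega
  refine spec_seq (R := fun τ => τ.var 4 = M) (spec_set (fits_flat rfl hA1) ?_) ?_
  · simp [Tm.eval, State.setVar_var, h3, h.pow (d + d + 1) (by omega), hM, two_mul]
  intro τ₁ hτ₁ hv4
  have h := h.frame hτ₁ rfl
  have h3 : τ₁.var 3 = d := (hτ₁.var 3 rfl).trans h3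
  refine spec_seq (R := fun τ => τ.var 15 = n * n + 2 * n + 4) (spec_set ?_ ?_) ?_
  · refine fits_add ((fits_sum n hn rfl (by exact h.var_n.le) le_rfl
      fun _ _ => fits_flat rfl le_rfl).mono ?_) (fits_flat rfl hA1)
    rw [mul_one]
    exact le_trans (Nat.le_self_pow (by norm_num) _) hn4
  · simp [Tm.eval, State.setVar_var, h.var_n]; ring
  intro τ₂ hτ₂ hv15
  have h := h.frame hτ₂ rfl
  have h3 : τ₂.var 3 = d := (hτ₂.var 3 rfl).trans h3
  have hv4 : τ₂.var 4 = M := (hτ₂.var 4 rfl).trans hv4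
  refine spec_seq (R := fun τ => ∀ q < n * n + 2 * n + 4, τ.arr 5 q = q * M)
    (((spec_fill (n * n + 2 * n + 4) (fun q z => z = q * M) (by omega) rfl (by exact hv15.le)
      (by simp) ?_).mono hS).imp ?_) ?_
  · intro i hi τ' hτ' _
    simp only [Tm.eval, hv15] at hi
    refine ⟨fits_sum (n * n + 2 * n + 4) (by omega) rfl ?_ le_rfl
      fun _ _ => fits_flat rfl le_rfl, ?_⟩
    · simp only [Tm.eval, State.setVar_var]; simpa using hi.le
    · simp [Tm.eval, State.setVar_var, (hτ'.var 4 rfl).trans hv4]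
  · intro τ' _ h' q hq
    exact h' q (by simpa [Tm.eval, hv15] using hq)
  intro τ₃ hτ₃ hmul
  have h := h.frame hτ₃ rfl
  have h3 : τ₃.var 3 = d := (hτ₃.var 3 rfl).trans h3
  have hv4 : τ₃.var 4 = M := (hτ₃.var 4 rfl).trans hv4
  refine ((spec_fill₂ (A := M * 1) (2 * d + 2) M (fun e g z => z = g / 2 ^ e) (by decide) (by omega)
    hM1 (by omega) rfl rfl ?_ (fun τ hτ => by exact (hτ.var 4 rfl).trans hv4) ?_).mono ?_).imp ?_
  · simp only [Tm.eval, h3]; ring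
  · intro e he g hg τ hτ h11 h12 hI
    have hm : ∀ e < 2 * d + 2, τ.arr 5 e = e * M := fun e he => by
      rw [hτ.arr 5 rfl]; exact hmul e (by omega)
    refine ⟨⟨fits_flat rfl (by omega), ?_⟩, ?_, ?_⟩
    · simp only [Tm.eval, h11, h12, hm e he]
    · refine fits_ite (fits_flat rfl (by omega)) (fun h0 => ?_) fun _ => fits_flat rfl (by omega)
      obtain ⟨e, rfl⟩ : ∃ e', e = e' + 1 := ⟨e - 1, by simp [Holds, Tm.eval, h11] at h0; omega⟩
      refine fits_sum M hM1 rfl ?_ le_rfl fun _ _ => fits_flat rfl le_rfl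
      have he' : τ.arr 6 (e * M + g) = g / 2 ^ e := hI e (by omega) g hg
      simp only [Tm.eval, h11, h12, Nat.add_sub_cancel, hm e (by omega), he']
      exact (Nat.div_le_self _ _).trans hg.le
    · rcases e with _ | e
      · simp [Tm.eval, h11, h12]
      · have he' : τ.arr 6 (e * M + g) = g / 2 ^ e := hI e (by omega) g hg
        simp only [Tm.eval, h11, h12, State.setVar_var, State.setVar_arr, Nat.add_sub_cancel,
          hm e (by omega), reduceIte, Nat.reduceEqDiff, he']
        -- Halving by counting: exactly z / 2 numbers i satisfy i + i + 1 < z.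
        rw [if_pos (by omega), pow_succ, ← Nat.div_div_eq_div_mul, ← Finset.sum_filter,
          Finset.sum_const, smul_eq_mul, mul_one]
        have : (Finset.range (g / 2 ^ e)).filter (fun i => i + i + 1 < g / 2 ^ e) =
            Finset.range (g / 2 ^ e / 2) := by
          ext r; simp; omega
        rw [this, Finset.card_range]
  · rw [hMM]; omega
  · intro τ hτ h'
    exact ⟨(hτ.var 4 rfl).trans hv4, fun q hq => by rw [hτ.arr 5 rfl]; exact hmul q hq, h'⟩

end
end RAM

/-! ### Searching a modulator -/

namespace MESP

/-- Adjacency on natural numbers. -/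
def AdjNat {n : ℕ} (G : SimpleGraph (Fin n)) (u v : ℕ) : Prop :=
  ∃ (hu : u < n) (hv : v < n), G.Adj ⟨u, hu⟩ ⟨v, hv⟩

/-- The triples of numbers below `n` that start with `u`, and have their second entry below `v`. -/
def triples₂ (n u v : ℕ) : List (ℕ × ℕ × ℕ) :=
  (List.range v).flatMap fun b => (List.range n).map fun c => (u, b, c)

/-- The triples of numbers below `n` whose first entry is below `u`. -/
def triples (n u : ℕ) : List (ℕ × ℕ × ℕ) := (List.range u).flatMap fun a => triples₂ n a n

theorem triples_succ (n u : ℕ) : triples n (u + 1) = triples n u ++ triples₂ n u n := by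
  simp [triples, List.range_succ]

theorem triples₂_succ (n u v : ℕ) :
    triples₂ n u (v + 1) = triples₂ n u v ++ (List.range n).map fun c => (u, v, c) := by
  simp [triples₂, List.range_succ]

theorem mem_triples₂ {n u v : ℕ} {t : ℕ × ℕ × ℕ} :
    t ∈ triples₂ n u v ↔ t.1 = u ∧ t.2.1 < v ∧ t.2.2 < n := by
  obtain ⟨a, b, c⟩ := t
  simp only [triples₂, List.mem_flatMap, List.mem_range, List.mem_map, Prod.mk.injEq]
  constructor
  · rintro ⟨b', hb', c', hc', rfl, rfl, rfl⟩; exact ⟨rfl, hb', hc'⟩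
  · rintro ⟨rfl, hb, hc⟩; exact ⟨b, hb, c, hc, rfl, rfl, rfl⟩

theorem mem_triples {n u : ℕ} {t : ℕ × ℕ × ℕ} :
    t ∈ triples n u ↔ t.1 < u ∧ t.2.1 < n ∧ t.2.2 < n := by
  simp only [triples, List.mem_flatMap, List.mem_range, mem_triples₂]
  constructor
  · rintro ⟨a, ha, rfl, h⟩; exact ⟨ha, h⟩
  · rintro ⟨ha, h⟩; exact ⟨_, ha, rfl, h⟩

theorem length_le_of_nodup {l : List ℕ} {n : ℕ} (hl : l.Nodup) (h : ∀ a ∈ l, a < n) :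
    l.length ≤ n := by
  rw [← List.toFinset_card_of_nodup hl, ← Finset.card_range n]
  exact Finset.card_le_card fun a ha => Finset.mem_range.2 (h a (List.mem_toFinset.1 ha))

/-- The list picked with digits `f`. -/
noncomputable def picks {n : ℕ} (G : SimpleGraph (Fin n)) (f : ℕ → ℕ) : List ℕ :=
  (triples n n).foldl (pick (AdjNat G) f) []

/-- The vertices in a list. -/
def toSet (n : ℕ) (l : List ℕ) : Finset (Fin n) := Finset.univ.filter fun v => v.val ∈ l

section

variable {n : ℕ} {G : SimpleGraph (Fin n)} {f : ℕ → ℕ}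

theorem mem_toSet {l : List ℕ} {v : Fin n} : v ∈ toSet n l ↔ v.val ∈ l := by simp [toSet]

theorem card_toSet {l : List ℕ} (hl : l.Nodup) (h : ∀ a ∈ l, a < n) :
    (toSet n l).card = l.length := by
  rw [← List.toFinset_card_of_nodup hl, ← Finset.card_map Fin.valEmbedding]
  congr 1
  ext a
  simp only [Finset.mem_map, mem_toSet, List.mem_toFinset, Fin.valEmbedding_apply]
  constructor
  · rintro ⟨v, hv, rfl⟩; exact hv
  · intro ha; exact ⟨⟨a, h a ha⟩, ha, rfl⟩

theorem nodup_picks : (picks G f).Nodup := nodup_foldl_pick _ _ List.nodup_nil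

theorem lt_of_mem_picks : ∀ a ∈ picks G f, a < n :=
  forall_mem_foldl_pick _ _ (by simp) fun _ ht => mem_triples.1 ht

/-- An induced path outside the final list would be a triple of the pass that is still free at the
end. -/
theorem hitsP3_picks : HitsP3 G (toSet n (picks G f)) := by
  intro a b c ha hb hc hac hab hbc
  simp only [mem_toSet] at ha hb hc
  by_contra h
  refine not_isFreeP3_foldl_pick (A := AdjNat G) (f := f) (triples n n) []
    (t := (a.val, b.val, c.val)) (mem_triples.2 ⟨a.2, b.2, c.2⟩)
    ⟨ha, hb, hc, fun h => hac (Fin.ext h), ⟨a.2, b.2, hab⟩, ⟨b.2, c.2, hbc⟩, ?_⟩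
  rintro ⟨_, _, h'⟩
  exact h h'

theorem distToCluster_le_length_picks : distToCluster G ≤ (picks G f).length := by
  rw [← card_toSet nodup_picks lt_of_mem_picks]
  exact distToCluster_le hitsP3_picks

/-- Let the digits follow a smallest modulator, which meets every induced path. Then only its
elements are picked, and none twice. -/
theorem exists_length_picks_le (G : SimpleGraph (Fin n)) :
    ∃ f : ℕ → ℕ, (∀ e, f e < 4) ∧ (picks G f).length ≤ distToCluster G := by
  obtain ⟨X, hX, hc⟩ := exists_hitsP3_card G
  obtain ⟨f, hf, h⟩ := exists_foldl_pick_subset (A := AdjNat G)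
    (fun a => ∃ h : a < n, (⟨a, h⟩ : Fin n) ∈ X) (triples n n) (by
      intro t ht hfree
      obtain ⟨ha, hb, hc⟩ := mem_triples.1 ht
      by_contra! hcon
      obtain ⟨-, -, -, hne, ⟨_, _, h1⟩, ⟨_, _, h2⟩, h3⟩ := hfree
      exact h3 ⟨ha, hc, hX ⟨_, ha⟩ ⟨_, hb⟩ ⟨_, hc⟩ (hcon.1 ha) (hcon.2.1 hb) (hcon.2.2 hc)
        (by simpa using hne) h1 h2⟩)
  refine ⟨f, hf, ?_⟩
  rw [← card_toSet nodup_picks lt_of_mem_picks, ← hc]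
  refine Finset.card_le_card fun v hv => ?_
  obtain ⟨_, h'⟩ := h v (mem_toSet.1 hv)
  exact h'

theorem picks_congr {f' : ℕ → ℕ} (h : ∀ e < (picks G f).length, f e = f' e) :
    picks G f' = picks G f :=
  foldl_pick_congr _ _ h

end

end MESP

/-! ### The search for a modulator on the machine -/

namespace RAM

open Tm Cmd MESP

/-- Variable `5` and array `7` contain a list. -/
structure Lists (l : List ℕ) (σ : State) : Prop where
  length : σ.var 5 = l.length
  get : ∀ i (h : i < l.length), σ.arr 7 i = l[i]

/-- The term for membership in the list. -/
abbrev memTm (x : ℕ) : Tm := sum 20 (var 5) (eq (get 7 (var 20)) (var x))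

/-- The term for an induced path that avoids the list. -/
abbrev freeTm : Tm :=
  and (not (memTm 11)) (and (not (memTm 12)) (and (not (memTm 13)) (and (not (eq (var 11) (var 13)))
    (and (entry 0 (var 11) (var 12)) (and (entry 0 (var 12) (var 13))
      (not (entry 0 (var 11) (var 13))))))))

/-- Treats one triple. -/
def pickStep : Cmd :=
  when freeTm (.seq
    (store 7 (var 5) (ite (not (digitTm (var 5) (var 7))) (var 11)
      (ite (eq (digitTm (var 5) (var 7)) (lit 1)) (var 12) (var 13))))
    (set 5 (add (var 5) (lit 1))))

/-- Picks vertices from all triples, guided by the digits of variable `7`. -/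
def pickAll : Cmd :=
  .seq (set 5 (lit 0)) (loop 11 (var 0) (loop 12 (var 0) (loop 13 (var 0) pickStep)))

/-- The digits read by the machine. -/
def readDigit (σ : State) (c : ℕ) : ℕ := (digitTm (lit c) (var 7)).eval σ

section

variable {n k d : ℕ} {G : SimpleGraph (Fin n)} {σ τ : State} {c : Cmd} {l : List ℕ}

theorem readDigit_congr (h0 : τ.var 7 = σ.var 7) (h1 : τ.arr 5 = σ.arr 5)
    (h2 : τ.arr 6 = σ.arr 6) : readDigit τ = readDigit σ := by
  funext c
  simp only [readDigit, Tm.eval, h0, h1, h2]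

theorem Lists.congr (h : Lists l σ) (h0 : τ.var 5 = σ.var 5) (h1 : τ.arr 7 = σ.arr 7) :
    Lists l τ :=
  ⟨h0.trans h.length, by rw [h1]; exact h.get⟩

theorem Lists.holds_mem (h : Lists l σ) {x : ℕ} (hx : x ≠ 20) :
    (memTm x).Holds σ ↔ σ.var x ∈ l := by
  rw [holds_sum, eval_var, h.length, List.mem_iff_getElem]
  refine exists_congr fun i => ?_
  rw [← exists_prop]
  refine exists_congr fun hi => ?_
  rw [holds_eq]
  simp [Tm.eval, State.setVar_var, State.setVar_arr, hx, h.get i hi]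

theorem Lists.fits_mem (h : Lists l σ) (hn : 1 ≤ n) (hl : l.length ≤ n) {x : ℕ} :
    (memTm x).Fits σ (n * 1) :=
  fits_sum n hn rfl (by simp only [Tm.eval, h.length]; exact hl) le_rfl
    fun _ _ => fits_flat rfl le_rfl

theorem Arith.holds_adjNat (h : Arith G k σ) {i j : Tm} (hi : i.eval σ < n) (hj : j.eval σ < n) :
    (Tm.Holds (entry 0 i j) σ) ↔ AdjNat G (i.eval σ) (j.eval σ) := by
  rw [h.holds_adj (u := ⟨_, hi⟩) (v := ⟨_, hj⟩) rfl rfl]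
  exact ⟨fun h => ⟨hi, hj, h⟩, fun ⟨_, _, h⟩ => h⟩

theorem spec_pickStep (hn : 1 ≤ n) (h : Arith G k σ) (hl : Lists l σ) (hln : l.length ≤ n)
    (h11 : σ.var 11 < n) (h12 : σ.var 12 < n) (h13 : σ.var 13 < n) :
    pickStep.Spec σ (n * 1)
      (Lists (pick (AdjNat G) (readDigit σ) l (σ.var 11, σ.var 12, σ.var 13))) := by
  have hn1 : 1 ≤ n * 1 := by omega
  have hfree : freeTm.Holds σ ↔ IsFreeP3 (AdjNat G) l (σ.var 11, σ.var 12, σ.var 13) := by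
    rw [holds_and, holds_and, holds_and, holds_and, holds_and, holds_and, holds_not, holds_not,
      holds_not, holds_not, holds_not, hl.holds_mem (by decide), hl.holds_mem (by decide),
      hl.holds_mem (by decide), holds_eq, h.holds_adjNat (by exact h11) (by exact h12),
      h.holds_adjNat (by exact h12) (by exact h13), h.holds_adjNat (by exact h11) (by exact h13)]
    rfl
  refine spec_when ?_ (fun hb => ?_) fun hb => ?_
  · refine fits_ite (fits_eq (hl.fits_mem hn hln) (fits_flat rfl hn1)) (fun _ => ?_)
      fun _ => fits_flat rfl hn1
    refine fits_ite (fits_eq (hl.fits_mem hn hln) (fits_flat rfl hn1)) (fun _ => ?_)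
      fun _ => fits_flat rfl hn1
    exact fits_ite (fits_eq (hl.fits_mem hn hln) (fits_flat rfl hn1))
      (fun _ => fits_flat rfl hn1) fun _ => fits_flat rfl hn1
  · rw [pick, if_pos (hfree.1 hb)]
    refine spec_seq (R := fun τ => τ = _) (spec_store (fits_flat rfl hn1) (fits_flat rfl hn1) rfl)
      ?_
    rintro τ - rfl
    refine spec_set (fits_flat rfl hn1) ⟨?_, fun i hi => ?_⟩
    · simp [Tm.eval, State.setVar_var, State.setArr_var, hl.length]
    · have hd : (digitTm (var 5) (var 7)).eval σ = readDigit σ l.length := by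
        rw [← hl.length]; rfl
      have he : (ite (not (digitTm (var 5) (var 7))) (var 11)
          (ite (eq (digitTm (var 5) (var 7)) (lit 1)) (var 12) (var 13))).eval σ =
          MESP.entry (readDigit σ l.length) (σ.var 11, σ.var 12, σ.var 13) := by
        rw [eval_ite, eval_ite, holds_eq, holds_eq, hd]
        simp only [eval_lit, eval_var, MESP.entry]
        congr
      rw [State.setVar_arr, State.setArr_arr, he]
      simp only [Tm.eval, hl.length, true_and]
      rw [List.length_append, List.length_singleton] at hi
      split_ifs with h'
      · subst h'; simp
      · rw [hl.get i (by omega), List.getElem_append_left]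
  · rw [pick, if_neg fun h' => hb (hfree.2 h')]
    exact hl

/-- There are n^3 triples, and each is treated in O(n) steps: the list has distinct entries below n,
so a membership test scans at most n cells. -/
theorem spec_pickAll (hn : 1 ≤ n) (h : Arith G k σ) :
    pickAll.Spec σ (n ^ 4) (Lists (picks G (readDigit σ))) := by
  set f := readDigit σ with hf
  set P : List (ℕ × ℕ × ℕ) → List ℕ := fun ts => ts.foldl (pick (AdjNat G) f) [] with hP
  have hA : n * (n * (n * (n * 1))) = n ^ 4 := by ring
  have hlen : ∀ ts, (∀ t ∈ ts, t.1 < n ∧ t.2.1 < n ∧ t.2.2 < n) → (P ts).length ≤ n := fun ts hts =>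
    length_le_of_nodup (nodup_foldl_pick _ _ List.nodup_nil) (forall_mem_foldl_pick _ _ (by simp) hts)
  refine spec_seq (R := Lists []) (spec_set (fits_flat rfl (Nat.one_le_pow _ _ hn)) ⟨?_, by simp⟩) ?_
  · simp [State.setVar_var, Tm.eval]
  intro σ₁ hσ₁ hl
  have hf₁ : readDigit σ₁ = f := readDigit_congr (hσ₁.var 7 rfl) (hσ₁.arr 5 rfl) (hσ₁.arr 6 rfl)
  have h := h.frame hσ₁ rfl
  rw [← hA]
  refine spec_loop n (fun u => Lists (P (triples n u))) hn rfl (by exact h.var_n.le)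
    (by rw [Nat.succ_le_iff]; positivity) hl ?_ ?_
  · intro u hu τ hτ hI
    simp only [Tm.eval, h.var_n] at hu
    have h₁ := h.frame hτ.setVar (τ := τ.setVar 11 u) rfl
    refine spec_loop n (fun v => Lists (P (triples n u ++ triples₂ n u v))) hn rfl
      (by exact h₁.var_n.le) (by rw [Nat.succ_le_iff]; positivity) ?_ ?_ ?_
    · have hI₀ : Lists (P (triples n u)) (τ.setVar 11 u) := hI.congr rfl rfl
      simpa [triples₂] using hI₀
    · intro v hv τ' hτ' hI'
      simp only [Tm.eval, h₁.var_n] at hv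
      have h₂ := h₁.frame hτ'.setVar (τ := τ'.setVar 12 v) rfl
      refine spec_loop n (fun w => Lists (P (triples n u ++ triples₂ n u v ++
        (List.range w).map fun c => (u, v, c)))) hn rfl
        (by exact h₂.var_n.le) (by omega) ?_ ?_ ?_
      · have hI₀ : Lists (P (triples n u ++ triples₂ n u v)) (τ'.setVar 12 v) := hI'.congr rfl rfl
        simpa using hI₀
      · intro w hw τ₃ hτ₃ hI₃
        simp only [Tm.eval, h₂.var_n] at hw
        have h₃ := h₂.frame hτ₃.setVar (τ := τ₃.setVar 13 w) rfl
        have hfr := hτ.body (hτ'.body (hτ₃.setVar (j := w)))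
        have hf₃ : readDigit (τ₃.setVar 13 w) = f :=
          (readDigit_congr (hfr.var 7 rfl) (hfr.arr 5 rfl) (hfr.arr 6 rfl)).trans hf₁
        have h13 : (τ₃.setVar 13 w).var 13 = w := by simp [State.setVar_var]
        have h12 : (τ₃.setVar 13 w).var 12 = v := by
          rw [hτ₃.setVar.var 12 rfl]; simp [State.setVar_var]
        have h11 : (τ₃.setVar 13 w).var 11 = u := by
          rw [hτ₃.setVar.var 11 rfl, hτ'.setVar.var 11 rfl]; simp [State.setVar_var]
        have := spec_pickStep (l := P (triples n u ++ triples₂ n u v ++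
            (List.range w).map fun c => (u, v, c))) hn h₃ (hI₃.congr rfl rfl) (hlen _ ?_)
          (by omega) (by omega) (by omega)
        · rw [hf₃, h11, h12, h13] at this
          rw [List.range_succ, List.map_append, ← List.append_assoc]
          simpa [hP] using this
        · intro t ht
          rw [List.mem_append, List.mem_append, mem_triples, mem_triples₂, List.mem_map] at ht
          rcases ht with (ht | ht) | ⟨c, hc, rfl⟩
          · omega
          · omega
          · have := List.mem_range.1 hc
            exact ⟨hu, hv, by dsimp only; omega⟩
      · intro τ₃ _ hI₃
        simp only [Tm.eval, h₂.var_n] at hI₃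
        rwa [triples₂_succ, ← List.append_assoc]
    · intro τ' _ hI'
      simp only [Tm.eval, h₁.var_n] at hI'
      rwa [triples_succ]
  · intro τ _ hI
    simp only [Tm.eval, h.var_n] at hI
    exact hI

/-- Searches a smallest modulator. -/
def search : Cmd :=
  .seq (set 2 (lit 0)) (loop 3 (add (var 0) (lit 1)) (when (not (var 2)) (.seq bitsTable
    (loop 7 (get 2 (add (var 3) (var 3))) (when (not (var 2)) (.seq pickAll
      (when (lt (var 5) (add (var 3) (lit 1))) (set 2 (lit 1)))))))))

/-- A smallest modulator and the tables for its size. -/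
structure Found (G : SimpleGraph (Fin n)) (k p : ℕ) (l : List ℕ) (σ : State) : Prop
    extends Dist G k σ, Bits n p σ, Lists l σ where
  length_eq : l.length = p
  nodup : l.Nodup
  lt : ∀ a ∈ l, a < n
  hits : HitsP3 G (toSet n l)

theorem Found.congr {p : ℕ} (h : Found G k p l σ)
    (hv : ∀ x ∈ [0, 1, 4, 5], τ.var x = σ.var x)
    (ha : ∀ a ∈ [0, 1, 2, 4, 5, 6, 7], τ.arr a = σ.arr a) : Found G k p l τ :=
  { h.toDist.congr (hv 0 (by simp)) (hv 1 (by simp)) (ha 0 (by simp)) (ha 1 (by simp))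
      (ha 2 (by simp)) (ha 4 (by simp)),
    h.toBits.congr (hv 4 (by simp)) (ha 5 (by simp)) (ha 6 (by simp)),
    h.toLists.congr (hv 5 (by simp)) (ha 7 (by simp)) with
    length_eq := h.length_eq
    nodup := h.nodup
    lt := h.lt
    hits := h.hits }

theorem Found.frame {p : ℕ} (h : Found G k p l σ) (hf : c.Frame σ τ)
    (hc : c.keeps [0, 1, 4, 5] [0, 1, 2, 4, 5, 6, 7] = true) : Found G k p l τ :=
  h.congr (fun _ hx => hf.var_eq hc hx) (fun _ ha => hf.arr_eq hc ha)

/-- Every run yields a modulator, so none of size at most d exists before d = p; at d = p some digit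
string succeeds. Later sizes are skipped by the flag, so the cost for size p bounds each of the n +
1 ≤ 2n rounds. -/
theorem spec_search {p : ℕ} (hn : 1 ≤ n) (hG : distToCluster G = p) (hpn : p ≤ n)
    (h : Dist G k σ) :
    search.Spec σ (2 * n * (49 * n ^ 4 + (2 * p + 2) * (4 * 16 ^ p) + 2 ^ (2 * p) * n ^ 4))
      (fun τ => ∃ l, Found G k p l τ) := by
  set A := 49 * n ^ 4 + (2 * p + 2) * (4 * 16 ^ p) + 2 ^ (2 * p) * n ^ 4 with hA
  have hn4 : 1 ≤ n ^ 4 := Nat.one_le_pow _ _ hn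
  have hA1 : 1 ≤ A := by omega
  refine spec_seq (R := fun τ => τ.var 2 = 0) (spec_set (fits_flat rfl ?_) ?_) ?_
  · exact Nat.mul_pos (by omega) hA1
  · simp [State.setVar_var, Tm.eval]
  intro σ₁ hσ₁ hv2
  have h := h.frame hσ₁ rfl
  have hev : (add (var 0) (lit 1)).eval σ₁ = n + 1 := by simp [Tm.eval, h.var_n]
  -- While the flag is `0`, the size about to be tried is at most `p`. After the last round it would
  -- be n + 1 > p, so the flag is set by then.
  refine spec_loop (2 * n) (fun d τ => (τ.var 2 = 0 ∧ d ≤ p) ∨ (τ.var 2 ≠ 0 ∧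
    ∃ l, Found G k p l τ)) (by omega) rfl (by omega) hA1 (Or.inl ⟨hv2, by omega⟩) ?_ ?_
  · intro d hd τ hτ hI
    refine spec_when (fits_flat rfl hA1) (fun hb => ?_) fun hb => ?_
    · rw [holds_not] at hb
      have hτ2 : τ.var 2 = 0 := by simpa [Holds, Tm.eval, State.setVar_var] using hb
      have hdp : d ≤ p := by
        rcases hI with hI | hI
        · exact hI.2
        · exact absurd hτ2 hI.1
      have h₁ := h.frame hτ.setVar (τ := τ.setVar 3 d) rfl
      have hle : (2 * d + 2) * (4 * 16 ^ d) ≤ (2 * p + 2) * (4 * 16 ^ p) :=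
        Nat.mul_le_mul (by omega) (Nat.mul_le_mul_left _ (Nat.pow_le_pow_right (by norm_num) hdp))
      have hle' : 2 ^ (2 * d) * n ^ 4 ≤ 2 ^ (2 * p) * n ^ 4 :=
        Nat.mul_le_mul_right _ (Nat.pow_le_pow_right (by norm_num) (by omega))
      refine spec_seq ((spec_bitsTable (d := d) hn (hdp.trans hpn) h₁.toArith
        (by simp [State.setVar_var])).mono (by omega)) fun τ₁ hτ₁ hB => ?_
      have h₁ := h₁.frame hτ₁ rfl
      have h3 : τ₁.var 3 = d := by rw [hτ₁.var 3 rfl]; simp [State.setVar_var]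
      have h2 : τ₁.var 2 = 0 := by rw [hτ₁.var 2 rfl]; simpa [State.setVar_var] using hτ2
      have hev : (get 2 (add (var 3) (var 3))).eval τ₁ = 2 ^ (2 * d) := by
        simp [Tm.eval, h3, h₁.pow (d + d) (by omega), two_mul]
      refine (spec_loop (2 ^ (2 * d)) (A := n ^ 4) (fun g τ => (τ.var 2 = 0 ∧
        ∀ g' < g, d < (picks G (digit g')).length) ∨ (τ.var 2 ≠ 0 ∧
        ∃ l, Found G k p l τ)) Nat.one_le_two_pow rfl hev.le hn4 (Or.inl ⟨h2, by simp⟩)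
        ?_ ?_).mono (by omega)
      · intro g hg τ₂ hτ₂ hI₂
        rw [hev] at hg
        refine spec_when (fits_flat rfl hn4) (fun hb => ?_) fun hb => ?_
        · rw [holds_not] at hb
          have hτ2 : τ₂.var 2 = 0 := by simpa [Holds, Tm.eval, State.setVar_var] using hb
          have hno : ∀ g' < g, d < (picks G (digit g')).length := by
            rcases hI₂ with hI | hI
            · exact hI.2
            · exact absurd hτ2 hI.1
          have h₂ := h₁.frame hτ₂.setVar (τ := τ₂.setVar 7 g) rfl
          have hB₂ := hB.frame hτ₂.setVar (τ := τ₂.setVar 7 g) rfl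
          have h3 : (τ₂.setVar 7 g).var 3 = d := (hτ₂.setVar.var 3 rfl).trans h3
          -- The tables guarantee only the digits below `d`. A run that picks more than `d` vertices
          -- may read arbitrary values, but such a run is rejected anyway.
          have hdig : ∀ e < d, readDigit (τ₂.setVar 7 g) e = digit g e := fun e he => by
            have := hB₂.eval_digit (hdp.trans hpn) (e := lit e) (g := var 7) (by exact he)
              (by simp only [Tm.eval, State.setVar_var, reduceIte]; rw [pow_succ]; omega)
            exact this.trans (by simp [Tm.eval, State.setVar_var])
          refine spec_seq (spec_pickAll hn h₂.toArith) fun τ₃ hτ₃ hL => ?_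
          set l := picks G (readDigit (τ₂.setVar 7 g)) with hl
          have h₃ := h₂.frame hτ₃ rfl
          have hB₃ := hB₂.frame hτ₃ rfl
          have h3 : τ₃.var 3 = d := (hτ₃.var 3 rfl).trans h3
          have hcond : (lt (var 5) (add (var 3) (lit 1))).Holds τ₃ ↔ l.length ≤ d := by
            rw [holds_lt]; simp [Tm.eval, h3, hL.length]
          refine spec_when (fits_flat rfl hn4) (fun hb => ?_) fun hb => ?_
          · rw [hcond] at hb
            have hpl : p ≤ l.length := hG ▸ distToCluster_le_length_picks
            -- An accepted list is a modulator, so p ≤ `l.length` ≤ d ≤ p.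
            obtain rfl : d = p := by omega
            refine spec_set (fits_flat rfl hn4) (Or.inr ⟨?_, l, Found.congr (σ := τ₃)
              { h₃, hB₃, hL with
                length_eq := by omega
                nodup := nodup_picks
                lt := lt_of_mem_picks
                hits := hitsP3_picks } (fun x hx => ?_) fun _ _ => rfl⟩)
            · simp [State.setVar_var, Tm.eval]
            · simp only [List.mem_cons, List.not_mem_nil, or_false] at hx
              rw [State.setVar_var, if_neg (by omega)]
          · rw [hcond] at hb
            refine Or.inl ⟨?_, fun g' hg' => ?_⟩
            · rw [hτ₃.var 2 rfl]; simpa [State.setVar_var] using hτ2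
            rcases Nat.lt_succ_iff_lt_or_eq.1 hg' with h' | rfl
            · exact hno g' h'
            · by_contra hcon
              have := picks_congr (G := G) (f := digit g')
                (f' := readDigit (τ₂.setVar 7 g')) fun e he => (hdig e (by omega)).symm
              rw [← hl] at this
              rw [this] at hb
              exact hcon (by omega)
        · have hτ2 : τ₂.var 2 ≠ 0 := by
            rw [holds_not, not_not] at hb
            simpa [Holds, Tm.eval, State.setVar_var] using hb
          rcases hI₂ with hI | ⟨_, l, hF⟩
          · exact absurd hI.1 hτ2
          · refine Or.inr ⟨by simpa [State.setVar_var] using hτ2, l, hF.congr (fun x hx => ?_)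
              fun _ _ => rfl⟩
            simp only [List.mem_cons, List.not_mem_nil, or_false] at hx
            rw [State.setVar_var, if_neg (by omega)]
      · intro τ₂ _ hI₂
        rw [hev] at hI₂
        rcases hI₂ with ⟨h2, hI₂⟩ | hI₂
        · refine Or.inl ⟨h2, ?_⟩
          rcases hdp.lt_or_eq with h' | rfl
          · exact h'
          · obtain ⟨f, hf, hlen⟩ := exists_length_picks_le G
            obtain ⟨g, hg, hgf⟩ := exists_digit_eq f hf d
            have := picks_congr (G := G) (f := f) (f' := digit g)
              fun e he => (hgf e (by omega)).symm
            have := hI₂ g hg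
            rw [‹picks G (digit g) = _›] at this
            omega
        · exact Or.inr hI₂
    · have hτ2 : τ.var 2 ≠ 0 := by
        rw [holds_not, not_not] at hb
        simpa [Holds, Tm.eval, State.setVar_var] using hb
      rcases hI with hI | ⟨_, l, hF⟩
      · exact absurd hI.1 hτ2
      · refine Or.inr ⟨by simpa [State.setVar_var] using hτ2, l, hF.congr (fun x hx => ?_)
          fun _ _ => rfl⟩
        simp only [List.mem_cons, List.not_mem_nil, or_false] at hx
        rw [State.setVar_var, if_neg (by omega)]
  · intro τ _ hI
    rw [hev] at hI
    rcases hI with hI | hI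
    · omega
    · exact hI.2

end
end RAM

/-! ### Walks that collect elements -/

namespace MESP

open Classical in
/-- The number with the binary digits `b`. -/
noncomputable def ofBits (m : ℕ) (b : ℕ → Prop) : ℕ := ∑ e ∈ Finset.range m, if b e then 2 ^ e else 0

theorem ofBits_lt (m : ℕ) (b : ℕ → Prop) : ofBits m b < 2 ^ m := by
  induction m with
  | zero => simp [ofBits]
  | succ m ih =>
    rw [ofBits, Finset.sum_range_succ, ← ofBits, pow_succ]
    split_ifs <;> omega

theorem testBit_ofBits {m : ℕ} {b : ℕ → Prop} {e : ℕ} (he : e < m) :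
    (ofBits m b).testBit e = true ↔ b e := by
  induction m with
  | zero => omega
  | succ m ih =>
    rw [ofBits, Finset.sum_range_succ, ← ofBits]
    have hlt := ofBits_lt m b
    rcases Nat.lt_succ_iff_lt_or_eq.1 he with h | rfl
    · split_ifs
      · rw [add_comm, Nat.testBit_two_pow_add_gt h, ih h]
      · rw [add_zero, ih h]
    · split_ifs with h
      · rw [add_comm, Nat.testBit_two_pow_add_eq, Nat.testBit_lt_two_pow hlt]
        simpa using h
      · rw [add_zero, Nat.testBit_lt_two_pow hlt]
        simpa using h

theorem ofBits_eq_zero_iff {m : ℕ} {b : ℕ → Prop} : ofBits m b = 0 ↔ ∀ e < m, ¬ b e := by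
  simp [ofBits, Finset.sum_eq_zero_iff]

/-! ### The recursion for walks that complete a set of tasks -/

section Reach

variable {V : Type*} {G : SimpleGraph V} {C : ℕ → V → Prop} {m : ℕ} {s : V}

/-- Some walk of length `l` from `v` to `s` meets all elements in the mask `S`. -/
def Reach (G : SimpleGraph V) (C : ℕ → V → Prop) (m : ℕ) (s : V) (l : ℕ) (v : V) (S : ℕ) : Prop :=
  ∃ q : G.Walk v s, q.length = l ∧ ∀ e < m, S.testBit e = true → ∃ w ∈ q.support, C e w

/-- The elements of the mask that `v` does not meet. -/
noncomputable def rest (C : ℕ → V → Prop) (m : ℕ) (v : V) (S : ℕ) : ℕ :=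
  ofBits m fun e => S.testBit e = true ∧ ¬ C e v

theorem reach_zero {v : V} {S : ℕ} : Reach G C m s 0 v S ↔ v = s ∧ rest C m v S = 0 := by
  simp only [rest, ofBits_eq_zero_iff, not_and, not_not]
  constructor
  · rintro ⟨q, hq, h⟩
    obtain rfl := SimpleGraph.Walk.eq_of_length_eq_zero hq
    rw [SimpleGraph.Walk.length_eq_zero_iff] at hq
    simpa [SimpleGraph.Walk.nil_iff_support_eq.1 hq] using h
  · rintro ⟨rfl, h⟩
    exact ⟨.nil, rfl, by simpa using h⟩

/-- Split off the first vertex: the tasks that `v` does not complete are left to the rest of the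
walk. The walk may be arbitrary, since shortest paths are singled out later by the length alone. -/
theorem reach_succ {l : ℕ} {v : V} {S : ℕ} :
    Reach G C m s (l + 1) v S ↔ ∃ w, G.Adj v w ∧ Reach G C m s l w (rest C m v S) := by
  constructor
  · rintro ⟨q, hq, h⟩
    cases q with
    | nil => simp at hq
    | @cons _ w _ ha q =>
      refine ⟨w, ha, q, by simpa using hq, fun e he hS => ?_⟩
      rw [rest, testBit_ofBits he] at hS
      obtain ⟨y, hy, hC⟩ := h e he hS.1
      rw [SimpleGraph.Walk.support_cons, List.mem_cons] at hy
      rcases hy with rfl | hy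
      · exact absurd hC hS.2
      · exact ⟨y, hy, hC⟩
  · rintro ⟨w, ha, q, hq, h⟩
    refine ⟨.cons ha q, by simpa using hq, fun e he hS => ?_⟩
    by_cases hC : C e v
    · exact ⟨v, by simp, hC⟩
    · obtain ⟨y, hy, hC⟩ := h e he (by rw [rest, testBit_ofBits he]; exact ⟨hS, hC⟩)
      exact ⟨y, by simp [hy], hC⟩

end Reach

/-! ### Correctness of the acceptance test -/

section Final

variable {n : ℕ} {G : SimpleGraph (Fin n)} {X : Finset (Fin n)} {x : ℕ → Fin n} {p k : ℕ}
  {δ : ℕ → ℕ}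

/-- `IsRep` on natural numbers. -/
def IsRepNat (G : SimpleGraph (Fin n)) (X : Finset (Fin n)) (x : ℕ → Fin n) (p k : ℕ) (δ : ℕ → ℕ)
    (u : ℕ) : Prop :=
  ∃ h : u < n, IsRep G X x p k δ ⟨u, h⟩

open Classical in
/-- The number of cliques that the path has to enter. -/
noncomputable def numReps (G : SimpleGraph (Fin n)) (X : Finset (Fin n)) (x : ℕ → Fin n) (p k : ℕ)
    (δ : ℕ → ℕ) : ℕ :=
  Nat.count (IsRepNat G X x p k δ) n

/-- What the path has to meet: a vertex near `x e`, or the `(e - p)`-th clique. -/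
def Meets (G : SimpleGraph (Fin n)) (X : Finset (Fin n)) (x : ℕ → Fin n) (p k : ℕ) (δ : ℕ → ℕ)
    (e : ℕ) (w : Fin n) : Prop :=
  if e < p then G.dist (x e) w ≤ δ e else
    ∃ u : Fin n, u.val = Nat.nth (IsRepNat G X x p k δ) (e - p) ∧ Touches G X u w

/-- `Nat.nth` of a finite predicate takes the default value `0` past its last element; an index
below the count excludes this. -/
theorem lt_of_lt_numReps {i : ℕ} (hi : i < numReps G X x p k δ) :
    ∃ u : Fin n, u.val = Nat.nth (IsRepNat G X x p k δ) i ∧ IsRep G X x p k δ u := by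
  classical
  have hlt := Nat.nth_lt_of_lt_count hi
  have hm : IsRepNat G X x p k δ (Nat.nth (IsRepNat G X x p k δ) i) := by
    refine Nat.nth_mem i fun hf => hi.trans_le ?_
    exact Nat.count_le_card hf n
  exact ⟨⟨_, hlt⟩, rfl, hm.2⟩

theorem exists_nth_eq {u : Fin n} (hu : IsRep G X x p k δ u) :
    ∃ i < numReps G X x p k δ, Nat.nth (IsRepNat G X x p k δ) i = u := by
  classical
  have hu' : IsRepNat G X x p k δ u := ⟨u.2, hu⟩
  exact ⟨Nat.count (IsRepNat G X x p k δ) u, Nat.count_strict_mono hu' u.2, Nat.nth_count hu'⟩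

theorem numReps_eq_card (G : SimpleGraph (Fin n)) (X : Finset (Fin n)) (x : ℕ → Fin n) (p k : ℕ)
    (δ : ℕ → ℕ) [DecidablePred (IsRep G X x p k δ)] :
    numReps G X x p k δ = (Finset.univ.filter (IsRep G X x p k δ)).card := by
  classical
  rw [numReps, Nat.count_eq_card_filter_range, ← Finset.card_map Fin.valEmbedding]
  congr 1
  ext a
  simp only [Finset.mem_filter, Finset.mem_range, Finset.mem_map, Finset.mem_univ, true_and,
    Fin.valEmbedding_apply]
  constructor
  · rintro ⟨_, h, h'⟩; exact ⟨⟨a, h⟩, h', rfl⟩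
  · rintro ⟨u, h, rfl⟩; exact ⟨u.2, u.2, h⟩

/-- The condition that is checked for the start vertex `s` and the digits of `g`. -/
def Accepts (G : SimpleGraph (Fin n)) (X : Finset (Fin n)) (x : ℕ → Fin n) (p k : ℕ) (δ : ℕ → ℕ)
    (s : Fin n) : Prop :=
  (numReps G X x p k δ ≤ p + 1 ∧ ∀ e < p, δ e ≤ k) ∧
    ∃ v, Reach G (Meets G X x p k δ) (p + numReps G X x p k δ) s (G.dist v s) v
      (2 ^ (p + numReps G X x p k δ) - 1)

/-- No property of `δ` beyond the test itself is used, so a wrong guess can never lead to a wrong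
yes: the walk found certifies all promised distances. -/
theorem isYesInstance_of_accepts (hG : G.Connected) (hX : HitsP3 G X)
    (hx : ∀ v ∈ X, ∃ e < p, x e = v) (hk : 1 ≤ k) {s : Fin n} (h : Accepts G X x p k δ s) :
    IsYesInstance G k := by
  obtain ⟨⟨-, hδ⟩, v, q, hq, hS⟩ := h
  -- In the full mask 2^m - 1 all m bits are set.
  have hS' : ∀ e < p + numReps G X x p k δ, ∃ w ∈ q.support, Meets G X x p k δ e w :=
    fun e he => hS e he (by rw [Nat.testBit_two_pow_sub_one]; simpa using he)
  refine (isYesInstance_iff hG).2 ⟨v, s, q, hq, covers_of_reps hG hX hx hk {w | w ∈ q.support} hδ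
    (fun e he => ?_) fun u hu => ?_⟩
  · obtain ⟨w, hw, h⟩ := hS' e (by omega)
    rw [Meets, if_pos he] at h
    exact ⟨w, hw, h⟩
  · obtain ⟨i, hi, hiu⟩ := exists_nth_eq hu
    obtain ⟨w, hw, h⟩ := hS' (p + i) (by omega)
    rw [Meets, if_neg (by omega), Nat.add_sub_cancel_left, hiu] at h
    obtain ⟨u', hu', h⟩ := h
    obtain rfl := Fin.ext hu'
    exact ⟨w, hw, h⟩

/-- For the guess belonging to a solution, `δ` consists of the true distances to the path. The
reversed path is then the walk that is asked for, as walks of `Reach` end in `s`. -/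
theorem exists_accepts (hG : G.Connected) (hX : HitsP3 G X) (hx : ∀ v ∈ X, ∃ e < p, x e = v)
    (hc : X.card = p) (h : IsYesInstance G k) :
    ∃ s, ∃ g < 2 ^ (2 * p), Accepts G X x p k (guess G x p s (RAM.digit g)) s := by
  classical
  obtain ⟨s, v, q, hq, hcov⟩ := (isYesInstance_iff hG).1 h
  obtain ⟨f, hf, hfe⟩ := exists_guess_eq hG hX hx q hq
  obtain ⟨g, hg, hgf⟩ := RAM.exists_digit_eq f hf p
  have hδ : ∀ e < p, guess G x p s (RAM.digit g) e = minDist G (x e) {w | w ∈ q.support} := by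
    intro e he
    rw [← hfe e he, guess, guess, hgf e he]
    congr 2
    ext y
    refine or_congr Iff.rfl (exists_congr fun i => and_congr_right fun hi => ?_)
    rw [hgf i hi]
  refine ⟨s, g, hg, ?_⟩
  set δ := guess G x p s (RAM.digit g) with hδdef
  have hT : ∀ u, IsBad G X x p k δ u → ∃ w ∈ q.support, Touches G X u w := fun u hu =>
    exists_touches_of_covers hG hX hx {w | w ∈ q.support} hcov hδ hu
  have hne : {w | w ∈ q.support}.Nonempty := ⟨s, q.start_mem_support⟩
  refine ⟨⟨?_, fun e he => ?_⟩, v, q.reverse, ?_, fun e he _ => ?_⟩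
  · rw [numReps_eq_card]
    exact (card_reps_le hX q hq _ (fun u hu => (Finset.mem_filter.1 hu).2)
      fun u hu => hT u (Finset.mem_filter.1 hu).2.1).trans (hc ▸ le_rfl)
  · rw [hδ e he, minDist_le_iff hne]
    exact hcov _
  · rw [SimpleGraph.Walk.length_reverse, hq, G.dist_comm]
  · simp only [SimpleGraph.Walk.support_reverse, List.mem_reverse]
    by_cases hep : e < p
    · obtain ⟨w, hw, h'⟩ := exists_dist_eq_minDist (G := G) (u := x e) hne
      exact ⟨w, hw, by rw [Meets, if_pos hep, h', hδ e hep]⟩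
    · obtain ⟨u, hu, hr⟩ := lt_of_lt_numReps (G := G) (X := X) (x := x) (p := p) (k := k) (δ := δ)
        (i := e - p) (by omega)
      obtain ⟨w, hw, h'⟩ := hT u hr.1
      exact ⟨w, hw, by rw [Meets, if_neg hep]; exact ⟨u, hu, h'⟩⟩

/-- A path with n distinct vertices contains every vertex. This holds for every `k`, so the program
may test it unconditionally. -/
theorem isYesInstance_of_dist (hG : G.Connected) {s v : Fin n} (h : G.dist s v + 1 = n) :
    IsYesInstance G k := by
  obtain ⟨q, hq⟩ := hG.exists_walk_length_eq_dist s v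
  refine (isYesInstance_iff hG).2 ⟨s, v, q, hq, fun u => ⟨u, ?_, by simp⟩⟩
  have hn := (isPath_of_length_eq_dist q hq).support_nodup
  have : q.support.toFinset = Finset.univ := by
    rw [← Finset.card_eq_iff_eq_univ, List.toFinset_card_of_nodup hn,
      SimpleGraph.Walk.length_support, hq, h, Fintype.card_fin]
  rw [← List.mem_toFinset, this]
  exact Finset.mem_univ u

theorem exists_dist_of_isYesInstance_zero (hG : G.Connected) (h : IsYesInstance G 0) :
    ∃ s v, G.dist s v + 1 = n := by
  obtain ⟨s, v, q, hq, hcov⟩ := (isYesInstance_iff hG).1 h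
  refine ⟨s, v, ?_⟩
  have hn := (isPath_of_length_eq_dist q hq).support_nodup
  rw [← hq, ← SimpleGraph.Walk.length_support, ← List.toFinset_card_of_nodup hn]
  have : q.support.toFinset = Finset.univ := by
    ext u
    obtain ⟨w, hw, h⟩ := hcov u
    rw [Nat.le_zero, hG.dist_eq_zero_iff] at h
    simpa [h] using hw
  rw [this, Finset.card_univ, Fintype.card_fin]

end Final

end MESP

/-! ### Deciding the problem for a given modulator -/

namespace RAM

open Tm Cmd MESP

/-- A modulator `X`, given by a list and by its characteristic function. -/
structure Setup {n : ℕ} (G : SimpleGraph (Fin n)) (k p : ℕ) (X : Finset (Fin n)) (x : ℕ → Fin n)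
    (σ : State) : Prop extends Dist G k σ, Bits n p σ where
  var_p : σ.var 5 = p
  xs : ∀ e < p, σ.arr 7 e = x e
  inX : ∀ u : Fin n, σ.arr 8 u ≠ 0 ↔ u ∈ X

/-- Array `9` contains `δ`, variable `9` and array `13` the representatives. -/
structure Guessed {n : ℕ} (G : SimpleGraph (Fin n)) (k p : ℕ) (X : Finset (Fin n))
    (x : ℕ → Fin n) (δ : ℕ → ℕ) (σ : State) : Prop where
  delta : ∀ e < p, σ.arr 9 e = δ e
  var_r : σ.var 9 = numReps G X x p k δ
  rep : ∀ i < numReps G X x p k δ, σ.arr 13 i = Nat.nth (IsRepNat G X x p k δ) i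

/-- The comparison `e ≤ f`. -/
abbrev leTm (e f : Tm) : Tm := lt e (add f (lit 1))

theorem holds_le (e f : Tm) (σ : State) : (leTm e f).Holds σ ↔ e.eval σ ≤ f.eval σ := by
  rw [holds_lt, eval_add, eval_lit, Nat.lt_succ_iff]

/-- Computes the characteristic function of the list. -/
def memTable : Cmd := loop 11 (var 0) (store 8 (var 11) (memTm 11))

/-- The term for the existence of a guessed vertex of the path near the vertex `x e`. -/
abbrev nearTm : Tm :=
  add (leTm (entry 4 (get 7 (var 11)) (var 6)) (var 20))
    (sum 21 (var 5) (and (not (digitTm (var 21) (var 7)))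
      (leTm (entry 4 (get 7 (var 11)) (get 7 (var 21))) (var 20))))

/-- Computes the guessed distances. -/
def deltaTable : Cmd :=
  loop 11 (var 5) (store 9 (var 11)
    (sub (sum 20 (var 0) (not nearTm)) (sub (digitTm (var 11) (var 7)) (lit 1))))

/-- Marks the bad vertices. -/
def badTable : Cmd :=
  loop 11 (var 0) (store 10 (var 11) (and (not (get 8 (var 11)))
    (not (sum 20 (var 5)
      (leTm (add (entry 4 (var 11) (get 7 (var 20))) (get 9 (var 20))) (var 1))))))

/-- Marks the representatives of the bad vertices. -/
def repTable : Cmd :=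
  loop 11 (var 0) (store 11 (var 11) (and (get 10 (var 11))
    (not (sum 20 (var 11) (and (get 10 (var 20)) (entry 0 (var 20) (var 11)))))))

/-- Counts the representatives below `e`. -/
abbrev countTm (e : Tm) : Tm := sum 20 e (ite (get 11 (var 20)) (lit 1) (lit 0))

/-- Ranks the representatives. -/
def rankTable : Cmd := loop 11 (var 0) (store 12 (var 11) (countTm (var 11)))

/-- Lists the representatives. -/
def listReps : Cmd :=
  loop 11 (var 9) (store 13 (var 11) (sum 20 (var 0)
    (ite (and (get 11 (var 20)) (eq (get 12 (var 20)) (var 11))) (var 20) (lit 0))))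

/-- All tables that depend on the guess. -/
def guessTables : Cmd :=
  .seq deltaTable (.seq badTable (.seq repTable (.seq rankTable
    (.seq (set 9 (countTm (var 0))) listReps))))

section

variable {n k p : ℕ} {G : SimpleGraph (Fin n)} {X : Finset (Fin n)} {x : ℕ → Fin n} {δ : ℕ → ℕ}
  {σ τ : State} {c : Cmd}

theorem Setup.congr (h : Setup G k p X x σ)
    (hv : ∀ x ∈ [0, 1, 4, 5], τ.var x = σ.var x)
    (ha : ∀ a ∈ [0, 1, 2, 4, 5, 6, 7, 8], τ.arr a = σ.arr a) : Setup G k p X x τ :=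
  { h.toDist.congr (hv 0 (by simp)) (hv 1 (by simp)) (ha 0 (by simp)) (ha 1 (by simp))
      (ha 2 (by simp)) (ha 4 (by simp)),
    h.toBits.congr (hv 4 (by simp)) (ha 5 (by simp)) (ha 6 (by simp)) with
    var_p := (hv 5 (by simp)).trans h.var_p
    xs := by rw [ha 7 (by simp)]; exact h.xs
    inX := by rw [ha 8 (by simp)]; exact h.inX }

theorem Setup.frame (h : Setup G k p X x σ) (hf : c.Frame σ τ)
    (hc : c.keeps [0, 1, 4, 5] [0, 1, 2, 4, 5, 6, 7, 8] = true) : Setup G k p X x τ :=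
  h.congr (fun _ hx => hf.var_eq hc hx) (fun _ ha => hf.arr_eq hc ha)

theorem Setup.setVar (h : Setup G k p X x σ) {y i : ℕ} (hy : y ∉ [0, 1, 4, 5]) :
    Setup G k p X x (σ.setVar y i) :=
  h.congr (fun z hz => by rw [State.setVar_var, if_neg]; rintro rfl; exact hy hz) fun _ _ => rfl

theorem Guessed.congr (h : Guessed G k p X x δ σ) (h1 : τ.var 9 = σ.var 9)
    (h2 : τ.arr 9 = σ.arr 9) (h3 : τ.arr 13 = σ.arr 13) : Guessed G k p X x δ τ :=
  ⟨by rw [h2]; exact h.delta, h1.trans h.var_r, by rw [h3]; exact h.rep⟩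

theorem Guessed.frame (h : Guessed G k p X x δ σ) (hf : c.Frame σ τ)
    (hc : c.keeps [9] [9, 13] = true) : Guessed G k p X x δ τ :=
  h.congr (hf.var_eq hc (by simp)) (hf.arr_eq hc (by simp)) (hf.arr_eq hc (by simp))

theorem Found.spec_memTable {l : List ℕ} (hn : 1 ≤ n) (hpn : p ≤ n) (h : Found G k p l σ) :
    memTable.Spec σ (n * (n * 1)) (fun τ => ∃ X x, Setup G k p X x τ ∧ HitsP3 G X ∧
      X.card = p ∧ ∀ v ∈ X, ∃ e < p, x e = v) := by
  refine (spec_fill (A := n * 1) n (fun u z => z ≠ 0 ↔ u ∈ l) hn rfl (by exact h.var_n.le)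
    (by omega) ?_).imp ?_
  · intro u hu τ hτ _
    have hl : Lists l (τ.setVar 11 u) := (h.frame hτ.setVar (τ := τ.setVar 11 u) rfl).toLists
    refine ⟨hl.fits_mem hn (by rw [h.length_eq]; exact hpn), ?_⟩
    refine (hl.holds_mem (by decide)).trans ?_
    simp [State.setVar_var]
  · intro τ hτ h'
    have hF := h.frame hτ rfl
    simp only [eval_var, h.var_n] at h'
    -- The value of `x` past the end of the list is a dummy; only indices below `p` matter.
    refine ⟨toSet n l, fun e => if h' : e < l.length then ⟨l[e], h.lt _ (List.getElem_mem h')⟩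
      else ⟨0, hn⟩, { hF.toDist, hF.toBits with
        var_p := by rw [hF.length, hF.length_eq]
        xs := fun e he => ?_
        inX := fun u => ?_ }, hF.hits, ?_, fun v hv => ?_⟩
    · rw [← h.length_eq] at he
      rw [dif_pos he, hF.get e he]
    · rw [mem_toSet]
      exact h' u u.2
    · rw [card_toSet hF.nodup hF.lt, hF.length_eq]
    · rw [mem_toSet, List.mem_iff_getElem] at hv
      obtain ⟨e, he, hev⟩ := hv
      refine ⟨e, h.length_eq ▸ he, ?_⟩
      simp only [dif_pos he]
      exact Fin.ext hev

theorem Setup.holds_near (h : Setup G k p X x σ) (hpn : p ≤ n) {s : Fin n} {g e r : ℕ}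
    (hs : σ.var 6 = s) (hg : σ.var 7 = g) (hgp : g < 2 ^ (2 * p)) (he : σ.var 11 = e) (hep : e < p)
    (hr : σ.var 20 = r) :
    nearTm.Holds σ ↔ ∃ y ∈ {y | y = s ∨ ∃ i < p, digit g i = 0 ∧ y = x i}, G.dist (x e) y ≤ r := by
  have hxe : (get 7 (var 11)).eval σ = x e := by simp only [Tm.eval]; rw [he, h.xs e hep]
  rw [holds_add, holds_le, h.eval_dist (v := s) hxe (by exact hs), holds_sum, eval_var, eval_var, hr, h.var_p]
  have key : ∀ i < p, (and (not (digitTm (var 21) (var 7)))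
      (leTm (entry 4 (get 7 (var 11)) (get 7 (var 21))) (var 20))).Holds (σ.setVar 21 i) ↔
      digit g i = 0 ∧ G.dist (x e) (x i) ≤ r := by
    intro i hi
    have h' : Setup G k p X x (σ.setVar 21 i) := h.setVar (by simp)
    rw [holds_and, holds_not, Holds, h'.eval_digit hpn (by simpa [Tm.eval, State.setVar_var] using hi)
      (by simp [Tm.eval, State.setVar_var, hg, pow_succ]; omega), holds_le,
      h'.eval_dist (u := x e) (v := x i)]
    · simp [Tm.eval, State.setVar_var, hg, hr]
    · simpa [Tm.eval, State.setVar_var, State.setVar_arr] using hxe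
    · simp [Tm.eval, State.setVar_var, h.xs i hi, State.setVar_arr]
  constructor
  · rintro (hd | ⟨i, hi, hd⟩)
    · exact ⟨s, Or.inl rfl, hd⟩
    · rw [key i hi] at hd
      exact ⟨x i, Or.inr ⟨i, hi, hd.1, rfl⟩, hd.2⟩
  · rintro ⟨y, rfl | ⟨i, hi, h0, rfl⟩, hd⟩
    · exact Or.inl hd
    · exact Or.inr ⟨i, hi, (key i hi).2 ⟨h0, hd⟩⟩

/-- The minimum is computed by counting the radii r < n within which no guessed vertex lies; all
distances are below n, so none is missed. -/
theorem Setup.spec_deltaTable (h : Setup G k p X x σ) (hG : G.Connected) (hn : 1 ≤ n) (hp : 1 ≤ p)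
    (hpn : p ≤ n) {s : Fin n} {g : ℕ} (hs : σ.var 6 = s) (hg : σ.var 7 = g)
    (hgp : g < 2 ^ (2 * p)) :
    deltaTable.Spec σ (p * (n * (p * 1)))
      (fun τ => ∀ e < p, τ.arr 9 e = guess G x p s (digit g) e) := by
  refine (spec_fill (A := n * (p * 1)) p (fun e z => z = guess G x p s (digit g) e) hp rfl
    (by exact h.var_p.le) (by rw [Nat.succ_le_iff]; positivity) ?_).imp ?_
  · intro e he τ hτ _
    rw [eval_var, h.var_p] at he
    have hfr := hτ.setVar (j := e)
    have h' := h.frame hfr rfl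
    have hs : (τ.setVar 11 e).var 6 = s := (hfr.var 6 rfl).trans hs
    have hg : (τ.setVar 11 e).var 7 = g := (hfr.var 7 rfl).trans hg
    have h11 : (τ.setVar 11 e).var 11 = e := by simp [State.setVar_var]
    generalize τ.setVar 11 e = τ' at h' hs hg h11
    have h1 : 1 ≤ n * (p * 1) := by rw [Nat.succ_le_iff]; positivity
    have hnear : ∀ r, nearTm.Holds (τ'.setVar 20 r) ↔
        minDist G (x e) {y | y = s ∨ ∃ i < p, digit g i = 0 ∧ y = x i} ≤ r := fun r => by
      rw [Setup.holds_near (e := e) (r := r) (h'.setVar (by simp)) hpn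
        (by simpa [State.setVar_var] using hs)
        (by simpa [State.setVar_var] using hg) hgp (by simpa [State.setVar_var] using h11) he
        (by simp [State.setVar_var]),
        minDist_le_iff ⟨s, Or.inl rfl⟩]
    constructor
    · refine fits_sub (fits_sum n hn rfl (by exact h'.var_n.le) (by omega) fun r _ => ?_)
        (fits_flat rfl h1)
      have h'' : Setup G k p X x (τ'.setVar 20 r) := h'.setVar (by simp)
      exact fits_eq (fits_add (fits_flat rfl (by omega)) (fits_sum p hp rfl (by exact h''.var_p.le)
        le_rfl fun _ _ => fits_flat rfl le_rfl)) (fits_flat rfl (by omega))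
    · rw [eval_sub, eval_sub, h'.eval_digit hpn (by simpa [Tm.eval, h11] using he)
        (by simp [Tm.eval, hg, pow_succ]; omega), guess, eval_sum, eval_var, h'.var_n]
      simp only [eval_var, eval_lit, hg, h11]
      congr 1
      set D := minDist G (x e) {y | y = s ∨ ∃ i < p, digit g i = 0 ∧ y = x i} with hD
      have hDn : D < n := by
        obtain ⟨y, -, hy⟩ := exists_dist_eq_minDist (G := G) (u := x e)
          (S := {y | y = s ∨ ∃ i < p, digit g i = 0 ∧ y = x i}) ⟨s, Or.inl rfl⟩
        rw [hD, ← hy]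
        simpa using dist_lt_card hG (x e) y
      have : ∀ r ∈ Finset.range n, (not nearTm).eval (τ'.setVar 20 r) = if r < D then 1 else 0 := by
        intro r _
        rw [eval_eq, eval_lit]
        refine if_congr ?_ rfl rfl
        rw [← not_iff_not, not_lt]
        exact hnear r
      rw [Finset.sum_congr rfl this, ← Finset.sum_filter, Finset.sum_const, smul_eq_mul, mul_one]
      have : (Finset.range n).filter (· < D) = Finset.range D := by
        ext r; simp; omega
      rw [this, Finset.card_range]
  · intro τ _ h' e he
    exact h' e (by rwa [eval_var, h.var_p])

theorem Setup.spec_badTable (h : Setup G k p X x σ) (hn : 1 ≤ n) (hp : 1 ≤ p)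
    (hδ : ∀ e < p, σ.arr 9 e = δ e) :
    badTable.Spec σ (n * (p * 1)) (fun τ => ∀ u : Fin n, τ.arr 10 u ≠ 0 ↔ IsBad G X x p k δ u) := by
  refine (spec_fill (A := p * 1) n (fun u z => ∀ hu : u < n, z ≠ 0 ↔ IsBad G X x p k δ ⟨u, hu⟩) hn
    rfl (by exact h.var_n.le) (by omega) ?_).imp ?_
  · intro u _ τ hτ _
    have hfr := hτ.setVar (j := u)
    have h' := h.frame hfr rfl
    have hδ' : ∀ e < p, (τ.setVar 11 u).arr 9 e = δ e := by rw [hfr.arr 9 rfl]; exact hδ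
    have h11 : (τ.setVar 11 u).var 11 = u := by simp [State.setVar_var]
    generalize τ.setVar 11 u = τ' at h' h11 hδ'
    refine ⟨fits_ite (fits_flat rfl (by omega)) (fun _ => fits_eq (fits_sum p hp rfl
      (by exact h'.var_p.le) le_rfl fun _ _ => fits_flat rfl le_rfl) (fits_flat rfl (by omega)))
      fun _ => fits_flat rfl (by omega), fun hu => ?_⟩
    have hx : (get 8 (var 11)).Holds τ' ↔ (⟨u, hu⟩ : Fin n) ∈ X := by
      rw [← h'.inX, Holds, eval_get, eval_var, h11]
    change Holds _ _ ↔ _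
    rw [holds_and, holds_not, holds_not, holds_sum, hx, eval_var, h'.var_p, IsBad]
    refine and_congr Iff.rfl ?_
    push Not
    refine forall_congr' fun e => forall_congr' fun he => ?_
    have h'' : Setup G k p X x (τ'.setVar 20 e) := h'.setVar (by simp)
    rw [holds_le, not_le, eval_add, h''.eval_dist (u := ⟨u, hu⟩) (v := x e)]
    · simp [Tm.eval, State.setVar_var, State.setVar_arr, h'.var_k, hδ' e he]
    · simp [Tm.eval, State.setVar_var, h11]
    · simp [Tm.eval, State.setVar_var, State.setVar_arr, h'.xs e he]
  · intro τ _ h' u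
    exact h' u (by rw [eval_var, h.var_n]; exact u.2) u.2

theorem Setup.spec_repTable (h : Setup G k p X x σ) (hn : 1 ≤ n)
    (hb : ∀ u : Fin n, σ.arr 10 u ≠ 0 ↔ IsBad G X x p k δ u) :
    repTable.Spec σ (n * (n * 1)) (fun τ => ∀ u < n, τ.arr 11 u ≠ 0 ↔ IsRepNat G X x p k δ u) := by
  refine (spec_fill (A := n * 1) n (fun u z => u < n → (z ≠ 0 ↔ IsRepNat G X x p k δ u)) hn
    rfl (by exact h.var_n.le) (by omega) ?_).imp ?_
  · intro u hun τ hτ _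
    rw [eval_var, h.var_n] at hun
    have hfr := hτ.setVar (j := u)
    have h' := h.frame hfr rfl
    have hb' : ∀ w : Fin n, (τ.setVar 11 u).arr 10 w ≠ 0 ↔ IsBad G X x p k δ w := by
      rw [hfr.arr 10 rfl]; exact hb
    have h11 : (τ.setVar 11 u).var 11 = u := by simp [State.setVar_var]
    generalize τ.setVar 11 u = τ' at h' h11 hb'
    refine ⟨fits_ite (fits_flat rfl (by omega)) (fun _ => fits_eq (fits_sum n hn rfl
      (by simpa only [eval_var, h11] using hun.le) le_rfl fun _ _ => fits_flat rfl le_rfl)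
      (fits_flat rfl (by omega))) fun _ => fits_flat rfl (by omega), fun hu => ?_⟩
    have hx : (get 10 (var 11)).Holds τ' ↔ IsBad G X x p k δ ⟨u, hu⟩ := by
      rw [← hb', Holds, eval_get, eval_var, h11]
    have hrep : IsRepNat G X x p k δ u ↔ IsRep G X x p k δ ⟨u, hu⟩ :=
      ⟨fun ⟨_, h⟩ => h, fun h => ⟨hu, h⟩⟩
    change Holds _ _ ↔ _
    rw [hrep, holds_and, holds_not, holds_sum, hx, eval_var, h11, IsRep]
    refine and_congr Iff.rfl ?_
    have key : ∀ w (hw : w < n), (and (get 10 (var 20)) (entry 0 (var 20) (var 11))).Holds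
        (τ'.setVar 20 w) ↔ IsBad G X x p k δ ⟨w, hw⟩ ∧ G.Adj ⟨w, hw⟩ ⟨u, hu⟩ := by
      intro w hw
      have h'' : Setup G k p X x (τ'.setVar 20 w) := h'.setVar (by simp)
      rw [holds_and, h''.holds_adj (u := ⟨w, hw⟩) (v := ⟨u, hu⟩), ← hb']
      · simp [Holds, Tm.eval, State.setVar_var, State.setVar_arr]
      · simp [Tm.eval, State.setVar_var]
      · simp [Tm.eval, State.setVar_var, h11]
    constructor
    · intro hno w hw hbw ha
      exact hno ⟨w, hw, (key w w.2).2 ⟨hbw, ha⟩⟩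
    · rintro hno ⟨w, hw, hk⟩
      rw [key w (hw.trans hu)] at hk
      exact hno ⟨w, hw.trans hu⟩ hw hk.1 hk.2
  · intro τ _ h' u hu
    exact h' u (by rwa [eval_var, h.var_n]) hu

open Classical in
theorem eval_count {P : ℕ → Prop} {N : Tm} (hN : N.eval σ ≤ n)
    (hr : ∀ u < n, σ.arr 11 u ≠ 0 ↔ P u) : (countTm N).eval σ = Nat.count P (N.eval σ) := by
  rw [eval_sum, Nat.count_eq_card_filter_range, Finset.card_filter]
  refine Finset.sum_congr rfl fun u hu => ?_
  rw [eval_ite]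
  refine if_congr ?_ rfl rfl
  rw [← hr u (by have := Finset.mem_range.1 hu; omega)]
  simp [Holds, Tm.eval, State.setVar_var, State.setVar_arr]

theorem fits_count {N : Tm} (hn : 1 ≤ n) (hf : N.flat = true) (hN : N.eval σ ≤ n) :
    (countTm N).Fits σ (n * 1) :=
  fits_sum n hn hf hN le_rfl fun _ _ => fits_flat rfl le_rfl

/-- Ranking the representatives makes them addressable: in the sum for the entry `i` of array 13,
only the representative of rank `i` contributes. -/
theorem Setup.spec_guessTables (h : Setup G k p X x σ) (hG : G.Connected) (hn : 1 ≤ n) (hp : 1 ≤ p)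
    (hpn : p ≤ n) {s : Fin n} {g : ℕ} (hs : σ.var 6 = s) (hg : σ.var 7 = g)
    (hgp : g < 2 ^ (2 * p)) :
    guessTables.Spec σ (n ^ 2 * p) (Guessed G k p X x (guess G x p s (digit g))) := by
  classical
  set δ := guess G x p s (digit g) with hδ
  have e1 : p * (n * (p * 1)) ≤ n ^ 2 * p := by
    calc p * (n * (p * 1)) = p * n * p := by ring
      _ ≤ n * n * p := by gcongr
      _ = n ^ 2 * p := by ring
  have e2 : n * (p * 1) ≤ n ^ 2 * p := by
    calc n * (p * 1) = n * 1 * p := by ring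
      _ ≤ n * n * p := by gcongr
      _ = n ^ 2 * p := by ring
  have e3 : n * (n * 1) ≤ n ^ 2 * p := by
    calc n * (n * 1) = n * n * 1 := by ring
      _ ≤ n * n * p := by gcongr
      _ = n ^ 2 * p := by ring
  have e4 : n * 1 ≤ n ^ 2 * p := le_trans (by nlinarith) e3
  refine spec_seq ((h.spec_deltaTable hG hn hp hpn hs hg hgp).mono e1) fun τ₁ hτ₁ hδ₁ => ?_
  have h := h.frame hτ₁ rfl
  refine spec_seq ((h.spec_badTable hn hp hδ₁).mono e2) fun τ₂ hτ₂ hb => ?_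
  have h := h.frame hτ₂ rfl
  refine spec_seq ((h.spec_repTable hn hb).mono e3) fun τ₃ hτ₃ hr => ?_
  have h := h.frame hτ₃ rfl
  refine spec_seq (R := fun τ => ∀ u < n, τ.arr 12 u = Nat.count (IsRepNat G X x p k δ) u)
    (((spec_fill (A := n * 1) n (fun u z => z = Nat.count (IsRepNat G X x p k δ) u) hn rfl
      (by exact h.var_n.le) (by omega) ?_).imp ?_).mono e3) ?_
  · intro u hu τ hτ _
    rw [eval_var, h.var_n] at hu
    have h11 : (var 11).eval (τ.setVar 11 u) = u := by simp [Tm.eval, State.setVar_var]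
    refine ⟨fits_count hn rfl (h11 ▸ hu.le), ?_⟩
    rw [eval_count (n := n) (P := IsRepNat G X x p k δ) (by rw [h11]; exact hu.le), h11]
    rw [State.setVar_arr, hτ.arr 11 rfl]
    exact hr
  · intro τ _ h' u hu
    exact h' u (by rwa [eval_var, h.var_n])
  intro τ₄ hτ₄ hrank
  have h := h.frame hτ₄ rfl
  have hr : ∀ u < n, τ₄.arr 11 u ≠ 0 ↔ IsRepNat G X x p k δ u := by rw [hτ₄.arr 11 rfl]; exact hr
  refine spec_seq (R := fun τ => τ.var 9 = numReps G X x p k δ)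
    (spec_set ((fits_count hn rfl (by exact h.var_n.le)).mono e4) ?_) ?_
  · rw [eval_count (n := n) (P := IsRepNat G X x p k δ) (by exact h.var_n.le) hr]
    simp [State.setVar_var, Tm.eval, h.var_n, numReps]
  intro τ₅ hτ₅ hv9
  have h := h.frame hτ₅ rfl
  have hr : ∀ u < n, τ₅.arr 11 u ≠ 0 ↔ IsRepNat G X x p k δ u := by rw [hτ₅.arr 11 rfl]; exact hr
  have hrank : ∀ u < n, τ₅.arr 12 u = Nat.count (IsRepNat G X x p k δ) u := by
    rw [hτ₅.arr 12 rfl]; exact hrank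
  have hRn : numReps G X x p k δ ≤ n := Nat.count_le _
  refine ((spec_fill (A := n * 1) n (fun i z => i < numReps G X x p k δ →
    z = Nat.nth (IsRepNat G X x p k δ) i) hn rfl (by rw [eval_var, hv9]; exact hRn)
      (by omega) ?_).mono e3).imp ?_
  · intro i _ τ hτ _
    have h' := h.frame (hτ.setVar (j := i)) rfl
    refine ⟨fits_sum n hn rfl (by exact h'.var_n.le) le_rfl fun _ _ => fits_flat rfl le_rfl,
      fun hi => ?_⟩
    obtain ⟨u, hu, hur⟩ := lt_of_lt_numReps hi
    have hval : ∀ w < n, (ite (and (get 11 (var 20)) (eq (get 12 (var 20)) (var 11))) (var 20)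
        (lit 0)).eval ((τ.setVar 11 i).setVar 20 w) =
        if IsRepNat G X x p k δ w ∧ Nat.count (IsRepNat G X x p k δ) w = i then w else 0 := by
      intro w hw
      rw [eval_ite]
      refine if_congr ?_ ?_ rfl
      · rw [holds_and, holds_eq, ← hr w hw, ← hrank w hw]
        simp [Holds, Tm.eval, State.setVar_var, State.setVar_arr, hτ.arr 11 rfl, hτ.arr 12 rfl]
      · simp [Tm.eval, State.setVar_var]
    have huN : IsRepNat G X x p k δ u := ⟨u.2, hur⟩
    have hcu : Nat.count (IsRepNat G X x p k δ) u = i := by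
      rw [hu]
      refine Nat.count_nth fun hf => hi.trans_le ?_
      exact Nat.count_le_card hf n
    rw [eval_sum, eval_var, h'.var_n, Finset.sum_congr rfl fun w hw => hval w (Finset.mem_range.1 hw),
      Finset.sum_eq_single u.val]
    · rw [if_pos ⟨huN, hcu⟩, hu]
    · intro w _ hwu
      rw [if_neg]
      rintro ⟨hw, hwi⟩
      exact hwu (Nat.count_injective hw huN (hwi.trans hcu.symm))
    · intro hn'
      exact absurd (Finset.mem_range.2 u.2) hn'
  · intro τ hτ h'
    refine ⟨?_, (hτ.var 9 rfl).trans hv9, fun i hi => h' i (by rwa [eval_var, hv9]) hi⟩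
    rw [hτ.arr 9 rfl, hτ₅.arr 9 rfl, hτ₄.arr 9 rfl, hτ₃.arr 9 rfl, hτ₂.arr 9 rfl]
    exact hδ₁

end
end RAM

/-! ### The dynamic program and the main algorithm -/

namespace RAM

open Tm Cmd MESP

/-- The term for `Meets`. -/
abbrev meetsTm (e w : Tm) : Tm :=
  ite (lt e (var 5)) (leTm (entry 4 (get 7 e) w) (get 9 e))
    (and (not (get 8 w)) (add (eq w (get 13 (sub e (var 5))))
      (entry 0 w (get 13 (sub e (var 5))))))

/-- The term for `rest`. -/
abbrev restTm : Tm :=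
  sum 21 (var 10) (ite (and (bitTm (var 21) (var 13)) (not (meetsTm (var 21) (var 12))))
    (get 2 (var 21)) (lit 0))

/-- Computes `Reach`. -/
def reachTable : Cmd :=
  loop 11 (var 0) (loop 12 (var 0) (loop 13 (var 4)
    (store 14 (add (get 5 (add (get 1 (var 11)) (var 12))) (var 13))
      (ite (var 11)
        (sum 20 (var 0) (and (entry 0 (var 12) (var 20))
          (get 14 (add (get 5 (add (get 1 (sub (var 11) (lit 1))) (var 20))) restTm))))
        (and (eq (var 12) (var 6)) (not restTm))))))

/-- Checks one guess. -/
def checkGuess : Cmd :=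
  .seq guessTables (.seq (set 10 (add (var 5) (var 9)))
    (when (and (leTm (var 9) (add (var 5) (lit 1)))
        (not (sum 20 (var 5) (lt (var 1) (get 9 (var 20))))))
      (.seq reachTable (set 8 (add (var 8) (sum 20 (var 0)
        (get 14 (add (get 5 (add (get 1 (entry 4 (var 20) (var 6))) (var 20)))
          (sub (get 2 (var 10)) (lit 1))))))))))

/-- Decides the problem. -/
def decideMESP : Cmd :=
  .seq prepare (.seq search (.seq memTable (.seq
    (set 8 (sum 20 (var 0) (sum 21 (var 0) (eq (add (entry 4 (var 20) (var 21)) (lit 1)) (var 0)))))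
    (.seq (when (var 1) (loop 6 (var 0) (loop 7 (get 2 (add (var 5) (var 5))) checkGuess)))
      (set 0 (lt (lit 0) (var 8)))))))

section

variable {n k p : ℕ} {G : SimpleGraph (Fin n)} {X : Finset (Fin n)} {x : ℕ → Fin n} {δ : ℕ → ℕ}
  {σ τ : State} {c : Cmd}

theorem Guessed.setVar (h : Guessed G k p X x δ σ) {y i : ℕ} (hy : y ≠ 9) :
    Guessed G k p X x δ (σ.setVar y i) :=
  h.congr (by rw [State.setVar_var, if_neg hy.symm]) rfl rfl

theorem Setup.holds_meets (h : Setup G k p X x σ) (hδ : Guessed G k p X x δ σ) {e w : Tm}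
    {v : Fin n} (he : e.eval σ < p + numReps G X x p k δ) (hw : w.eval σ = v) :
    (meetsTm e w).Holds σ ↔ Meets G X x p k δ (e.eval σ) v := by
  rw [holds_ite, holds_lt, eval_var, h.var_p, Meets]
  by_cases hep : e.eval σ < p
  · rw [if_pos hep, if_pos hep, holds_le, h.eval_dist (u := x (e.eval σ)) (v := v) _ hw, eval_get,
      hδ.delta _ hep]
    rw [eval_get, h.xs _ hep]
  · rw [if_neg hep, if_neg hep]
    obtain ⟨u, hu, -⟩ := lt_of_lt_numReps (G := G) (X := X) (x := x) (p := p) (k := k) (δ := δ)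
      (i := e.eval σ - p) (by omega)
    have hrep : (get 13 (sub e (var 5))).eval σ = u := by
      rw [eval_get, eval_sub, eval_var, h.var_p, hδ.rep _ (by omega), hu]
    have hX : (get 8 w).Holds σ ↔ v ∈ X := by rw [← h.inX, Holds, eval_get, hw]
    rw [holds_and, holds_not, holds_add, holds_eq, hX, hrep, hw,
      h.holds_adj (u := v) (v := u) hw hrep]
    constructor
    · rintro ⟨h1, h2⟩
      exact ⟨u, hu, h1, h2.imp_left Fin.ext⟩
    · rintro ⟨u', hu', h1, h2⟩
      obtain rfl : u' = u := Fin.ext (hu'.trans hu.symm)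
      exact ⟨h1, h2.imp_left (congrArg _)⟩

theorem Setup.eval_rest (h : Setup G k p X x σ) (hδ : Guessed G k p X x δ σ) (hpn : p ≤ n)
    (hr : numReps G X x p k δ ≤ p + 1) (hm : σ.var 10 = p + numReps G X x p k δ) {v : Fin n} {S : ℕ}
    (h12 : σ.var 12 = v) (h13 : σ.var 13 = S) (hS : S < 2 ^ (2 * p + 1)) :
    restTm.eval σ = rest (Meets G X x p k δ) (p + numReps G X x p k δ) v S := by
  rw [eval_sum, eval_var, hm, rest, ofBits]
  refine Finset.sum_congr rfl fun e he => ?_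
  have he := Finset.mem_range.1 he
  have h' : Setup G k p X x (σ.setVar 21 e) := h.setVar (by simp)
  have hδ' : Guessed G k p X x δ (σ.setVar 21 e) := hδ.setVar (by simp)
  have h21 : (var 21).eval (σ.setVar 21 e) = e := by simp [Tm.eval, State.setVar_var]
  have h13' : (var 13).eval (σ.setVar 21 e) = S := by simp [Tm.eval, State.setVar_var, h13]
  have hiff : (and (bitTm (var 21) (var 13)) (not (meetsTm (var 21) (var 12)))).Holds
      (σ.setVar 21 e) ↔ S.testBit e = true ∧ ¬ Meets G X x p k δ e v := by
    rw [holds_and, holds_not, h'.holds_bit hpn (by rw [h21]; omega) (by rw [h13']; exact hS),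
      h'.holds_meets hδ' (v := v) (by rw [h21]; exact he)
        (by simp [Tm.eval, State.setVar_var, h12]), h21, h13']
  rw [eval_ite]
  by_cases hb : S.testBit e = true ∧ ¬ Meets G X x p k δ e v
  · rw [if_pos (hiff.2 hb), if_pos hb, eval_get, h21, h'.pow e (by omega)]
  · rw [if_neg (mt hiff.1 hb), if_neg hb, eval_lit]

/-- The number of tasks is at most p + (p + 1) ≤ 3p, by `1 ≤ p`. -/
theorem Setup.fits_rest (hp : 1 ≤ p)
    (hr : numReps G X x p k δ ≤ p + 1) (hm : σ.var 10 = p + numReps G X x p k δ) :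
    restTm.Fits σ (3 * p * 1) :=
  fits_sum (3 * p) (by omega) rfl (by rw [eval_var, hm]; omega) le_rfl fun _ _ => fits_flat rfl le_rfl

theorem Setup.eval_index (h : Setup G k p X x σ) {a b : Tm} (ha : a.eval σ < n)
    (hb : b.eval σ < n) :
    (get 5 (add (get 1 a) b)).eval σ = (a.eval σ * n + b.eval σ) * 2 ^ (2 * p + 1) := by
  have h1 := cell_lt ha hb
  rw [eval_get, eval_add, eval_get, h.mul _ (by
    exact ha.trans_le (Nat.le_mul_of_pos_left _ (by omega))), h.mulM _ (by omega)]

/-- Rows are indexed by the length, so the entries for length `l + 1` use only finished rows, as in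
`reach_succ`. There are n^2 * 2^(2p+1) entries with a sum over n neighbours each, and every
remaining mask is recomputed in 3p steps. -/
theorem Setup.spec_reachTable (h : Setup G k p X x σ) (hδ : Guessed G k p X x δ σ) (hn : 1 ≤ n)
    (hp : 1 ≤ p) (hpn : p ≤ n) (hr : numReps G X x p k δ ≤ p + 1)
    (hm : σ.var 10 = p + numReps G X x p k δ) {s : Fin n} (hs : σ.var 6 = s) :
    reachTable.Spec σ (n * (n * (2 ^ (2 * p + 1) * (n * (3 * p * 1)))))
      (fun τ => ∀ l < n, ∀ v < n, ∀ S < 2 ^ (2 * p + 1), ∀ hv : v < n,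
        τ.arr 14 ((l * n + v) * 2 ^ (2 * p + 1) + S) ≠ 0 ↔
          Reach G (Meets G X x p k δ) (p + numReps G X x p k δ) s l ⟨v, hv⟩ S) := by
  set m := p + numReps G X x p k δ with hm'
  have hB1 : 1 ≤ 3 * p * 1 := by omega
  have hA1 : 1 ≤ n * (3 * p * 1) := Nat.mul_pos hn hB1
  refine spec_fill₃ n n (2 ^ (2 * p + 1)) (fun l v S z => ∀ hv : v < n, z ≠ 0 ↔
    Reach G (Meets G X x p k δ) m s l ⟨v, hv⟩ S) (by decide) (by decide) (by decide) hn hn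
    Nat.one_le_two_pow hA1 rfl rfl rfl (by exact h.var_n)
    (fun τ hτ => ⟨(h.frame hτ rfl).var_n, (h.frame hτ rfl).var_M⟩) ?_
  intro l hl v hv S hS τ hτ h11 h12 h13 hI
  have h := h.frame hτ rfl
  have hδ := hδ.frame hτ rfl
  have hm : τ.var 10 = m := (hτ.var 10 rfl).trans hm
  have hs : τ.var 6 = s := (hτ.var 6 rfl).trans hs
  have hrest := h.eval_rest hδ hpn hr hm (v := ⟨v, hv⟩) h12 h13 hS
  refine ⟨⟨fits_flat rfl hA1, ?_⟩, ?_, fun hv => ?_⟩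
  · rw [eval_add, h.eval_index (by rw [eval_var, h11]; exact hl) (by rw [eval_var, h12]; exact hv)]
    simp only [eval_var, h11, h12, h13]
  · have hle : 3 * p * 1 ≤ n * (3 * p * 1) := Nat.le_mul_of_pos_left _ hn
    refine fits_ite (fits_flat rfl hA1) (fun _ => fits_sum n hn rfl (by exact h.var_n.le) hB1
      fun i _ => ?_) fun _ => ?_
    · exact fits_ite (fits_flat rfl hB1) (fun _ => fits_get (fits_add (fits_flat rfl hB1)
        (Setup.fits_rest hp hr (by rw [State.setVar_var, if_neg (by decide)]; exact hm))))
        fun _ => fits_flat rfl hB1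
    · exact fits_ite (fits_flat rfl hA1) (fun _ => fits_eq ((Setup.fits_rest hp hr hm).mono hle)
        (fits_flat rfl hA1)) fun _ => fits_flat rfl hA1
  · change Holds _ _ ↔ _
    have hv11 : (var 11).Holds τ ↔ l ≠ 0 := by rw [← h11]; rfl
    rw [holds_ite, hv11]
    rcases l with _ | l
    · rw [if_neg (by simp), holds_and, holds_not, holds_eq, Holds, hrest, reach_zero]
      simp only [eval_var, h12, hs, not_not]
      rw [← Fin.val_inj]
    · rw [if_pos (by simp), holds_sum, reach_succ, eval_var, h.var_n, Fin.exists_iff]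
      refine exists_congr fun w => ?_
      rw [← exists_prop]
      refine exists_congr fun hw => ?_
      have h' : Setup G k p X x (τ.setVar 20 w) := h.setVar (by simp)
      have hδ' : Guessed G k p X x δ (τ.setVar 20 w) := hδ.setVar (by simp)
      have hrest := h'.eval_rest hδ' hpn hr (v := ⟨v, hv⟩) (S := S)
        (by rw [State.setVar_var, if_neg (by decide)]; exact hm)
        (by rw [State.setVar_var, if_neg (by decide)]; exact h12)
        (by rw [State.setVar_var, if_neg (by decide)]; exact h13) hS
      have h20 : (var 20).eval (τ.setVar 20 w) = w := by simp [Tm.eval, State.setVar_var]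
      have hl1 : (sub (var 11) (lit 1)).eval (τ.setVar 20 w) = l := by
        simp [Tm.eval, State.setVar_var, h11]
      rw [holds_and, h'.holds_adj (u := ⟨v, hv⟩) (v := ⟨w, hw⟩)
        (by simp [Tm.eval, State.setVar_var, h12]) h20]
      refine and_congr Iff.rfl ?_
      rw [Holds, eval_get, eval_add, h'.eval_index (by rw [hl1]; omega) (by rw [h20]; exact hw),
        hl1, h20, hrest]
      refine hI l (Nat.lt_succ_self l) w hw _ ?_ hw
      -- The remaining mask lies within the table because at most 2p + 1 tasks occur.
      exact (ofBits_lt _ _).trans_le (Nat.pow_le_pow_right (by norm_num) (by omega))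

/-- The conditional ensures that all masks fit into the table before it is filled. A success is
added to variable 8, so earlier successes are preserved. The constant 6 is 2 * 3, from 2^(2p+1)
masks and 3p tasks. -/
theorem Setup.spec_checkGuess (h : Setup G k p X x σ) (hG : G.Connected) (hn : 1 ≤ n) (hp : 1 ≤ p)
    (hpn : p ≤ n) {s : Fin n} {g : ℕ} (hs : σ.var 6 = s) (hg : σ.var 7 = g)
    (hgp : g < 2 ^ (2 * p)) :
    checkGuess.Spec σ (6 * (n ^ 3 * p * 2 ^ (2 * p))) (fun τ => τ.var 8 ≠ 0 ↔ σ.var 8 ≠ 0 ∨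
      Accepts G X x p k (guess G x p s (digit g)) s) := by
  set δ := guess G x p s (digit g) with hδdef
  set m := p + numReps G X x p k δ with hm'
  set T := 6 * (n ^ 3 * p * 2 ^ (2 * p)) with hT
  have h1 : 1 ≤ 2 ^ (2 * p) := Nat.one_le_two_pow
  have e1 : n ^ 2 * p ≤ T := by
    calc n ^ 2 * p = 1 * (n ^ 2 * p * 1) := by ring
      _ ≤ 6 * (n ^ 3 * p * 2 ^ (2 * p)) := by gcongr <;> omega
  have e2 : n * (n * (2 ^ (2 * p + 1) * (n * (3 * p * 1)))) = T := by rw [hT, pow_succ]; ring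
  have e3 : n * 1 ≤ n ^ 2 * p := by
    calc n * 1 = n ^ 1 * 1 := by ring
      _ ≤ n ^ 2 * p := by gcongr; omega
  have e4 : p * 1 ≤ n ^ 2 * p := by
    calc p * 1 = 1 * p := by ring
      _ ≤ n ^ 2 * p := by gcongr; exact Nat.one_le_pow _ _ hn
  have hT1 : 1 ≤ T := by omega
  refine spec_seq ((h.spec_guessTables hG hn hp hpn hs hg hgp).mono e1) fun τ₁ hτ₁ hδ => ?_
  rw [← hδdef] at hδ
  have h := h.frame hτ₁ rfl
  have hs : τ₁.var 6 = s := (hτ₁.var 6 rfl).trans hs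
  have h8 : τ₁.var 8 = σ.var 8 := hτ₁.var 8 rfl
  refine spec_seq (R := fun τ => τ.var 10 = m) (spec_set (fits_flat rfl hT1) ?_) ?_
  · simp [State.setVar_var, Tm.eval, h.var_p, hδ.var_r, hm', hδdef]
  intro τ₂ hτ₂ hm
  have h := h.frame hτ₂ rfl
  have hδ := hδ.frame hτ₂ rfl
  have hs : τ₂.var 6 = s := (hτ₂.var 6 rfl).trans hs
  have h8 : τ₂.var 8 = σ.var 8 := (hτ₂.var 8 rfl).trans h8
  have hcond : (and (leTm (var 9) (add (var 5) (lit 1)))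
        (not (sum 20 (var 5) (lt (var 1) (get 9 (var 20)))))).Holds τ₂ ↔
      numReps G X x p k δ ≤ p + 1 ∧ ∀ e < p, δ e ≤ k := by
    rw [holds_and, holds_le, holds_not, holds_sum]
    simp only [Tm.eval, hδ.var_r, h.var_p]
    refine and_congr Iff.rfl ?_
    push Not
    refine forall_congr' fun e => forall_congr' fun he => ?_
    rw [holds_lt, not_lt]
    simp [Tm.eval, State.setVar_var, State.setVar_arr, hδ.delta e he, h.var_k]
  refine spec_when ?_ (fun hb => ?_) fun hb => ?_
  · exact fits_ite (fits_flat rfl hT1) (fun _ => fits_eq ((fits_sum p hp rfl (by exact h.var_p.le)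
      le_rfl fun _ _ => fits_flat rfl le_rfl).mono (e4.trans e1)) (fits_flat rfl hT1))
      fun _ => fits_flat rfl hT1
  · rw [hcond] at hb
    refine spec_seq (e2 ▸ h.spec_reachTable hδ hn hp hpn hb.1 hm hs) fun τ₃ hτ₃ hR => ?_
    have h := h.frame hτ₃ rfl
    have hs : τ₃.var 6 = s := (hτ₃.var 6 rfl).trans hs
    have hm : τ₃.var 10 = m := (hτ₃.var 10 rfl).trans hm
    have h8 : τ₃.var 8 = σ.var 8 := (hτ₃.var 8 rfl).trans h8
    refine spec_set ?_ ?_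
    · exact fits_add (fits_flat rfl hT1) ((fits_sum n hn rfl (by exact h.var_n.le) le_rfl
        fun _ _ => fits_flat rfl le_rfl).mono (e3.trans e1))
    · rw [State.setVar_var, if_pos rfl]
      change Holds _ _ ↔ _
      rw [holds_add, holds_sum, eval_var, h.var_n, Holds, eval_var, h8, Accepts, and_iff_right hb,
        Fin.exists_iff]
      refine or_congr Iff.rfl (exists_congr fun v => ?_)
      rw [← exists_prop]
      refine exists_congr fun hv => ?_
      have h' : Setup G k p X x (τ₃.setVar 20 v) := h.setVar (by simp)
      have h20 : (var 20).eval (τ₃.setVar 20 v) = v := by simp [Tm.eval, State.setVar_var]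
      have hd := h'.eval_dist (i := var 20) (j := var 6) (u := ⟨v, hv⟩) (v := s) h20
        (by simp [Tm.eval, State.setVar_var, hs])
      have hdn := dist_lt_card hG ⟨v, hv⟩ s
      rw [Fintype.card_fin] at hdn
      have hfull : (sub (get 2 (var 10)) (lit 1)).eval (τ₃.setVar 20 v) = 2 ^ m - 1 := by
        rw [eval_sub, eval_get, eval_lit, eval_var, State.setVar_var, if_neg (by decide), hm,
          h'.pow m (by omega)]
      rw [Holds, eval_get, eval_add, h'.eval_index (by rw [hd]; exact hdn) (by rw [h20]; exact hv),
        hd, h20, hfull]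
      refine hR _ hdn v hv _ ?_ hv
      have : 2 ^ m ≤ 2 ^ (2 * p + 1) := Nat.pow_le_pow_right (by norm_num) (by omega)
      have : 1 ≤ 2 ^ m := Nat.one_le_two_pow
      omega
  · rw [hcond] at hb
    rw [h8]
    exact ⟨Or.inl, fun h' => h'.resolve_right fun h'' => hb h''.1⟩

/-- Each stage stays below the common bound: the main loop needs 6 * 16^p * p * n^4 and the search
at most n^5 and 16^p * p * n up to constants, so the exponent 6 leaves room. The guesses are tried
only for k ≥ 1; for k = 0 the test for two vertices at distance n - 1 already decides. -/
theorem spec_decideMESP (hG : G.Connected) (hp : distToCluster G = p) (hp1 : 1 ≤ p)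
    (h : Input G k σ) :
    decideMESP.Spec σ (132 * (2 ^ (4 * p) * p * n ^ 6))
      (fun τ => (IsYesInstance G k → τ.var 0 = 1) ∧ (¬ IsYesInstance G k → τ.var 0 = 0)) := by
  have hpn : p ≤ n := by
    obtain ⟨X, -, hc⟩ := exists_hitsP3_card G
    rw [← hp, ← hc]
    simpa using Finset.card_le_univ X
  have hn : 1 ≤ n := hp1.trans hpn
  set Y := 2 ^ (4 * p) * p * n ^ 6 with hY
  have hW1 : 1 ≤ 2 ^ (4 * p) := Nat.one_le_two_pow
  have hW2 : 2 ^ (2 * p) ≤ 2 ^ (4 * p) := Nat.pow_le_pow_right (by norm_num) (by omega)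
  have hpow : ∀ a ≤ 6, n ^ a ≤ n ^ 6 := fun a ha => Nat.pow_le_pow_right hn ha
  have hmono : ∀ a ≤ 6, ∀ w ≤ 2 ^ (4 * p), ∀ q ≤ p, w * q * n ^ a ≤ Y := fun a ha w hw q hq =>
    Nat.mul_le_mul (Nat.mul_le_mul hw hq) (hpow a ha)
  have c4 : n ^ 4 ≤ Y := by simpa using hmono 4 (by norm_num) 1 hW1 1 hp1
  have c2 : n ^ 2 ≤ Y := by simpa using hmono 2 (by norm_num) 1 hW1 1 hp1
  have c5 : n ^ 5 ≤ Y := by simpa using hmono 5 (by norm_num) 1 hW1 1 hp1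
  have c1 : 2 ^ (4 * p) * p * n ^ 1 ≤ Y := hmono 1 (by norm_num) _ le_rfl p le_rfl
  have c0 : 2 ^ (4 * p) * 1 * n ^ 1 ≤ Y := hmono 1 (by norm_num) _ le_rfl 1 hp1
  have c6 : 2 ^ (2 * p) * 1 * n ^ 5 ≤ Y := hmono 5 (by norm_num) _ hW2 1 hp1
  have c7 : 2 ^ (4 * p) * p * n ^ 4 ≤ Y := hmono 4 (by norm_num) _ le_rfl p le_rfl
  have hY1 : 1 ≤ 132 * Y := by have := Nat.one_le_pow 4 n hn; omega
  have hsearch : 2 * n * (49 * n ^ 4 + (2 * p + 2) * (4 * 16 ^ p) + 2 ^ (2 * p) * n ^ 4) ≤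
      132 * Y := by
    have : (16 : ℕ) ^ p = 2 ^ (4 * p) := by rw [pow_mul]; norm_num
    rw [this]
    -- The constant is 132 = 98 + 16 + 16 + 2, from the search, which has the largest coefficients.
    calc _ = 98 * n ^ 5 + 16 * (2 ^ (4 * p) * p * n ^ 1) + 16 * (2 ^ (4 * p) * 1 * n ^ 1) +
          2 * (2 ^ (2 * p) * 1 * n ^ 5) := by ring
      _ ≤ 132 * Y := by omega
  have hmain : n * (2 ^ (2 * p) * (6 * (n ^ 3 * p * 2 ^ (2 * p)))) ≤ 132 * Y := by
    calc _ = 6 * (2 ^ (2 * p + 2 * p) * p * n ^ 4) := by rw [pow_add]; ring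
      _ = 6 * (2 ^ (4 * p) * p * n ^ 4) := by rw [show 2 * p + 2 * p = 4 * p by ring]
      _ ≤ 132 * Y := by omega
  have hnn : n * (n * 1) ≤ 132 * Y := by
    calc n * (n * 1) = n ^ 2 := by ring
      _ ≤ 132 * Y := by omega
  refine spec_seq ((spec_prepare hn hG h).mono (by omega)) fun τ₁ _ h₁ => ?_
  refine spec_seq ((spec_search hn hp hpn h₁).mono hsearch) fun τ₂ _ h₂ => ?_
  obtain ⟨l, h₂⟩ := h₂
  refine spec_seq ((h₂.spec_memTable hn hpn).mono hnn) fun τ₃ _ h₃ => ?_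
  obtain ⟨X, x, h₃, hX, hc, hx⟩ := h₃
  have h0 : (sum 20 (var 0) (sum 21 (var 0)
      (eq (add (entry 4 (var 20) (var 21)) (lit 1)) (var 0)))).Holds τ₃ ↔
      ∃ s v, G.dist s v + 1 = n := by
    rw [holds_sum, eval_var, h₃.var_n, Fin.exists_iff]
    refine exists_congr fun s => ?_
    rw [← exists_prop]
    refine exists_congr fun hs => ?_
    have h' : Setup G k p X x (τ₃.setVar 20 s) := h₃.setVar (by simp)
    rw [holds_sum, eval_var, h'.var_n, Fin.exists_iff]
    refine exists_congr fun v => ?_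
    rw [← exists_prop]
    refine exists_congr fun hv => ?_
    have h'' : Setup G k p X x ((τ₃.setVar 20 s).setVar 21 v) := h'.setVar (by simp)
    rw [holds_eq, eval_var, h''.var_n, eval_add, eval_lit,
      h''.eval_dist (u := ⟨s, hs⟩) (v := ⟨v, hv⟩)] <;> simp [Tm.eval, State.setVar_var]
  refine spec_seq (R := fun τ => τ.var 8 ≠ 0 ↔ ∃ s v, G.dist s v + 1 = n) (spec_set ?_ ?_) ?_
  · exact (fits_sum n hn rfl (by exact h₃.var_n.le) (by omega) fun s _ => fits_sum n hn rfl
      (by exact ((h₃.setVar (by simp) : Setup G k p X x (τ₃.setVar 20 s)).var_n.le)) le_rfl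
      fun _ _ => fits_flat rfl le_rfl).mono hnn
  · rw [← h0, State.setVar_var, if_pos rfl, Holds]
  intro τ₄ hτ₄ h8
  have h₄ := h₃.frame hτ₄ rfl
  refine spec_seq (R := fun τ => τ.var 8 ≠ 0 ↔ IsYesInstance G k) (spec_when (fits_flat rfl hY1) ?_ ?_)
    ?_
  · intro hk
    rw [Holds, eval_var, h₄.var_k] at hk
    have hk : 1 ≤ k := Nat.one_le_iff_ne_zero.2 hk
    refine Spec.mono ?_ hmain
    have hT1 : 1 ≤ 6 * (n ^ 3 * p * 2 ^ (2 * p)) := by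
      have : 1 ≤ n ^ 3 * p * 2 ^ (2 * p) := by rw [Nat.succ_le_iff]; positivity
      omega
    -- Soundness is kept as "answer set implies yes-instance", completeness as "every accepting
    -- guess tried so far has set the answer".
    refine spec_loop n (fun s τ => (τ.var 8 ≠ 0 → IsYesInstance G k) ∧ ∀ s' : Fin n, s'.val < s →
      ∀ g < 2 ^ (2 * p), Accepts G X x p k (guess G x p s' (digit g)) s' → τ.var 8 ≠ 0) hn rfl
      (by exact h₄.var_n.le) (Nat.mul_pos Nat.one_le_two_pow hT1) ?_ ?_ ?_
    · refine ⟨fun h' => ?_, by simp⟩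
      obtain ⟨s, v, hsv⟩ := h8.1 h'
      exact isYesInstance_of_dist hG hsv
    · intro s hs τ hτ hI
      rw [eval_var, h₄.var_n] at hs
      have h₅ := h₄.frame (hτ.setVar (j := s)) rfl
      have h6 : (τ.setVar 6 s).var 6 = s := by simp [State.setVar_var]
      have h8' : (τ.setVar 6 s).var 8 = τ.var 8 := by simp [State.setVar_var]
      rw [← h8'] at hI
      generalize τ.setVar 6 s = τ' at h₅ h6 hI
      have hev : (get 2 (add (var 5) (var 5))).eval τ' = 2 ^ (2 * p) := by
        rw [eval_get, eval_add, eval_var, h₅.var_p, h₅.pow _ (by omega), two_mul]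
      refine spec_loop (2 ^ (2 * p)) (fun g τ => (τ.var 8 ≠ 0 → IsYesInstance G k) ∧
        (∀ s' : Fin n, s'.val < s → ∀ g < 2 ^ (2 * p),
          Accepts G X x p k (guess G x p s' (digit g)) s' → τ.var 8 ≠ 0) ∧
        ∀ g' < g, Accepts G X x p k (guess G x p ⟨s, hs⟩ (digit g')) ⟨s, hs⟩ → τ.var 8 ≠ 0)
        Nat.one_le_two_pow rfl hev.le hT1 ⟨hI.1, hI.2, by simp⟩ ?_ ?_
      · intro g hg τ₂ hτ₂ hI₂
        rw [hev] at hg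
        have h₆ := h₅.frame (hτ₂.setVar (j := g)) rfl
        have h6' : (τ₂.setVar 7 g).var 6 = s := (hτ₂.setVar.var 6 rfl).trans h6
        refine (h₆.spec_checkGuess hG hn hp1 hpn (s := ⟨s, hs⟩) h6' (g := g)
          (by simp [State.setVar_var]) hg).imp fun τ₃ _ h' => ?_
        rw [show (τ₂.setVar 7 g).var 8 = τ₂.var 8 by simp [State.setVar_var]] at h'
        refine ⟨fun hne => ?_, fun s' hs' g' hg' ha => h'.2 (Or.inl (hI₂.2.1 s' hs' g' hg' ha)),
          fun g' hg' ha => ?_⟩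
        · rcases h'.1 hne with h1 | h1
          · exact hI₂.1 h1
          · exact isYesInstance_of_accepts hG hX hx hk h1
        · rcases Nat.lt_succ_iff_lt_or_eq.1 hg' with h1 | rfl
          · exact h'.2 (Or.inl (hI₂.2.2 g' h1 ha))
          · exact h'.2 (Or.inr ha)
      · intro τ₂ _ hI₂
        rw [hev] at hI₂
        refine ⟨hI₂.1, fun s' hs' g hg ha => ?_⟩
        rcases Nat.lt_succ_iff_lt_or_eq.1 hs' with h1 | rfl
        · exact hI₂.2.1 s' h1 g hg ha
        · exact hI₂.2.2 g hg ha
    · intro τ _ hI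
      rw [eval_var, h₄.var_n] at hI
      refine ⟨hI.1, fun hyes => ?_⟩
      obtain ⟨s, g, hg, ha⟩ := exists_accepts hG hX hx hc hyes
      exact hI.2 s s.2 g hg ha
  · intro hk
    rw [Holds, eval_var, h₄.var_k, not_not] at hk
    subst hk
    rw [h8]
    exact ⟨fun ⟨s, v, h'⟩ => isYesInstance_of_dist hG h', exists_dist_of_isYesInstance_zero hG⟩
  · intro τ₅ _ h8
    refine spec_set (fits_flat rfl hY1) ⟨fun hyes => ?_, fun hno => ?_⟩
    · rw [State.setVar_var, if_pos rfl, eval_lt, eval_lit, eval_var,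
        if_pos (Nat.pos_of_ne_zero (h8.2 hyes))]
    · rw [State.setVar_var, if_pos rfl, eval_lt, eval_lit, eval_var,
        if_neg fun h' => hno (h8.1 h'.ne')]

theorem input_inputState (G : SimpleGraph (Fin n)) (k : ℕ) : Input G k (inputState G k) := by
  refine ⟨rfl, rfl, fun u v => ?_⟩
  simp only [inputState]
  constructor
  · intro h
    by_contra hno
    refine h (if_neg ?_)
    rintro ⟨-, i, j, hij, he⟩
    obtain ⟨h1, h2⟩ := cell_inj v.2 j.2 he
    exact hno (by rwa [Fin.ext h1, Fin.ext h2])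
  · intro h
    rw [if_pos ⟨rfl, u, v, h, rfl⟩]
    exact one_ne_zero

end

end RAM

/-- One fixed program decides the Minimum Eccentricity Shortest Path Problem: on every connected
graph with distance to cluster graph `p ≥ 1` and every `k`, it halts within `c * 2^(4p) * p * n^6`
steps, with the answer (`1` for yes, `0` for no) in variable `0`. -/
theorem mainTheorem3 :
    ∃ (P : RAM.Prog) (c : ℕ), ∀ (n : ℕ) (G : SimpleGraph (Fin n)) (k p : ℕ),
      G.Connected → MESP.distToCluster G = p → 1 ≤ p →
        ∃ (t : ℕ) (τ : RAM.State),
          RAM.Exec P (RAM.inputState G k) t τ ∧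
          t ≤ c * (2 ^ (4 * p) * p * n ^ 6) ∧
          (MESP.IsYesInstance G k → τ.var 0 = 1) ∧
          (¬ MESP.IsYesInstance G k → τ.var 0 = 0) := by
  -- The constant is the size of the program text times 132, and the scratch variables start above
  -- all variables of the program.
  refine ⟨RAM.decideMESP.comp RAM.decideMESP.bd, RAM.decideMESP.size * 132,
    fun n G k p hG hp hp1 => ?_⟩
  obtain ⟨-, hcost, hyes, hno⟩ := RAM.spec_decideMESP hG hp hp1 (RAM.input_inputState G k)
  obtain ⟨t, τ, hexec, ht, hv⟩ := RAM.decideMESP.exists_exec (RAM.inputState G k)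
  have h0 : τ.var 0 = (RAM.decideMESP.run (RAM.inputState G k)).var 0 :=
    hv 0 (by decide)
  refine ⟨t, τ, hexec, ?_, fun h => h0.trans (hyes h), fun h => h0.trans (hno h)⟩
  rw [mul_assoc]
  exact ht.trans hcost
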